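/- Let $\xi,\rho,\tau>0$ and $T>0$, put $Q_T=(0,\pi)\times(0,T)$ and $$ D=\begin{pmatrix}\xi&-\tfrac12\rho\xi\\0&\xi\end{pmatrix},\qquad A=\begin{pmatrix}\tfrac{\rho}{\tau}&-\tfrac{\rho}{2\tau}\\-\tfrac{2}{\tau}&\tfrac1\tau\end{pmatrix},\qquad B=\begin{pmatrix}1\\0\end{pmatrix}, $$ and consider the linear boundary-controlled phase-field system $$ y_t-Dy_{xx}+Ay=0\ \text{ in }Q_T,\qquad y(0,\cdot)=Bv,\quad y(\pi,\cdot)=0\ \text{ on }(0,T),\qquad y(\cdot,0)=y_0\ \text{ in }(0,\pi), $$ with $y_0\in H^{-1}(0,\pi;\mathbb R^2)$ and control $v\in L^2(0,T)$. Its solution is understood by transposition: $y\in L^2(Q_T;\mathbb R^2)\cap C^0([0,T];H^{-1}(0,\pi;\mathbb R^2))$ and, for every $g\in L^2(Q_T;\mathbb R^2)$, $$ \iint_{Q_T}y\cdot g\,dx\,dt=\langle y_0,\varphi(\cdot,0)\rangle+\int_0^T B^*D^*\varphi_x(0,t)\,v(t)\,dt, $$ where $\varphi\in C^0([0,T];H^1_0(0,\pi;\mathbb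 R^2))\cap L^2(0,T;H^2(0,\pi;\mathbb R^2)\cap H^1_0(0,\pi;\mathbb R^2))$ is the strong solution of $-\varphi_t-D^*\varphi_{xx}+A^*\varphi=g$ in $Q_T$, $\varphi(0,\cdot)=\varphi(\pi,\cdot)=0$, $\varphi(\cdot,T)=0$. The system is called approximately controllable in $H^{-1}(0,\pi;\mathbb R^2)$ at time $T$ if for all $y_0,y_1\in H^{-1}(0,\pi;\mathbb R^2)$ and all $\varepsilon>0$ there is $v\in L^2(0,T)$ such that the corresponding solution satisfies $\|y(\cdot,T)-y_1\|_{H^{-1}}\le\varepsilon$. **Theorem 1.1.** The system is approximately controllable in $H^{-1}(0,\pi;\mathbb R^2)$ at time $T$ if and only if $$ \xi^2\tau^2(\ell^2-k^2)^2-2\xi\rho\tau(\ell^2+k^2)-2\rho-1\neq0\qquad\text{for all integers }\ell>k\ge1. \tag{H2} $$ Moreover, (H2) holds if and only if the spectrum of $L=-D\partial_{xx}+A$ with domain $H^2\cap H^1_0$ on $(0,\pi)$ is simple, in the sense that every (complex) eigenvalue of $L$ has geometric multiplicity one; and likewise if and only if every eigenvalue of $L^*=-D^*\partial_{xx}+A^*$,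 with the same domain, has geometric multiplicity one. -/

import Mathlib

open MeasureTheory Set
open scoped ContDiff

noncomputable section

namespace PhaseField

/-! ### Function spaces on the interval `(0, π)` -/

/-- The value space `𝕜²` with its Euclidean norm. -/
abbrev Vec (𝕜 : Type) [RCLike 𝕜] : Type := EuclideanSpace 𝕜 (Fin 2)

/-- Lebesgue measure on the open interval `(0, π)`. -/
abbrev spaceMeasure : Measure ℝ := volume.restrict (Ioo 0 Real.pi)

/-- Lebesgue measure on the open interval `(0, T)`. -/
abbrev timeMeasure (T : ℝ) : Measure ℝ := volume.restrict (Ioo 0 T)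

/-- The Hilbert space `L²(0, π; 𝕜²)`. -/
abbrev L2 (𝕜 : Type) [RCLike 𝕜] : Type := Lp (Vec 𝕜) 2 spaceMeasure

/-- `w` is the weak (distributional) derivative of `u` on the interval `(a, b)`, for functions with
values in a normed space: `∫ η' u = - ∫ η w` for every real test function `η ∈ C_c^∞(a, b)`. It is
used for locally integrable `u` and `w` only. -/
def HasWeakDeriv {F : Type*} [NormedAddCommGroup F] [NormedSpace ℝ F] (a b : ℝ)
    (u w : ℝ → F) : Prop :=
  ∀ η : ℝ → ℝ, ContDiff ℝ ∞ η → HasCompactSupport η → tsupport η ⊆ Ioo a b →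
    ∫ x in Ioo a b, deriv η x • u x = - ∫ x in Ioo a b, η x • w x

/-- The Sobolev space `H¹₀(0, π; 𝕜²)`: the closure of the test functions `C_c^∞(0, π; 𝕜²)` for the
`H¹` norm `(‖u‖² + ‖u'‖²)^(1/2)`. Its elements are realized as pairs `(u, u')` in `L² × L²`. -/
def H10 (𝕜 : Type) [RCLike 𝕜] : Submodule 𝕜 (WithLp 2 (L2 𝕜 × L2 𝕜)) :=
  (Submodule.span 𝕜 {p : WithLp 2 (L2 𝕜 × L2 𝕜) | ∃ ζ : ℝ → Vec 𝕜,
    ContDiff ℝ ∞ ζ ∧ HasCompactSupport ζ ∧ tsupport ζ ⊆ Ioo 0 Real.pi ∧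
      p.fst =ᵐ[spaceMeasure] ζ ∧ p.snd =ᵐ[spaceMeasure] deriv ζ}).topologicalClosure

/-- The function `u ∈ L²` underlying an element of `H¹₀`. -/
def valL2 {𝕜 : Type} [RCLike 𝕜] (u : H10 𝕜) : L2 𝕜 := (u : WithLp 2 (L2 𝕜 × L2 𝕜)).fst

/-- The derivative `u_x ∈ L²` of an element `u` of `H¹₀`. -/
def dxL2 {𝕜 : Type} [RCLike 𝕜] (u : H10 𝕜) : L2 𝕜 := (u : WithLp 2 (L2 𝕜 × L2 𝕜)).snd

/-- `H⁻¹(0, π; ℝ²)`: the topological dual of `H¹₀(0, π; ℝ²)`, with the dual norm. The duality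
pairing `⟨y, φ⟩` is function application `y φ`. -/
abbrev Hneg1 : Type := StrongDual ℝ (H10 ℝ)

/-- The usual embedding of `L²(0, π; ℝ²)` into `H⁻¹(0, π; ℝ²)`: `f ↦ (φ ↦ ∫ f · φ)`. -/
def toHneg1 (f : L2 ℝ) : Hneg1 :=
  (innerSL ℝ f) ∘L (WithLp.fstL 2 ℝ (L2 ℝ) (L2 ℝ)) ∘L (H10 ℝ).subtypeL

/-- The action `u ↦ M u` of a constant real `2 × 2` matrix on `L²(0, π; 𝕜²)`. -/
def matAct (𝕜 : Type) [RCLike 𝕜] (M : Matrix (Fin 2) (Fin 2) ℝ) : L2 𝕜 →L[𝕜] L2 𝕜 :=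
  (Matrix.toEuclideanCLM (n := Fin 2) (𝕜 := 𝕜) (M.map (algebraMap ℝ 𝕜))).compLpL 2 spaceMeasure

/-- `c` is the value at `x = 0` of the continuous representative on `[0, π]` of `p`. For
`p ∈ H¹(0, π)` such a `c` exists and is unique. -/
def HasTraceZero (p : L2 ℝ) (c : Vec ℝ) : Prop :=
  ∃ q : ℝ → Vec ℝ, ContinuousOn q (Icc 0 Real.pi) ∧ p =ᵐ[spaceMeasure] q ∧ q 0 = c

/-! ### The matrices of the system -/

/-- The diffusion matrix `D`. -/
def matD (ξ ρ : ℝ) : Matrix (Fin 2) (Fin 2) ℝ := !![ξ, -(1 / 2) * ρ * ξ; 0, ξ]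

/-- The coupling matrix `A`. -/
def matA (ρ τ : ℝ) : Matrix (Fin 2) (Fin 2) ℝ := !![ρ / τ, -(ρ / (2 * τ)); -(2 / τ), 1 / τ]

/-- The control vector `B = (1, 0)`. -/
def vecB : Vec ℝ := !₂[1, 0]

/-- The nonresonance condition on the parameters. -/
def Nonresonance (ξ ρ τ : ℝ) : Prop :=
  ∀ k ℓ : ℕ, 1 ≤ k → k < ℓ →
    ξ ^ 2 * τ ^ 2 * ((ℓ : ℝ) ^ 2 - (k : ℝ) ^ 2) ^ 2
      - 2 * ξ * ρ * τ * ((ℓ : ℝ) ^ 2 + (k : ℝ) ^ 2) - 2 * ρ - 1 ≠ 0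

/-! ### The backward adjoint problem and solutions by transposition -/

/-- `φ ∈ C⁰([0,T]; H¹₀) ∩ L²(0,T; H² ∩ H¹₀)`, with second space derivative `φxx` and time derivative
`φt` in `L²(0,T; L²) = L²(Q_T)`, is the strong solution of the backward problem
`-φ_t - Dᵀ φ_xx + Aᵀ φ = g` in `Q_T`, `φ = 0` at `x = 0, π`, `φ(·, T) = φ₀`. -/
structure IsBackwardSolution (D A : Matrix (Fin 2) (Fin 2) ℝ) (T : ℝ) (g : ℝ → L2 ℝ) (φ₀ : H10 ℝ)
    (φ : ℝ → H10 ℝ) (φxx φt : ℝ → L2 ℝ) : Prop where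
  continuousOn : ContinuousOn φ (Icc 0 T)
  memLp_xx : MemLp φxx 2 (timeMeasure T)
  memLp_t : MemLp φt 2 (timeMeasure T)
  hasWeakDeriv_xx : ∀ᵐ t ∂(timeMeasure T), HasWeakDeriv 0 Real.pi (dxL2 (φ t)) (φxx t)
  hasWeakDeriv_t : HasWeakDeriv 0 T (fun t => valL2 (φ t)) φt
  equation : ∀ᵐ t ∂(timeMeasure T),
    -φt t - matAct ℝ D.transpose (φxx t) + matAct ℝ A.transpose (valL2 (φ t)) = g t
  final : φ T = φ₀

/-- `y ∈ L²(0,T; L²(0,π;ℝ²)) = L²(Q_T; ℝ²)` is the solution by transposition of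
`y_t - D y_xx + A y = 0` in `Q_T`, `y(0, ·) = B v`, `y(π, ·) = 0`, `y(·, 0) = y₀`: for every
`g ∈ L²(Q_T; ℝ²)`, if `φ` is the strong solution of the backward problem with source `g` and zero
final datum, and `γ(t) = φ_x(0, t)`, then
`∬ y · g = ⟨y₀, φ(·, 0)⟩ + ∫ Bᵀ Dᵀ φ_x(0, t) v(t) dt`. -/
structure IsTranspositionSolution (D A : Matrix (Fin 2) (Fin 2) ℝ) (B : Vec ℝ) (T : ℝ)
    (y₀ : Hneg1) (v : ℝ → ℝ) (y : ℝ → L2 ℝ) : Prop where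
  memLp : MemLp y 2 (timeMeasure T)
  identity : ∀ (g : ℝ → L2 ℝ) (φ : ℝ → H10 ℝ) (φxx φt : ℝ → L2 ℝ) (γ : ℝ → Vec ℝ),
    MemLp g 2 (timeMeasure T) →
    IsBackwardSolution D A T g 0 φ φxx φt →
    (∀ᵐ t ∂(timeMeasure T), HasTraceZero (dxL2 (φ t)) (γ t)) →
    ∫ t in Ioo 0 T, inner ℝ (y t) (g t) =
      y₀ (φ 0) +
        ∫ t in Ioo 0 T, inner ℝ B (Matrix.toEuclideanCLM (𝕜 := ℝ) D.transpose (γ t)) * v t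

/-- `Y ∈ C⁰([0,T]; H⁻¹)` is the continuous representative of `y ∈ L²(Q_T; ℝ²)`. -/
def IsContinuousRepresentative (T : ℝ) (y : ℝ → L2 ℝ) (Y : ℝ → Hneg1) : Prop :=
  ContinuousOn Y (Icc 0 T) ∧ ∀ᵐ t ∂(timeMeasure T), Y t = toHneg1 (y t)

/-- Approximate controllability in `H⁻¹(0, π; ℝ²)` at time `T`: for all `y₀, y₁ ∈ H⁻¹` and `ε > 0`
there is a control `v ∈ L²(0, T)` whose associated solution satisfies `‖y(·, T) - y₁‖ ≤ ε`. -/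
def ApproximatelyControllable (D A : Matrix (Fin 2) (Fin 2) ℝ) (B : Vec ℝ) (T : ℝ) : Prop :=
  ∀ (y₀ y₁ : Hneg1) (ε : ℝ), 0 < ε →
    ∃ (v : ℝ → ℝ) (y : ℝ → L2 ℝ) (Y : ℝ → Hneg1),
      MemLp v 2 (timeMeasure T) ∧
      IsTranspositionSolution D A B T y₀ v y ∧
      IsContinuousRepresentative T y Y ∧
      ‖Y T - y₁‖ ≤ ε

/-! ### The operator `L = -D ∂_xx + A` on `H² ∩ H¹₀` -/

theorem integrable_test_smul {𝕜 : Type} [RCLike 𝕜] {η : ℝ → ℝ} (hη : Continuous η)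
    (hc : HasCompactSupport η) (u : L2 𝕜) :
    Integrable (fun x => η x • u x) spaceMeasure := by
  obtain ⟨C, hC⟩ := hc.exists_bound_of_continuous hη
  have hu : Integrable u spaceMeasure := (Lp.memLp u).integrable (by norm_num)
  exact hu.bdd_smul C hη.aestronglyMeasurable (Filter.Eventually.of_forall hC)

theorem HasWeakDeriv.add {𝕜 : Type} [RCLike 𝕜] {u u' w w' : L2 𝕜}
    (h : HasWeakDeriv 0 Real.pi u w) (h' : HasWeakDeriv 0 Real.pi u' w') :
    HasWeakDeriv 0 Real.pi (u + u' : L2 𝕜) (w + w' : L2 𝕜) := by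
  intro η h1 h2 h3
  have hd : Continuous (deriv η) := h1.continuous_deriv (by simp)
  have e1 : (fun x => deriv η x • (u + u' : L2 𝕜) x) =ᵐ[spaceMeasure]
      fun x => deriv η x • u x + deriv η x • u' x := by
    filter_upwards [Lp.coeFn_add u u'] with x hx
    rw [hx, Pi.add_apply, smul_add]
  have e2 : (fun x => η x • (w + w' : L2 𝕜) x) =ᵐ[spaceMeasure]
      fun x => η x • w x + η x • w' x := by
    filter_upwards [Lp.coeFn_add w w'] with x hx
    rw [hx, Pi.add_apply, smul_add]
  rw [integral_congr_ae e1, integral_congr_ae e2,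
    integral_add (integrable_test_smul hd h2.deriv u) (integrable_test_smul hd h2.deriv u'),
    integral_add (integrable_test_smul h1.continuous h2 w)
      (integrable_test_smul h1.continuous h2 w'), h η h1 h2 h3, h' η h1 h2 h3, neg_add]

theorem HasWeakDeriv.smul {𝕜 : Type} [RCLike 𝕜] {u w : L2 𝕜} (c : 𝕜)
    (h : HasWeakDeriv 0 Real.pi u w) :
    HasWeakDeriv 0 Real.pi (c • u : L2 𝕜) (c • w : L2 𝕜) := by
  intro η h1 h2 h3
  have e1 : (fun x => deriv η x • (c • u : L2 𝕜) x) =ᵐ[spaceMeasure]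
      fun x => c • (deriv η x • u x) := by
    filter_upwards [Lp.coeFn_smul c u] with x hx
    rw [hx, Pi.smul_apply, smul_comm]
  have e2 : (fun x => η x • (c • w : L2 𝕜) x) =ᵐ[spaceMeasure]
      fun x => c • (η x • w x) := by
    filter_upwards [Lp.coeFn_smul c w] with x hx
    rw [hx, Pi.smul_apply, smul_comm]
  rw [integral_congr_ae e1, integral_congr_ae e2, integral_smul, integral_smul,
    h η h1 h2 h3, smul_neg]

/-- The eigenspace, for `μ ∈ ℂ`, of the operator `-D ∂_xx + A` with domain
`H²(0, π; ℂ²) ∩ H¹₀(0, π; ℂ²)`: the `u ∈ H¹₀` whose derivative has a weak derivative `u_xx = w ∈ L²`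
and that satisfy `-D u_xx + A u = μ u`. -/
def eigenspace (D A : Matrix (Fin 2) (Fin 2) ℝ) (μ : ℂ) : Submodule ℂ (H10 ℂ) where
  carrier := {u | ∃ w : L2 ℂ, HasWeakDeriv 0 Real.pi (dxL2 u) w ∧
    -matAct ℂ D w + matAct ℂ A (valL2 u) = μ • valL2 u}
  zero_mem' := by
    refine ⟨0, ?_, ?_⟩
    · have := HasWeakDeriv.smul (𝕜 := ℂ) (u := 0) (w := 0) 0 ?_
      · simpa [dxL2] using this
      · intro η _ _ _
        have e (f : ℝ → ℝ) : (fun x => f x • (0 : L2 ℂ) x) =ᵐ[spaceMeasure] fun _ => 0 := by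
          filter_upwards [Lp.coeFn_zero (Vec ℂ) 2 spaceMeasure] with x hx
          rw [hx]; simp
        rw [integral_congr_ae (e _), integral_congr_ae (e _)]
        simp
    · simp [valL2]
  add_mem' := by
    rintro u u' ⟨w, hw, he⟩ ⟨w', hw', he'⟩
    refine ⟨w + w', hw.add hw', ?_⟩
    have : valL2 (u + u') = valL2 u + valL2 u' := rfl
    rw [this, map_add, map_add, smul_add, ← he, ← he']
    abel
  smul_mem' := by
    rintro c u ⟨w, hw, he⟩
    refine ⟨c • w, hw.smul c, ?_⟩
    have : valL2 (c • u) = c • valL2 u := rfl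
    rw [this, map_smul, map_smul, smul_comm μ c, ← he, smul_add, smul_neg]

/-- The spectrum of `-D ∂_xx + A` is simple: every (complex) eigenvalue has geometric multiplicity
equal to one. -/
def HasSimpleSpectrum (D A : Matrix (Fin 2) (Fin 2) ℝ) : Prop :=
  ∀ μ : ℂ, eigenspace D A μ ≠ ⊥ → Module.finrank ℂ (eigenspace D A μ) = 1

end PhaseField

end

noncomputable section

namespace PhaseField

/-! ### Weak derivatives on an interval -/

/-! On the mode `sin (n x)` the operator `L` acts as the matrix `M_n = n² D + A`, with
characteristic polynomial `p_n(μ) = (ξn² + ρ/τ - μ)(ξn² + 1/τ - μ) - (ρ/τ)(ξn² + 1/τ)`. For `k ≠ ℓ`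
the difference `p_k - p_ℓ` is affine in `μ`, its only zero is `μ* = (ξ(k² + ℓ²) + 1/τ)/2`, and `4τ²
p_k(μ*)` is the expression in (H2). So (H2) says that no two frequencies share an eigenvalue
(`nonresonance_iff`). The sine system is total (`eq_zero_of_pair_sinC`) and the off-diagonal entries
of `M_n` do not vanish, so the multiplicity of `μ` counts the frequencies that have `μ` as an
eigenvalue. This gives the two spectral equivalences (`hasSimpleSpectrum_iff`).

Necessity of (H2): at a resonance there are adjoint eigenfunctions of frequencies `k` and `ℓ` for
one real eigenvalue, both with first component `1`. The control sees only the first component of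
`φ_x(0)`, which is `k` for one and `ℓ` for the other, so `ℓ φ_k - k φ_ℓ` is a nonzero unobservable
eigenfunction. Every solution starting from zero stays orthogonal to it
(`not_approximatelyControllable`).

Sufficiency: solutions are built as sine series whose coefficients solve `2 × 2` linear equations in
closed form (`IsModeFamily.exists_solution`). Let `f` be orthogonal to all states reached from zero.
Its pairing with such a state is a series of Duhamel integrals over the eigenvalues `λ_j`, with
weights `d_j`; that it vanishes for every control forces the Dirichlet series `∑ d_j exp(-λ_j s)` to
vanish on an interval. Under (H2) the `λ_j` are distinct, so all `d_j` are zero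
(`eq_zero_of_tsum_exp_eq_zero`), and the two weights of a frequency determine both components of the
coefficient of `f` (`eq_zero_of_obsWeight`). Hence the reachable states are dense, and superposition
with the free evolution handles arbitrary initial data. -/

theorem integral_smul_primitive {F : Type*} [NormedAddCommGroup F] [NormedSpace ℝ F]
    [CompleteSpace F] {a b : ℝ} {s' : ℝ → ℝ} (hs' : Continuous s') {w : ℝ → F}
    (hw : IntegrableOn w (Ioo a b)) :
    ∫ y in Ioo a b, s' y • ∫ x in Ioo a y, w x
      = ∫ x in Ioo a b, (∫ y in x..b, s' y) • w x := by
  set μ := (volume : Measure ℝ).restrict (Ioo a b) with hμ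
  have hs'i : Integrable s' μ :=
    (hs'.integrableOn_Icc (a := a) (b := b)).mono_set Ioo_subset_Icc_self
  have hprod : Integrable (fun z : ℝ × ℝ => s' z.1 • w z.2) (μ.prod μ) :=
    hs'i.smul_prod hw
  -- Fubini on the triangle `x < y` of the square.
  have hmeas : MeasurableSet {z : ℝ × ℝ | z.2 < z.1} :=
    measurableSet_lt measurable_snd measurable_fst
  have hind := hprod.indicator hmeas
  have hswap := integral_integral_swap (f := fun y x =>
    ({z : ℝ × ℝ | z.2 < z.1}.indicator (fun z : ℝ × ℝ => s' z.1 • w z.2)) (y, x)) hind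
  have h1 : ∀ y ∈ Ioo a b, ∫ x in Ioo a b, ({z : ℝ × ℝ | z.2 < z.1}.indicator
      (fun z : ℝ × ℝ => s' z.1 • w z.2)) (y, x) = s' y • ∫ x in Ioo a y, w x := by
    intro y hy
    have : (fun x => ({z : ℝ × ℝ | z.2 < z.1}.indicator
      (fun z : ℝ × ℝ => s' z.1 • w z.2)) (y, x)) = (Iio y).indicator (fun x => s' y • w x) := by
      ext x; simp [indicator_apply]
    rw [this, setIntegral_indicator measurableSet_Iio, integral_smul, Ioo_inter_Iio,
      min_eq_right hy.2.le]
  have h2 : ∀ x ∈ Ioo a b, ∫ y in Ioo a b, ({z : ℝ × ℝ | z.2 < z.1}.indicator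
      (fun z : ℝ × ℝ => s' z.1 • w z.2)) (y, x) = (∫ y in x..b, s' y) • w x := by
    intro x hx
    have : (fun y => ({z : ℝ × ℝ | z.2 < z.1}.indicator
      (fun z : ℝ × ℝ => s' z.1 • w z.2)) (y, x)) = (Ioi x).indicator (fun y => s' y • w x) := by
      ext y; simp [indicator_apply]
    rw [this, setIntegral_indicator measurableSet_Ioi, Ioo_inter_Ioi,
      max_eq_right hx.1.le, integral_smul_const, intervalIntegral.integral_of_le hx.2.le,
      integral_Ioc_eq_integral_Ioo]
  rw [setIntegral_congr_fun measurableSet_Ioo h1,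
    setIntegral_congr_fun measurableSet_Ioo h2] at hswap
  exact hswap

theorem integrableOn_primitive {F : Type*} [NormedAddCommGroup F] [NormedSpace ℝ F]
    {a b : ℝ} (hab : a ≤ b) {w : ℝ → F} (hw : IntegrableOn w (Ioo a b)) :
    IntegrableOn (fun y => ∫ x in Ioo a y, w x) (Ioo a b) := by
  have hc := intervalIntegral.continuousOn_primitive_interval (a := a) (b := b) (f := w)
    (μ := volume) (by rw [uIcc_of_le hab, integrableOn_Icc_iff_integrableOn_Ioo]; exact hw)
  rw [uIcc_of_le hab] at hc
  refine ((hc.integrableOn_Icc).mono_set Ioo_subset_Icc_self).congr_fun ?_ measurableSet_Ioo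
  intro y hy
  simp only
  rw [intervalIntegral.integral_of_le hy.1.le, integral_Ioc_eq_integral_Ioo]

/-- Integration by parts for `w` merely integrable: its primitive need not be differentiable
everywhere, so the formula comes from exchanging the two integrals. -/
theorem integral_deriv_smul_primitive {F : Type*} [NormedAddCommGroup F] [NormedSpace ℝ F]
    [CompleteSpace F] {a b : ℝ} (hab : a ≤ b) {s s' : ℝ → ℝ} (hs' : Continuous s')
    (hs : ∀ x, HasDerivAt s (s' x) x) {w : ℝ → F} (hw : IntegrableOn w (Ioo a b)) (c : F) :
    ∫ y in Ioo a b, s' y • (c + ∫ x in Ioo a y, w x)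
      = s b • (c + ∫ x in Ioo a b, w x) - s a • c - ∫ x in Ioo a b, s x • w x := by
  have hint (x y : ℝ) : ∫ t in x..y, s' t = s y - s x :=
    intervalIntegral.integral_eq_sub_of_hasDerivAt (fun t _ => hs t) (hs'.intervalIntegrable _ _)
  have hsc : Continuous s := continuous_iff_continuousAt.2 fun x => (hs x).continuousAt
  have hs'i : IntegrableOn s' (Ioo a b) :=
    (hs'.integrableOn_Icc (a := a) (b := b)).mono_set Ioo_subset_Icc_self
  have hbdd (f : ℝ → ℝ) (hf : Continuous f) (g : ℝ → F) (hg : IntegrableOn g (Ioo a b)) :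
      IntegrableOn (fun x => f x • g x) (Ioo a b) := by
    obtain ⟨C, hC⟩ := (isCompact_Icc (a := a) (b := b)).exists_bound_of_continuousOn hf.continuousOn
    refine Integrable.bdd_smul hg C hf.aestronglyMeasurable ?_
    filter_upwards [ae_restrict_mem measurableSet_Ioo] with x hx
    exact hC x (Ioo_subset_Icc_self hx)
  have hprim := integrableOn_primitive hab hw
  simp_rw [smul_add]
  rw [integral_add (hs'i.smul_const c) (hbdd s' hs' _ hprim), integral_smul_const,
    integral_smul_primitive hs' hw]
  simp_rw [hint, sub_smul]
  rw [integral_sub (f := fun x => s b • w x) (hw.smul (s b)) (hbdd s hsc w hw), integral_smul,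
    ← integral_Ioc_eq_integral_Ioo, ← intervalIntegral.integral_of_le hab, hint, sub_smul]
  abel

theorem exists_Icc_of_isCompact_subset_Ioo {a b : ℝ} (hab : a < b) {K : Set ℝ} (hK : IsCompact K)
    (h : K ⊆ Ioo a b) : ∃ a' b', a < a' ∧ b' < b ∧ K ⊆ Icc a' b' := by
  have hK' : IsCompact (insert ((a + b) / 2) K) := hK.insert _
  have hm : (a + b) / 2 ∈ Ioo a b := ⟨by linarith, by linarith⟩
  have hsub : insert ((a + b) / 2) K ⊆ Ioo a b := insert_subset hm h
  obtain ⟨a', ha', hl⟩ := hK'.exists_isLeast (insert_nonempty _ _)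
  obtain ⟨b', hb', hg⟩ := hK'.exists_isGreatest (insert_nonempty _ _)
  exact ⟨a', b', (hsub ha').1, (hsub hb').2, fun x hx =>
    ⟨hl (mem_insert_of_mem _ hx), hg (mem_insert_of_mem _ hx)⟩⟩

/-- The primitive from `a` is zero to the left of the support of `θ`, and to its right it is the
total integral, again zero. -/
theorem exists_test_primitive {a b : ℝ} (hab : a < b) {θ : ℝ → ℝ} (hθ : ContDiff ℝ ∞ θ)
    (hc : HasCompactSupport θ) (hsub : tsupport θ ⊆ Ioo a b) (h0 : ∫ x, θ x = 0) :
    ∃ η : ℝ → ℝ, ContDiff ℝ ∞ η ∧ HasCompactSupport η ∧ tsupport η ⊆ Ioo a b ∧ deriv η = θ := by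
  obtain ⟨a', b', ha', hb', hK⟩ := exists_Icc_of_isCompact_subset_Ioo hab hc hsub
  have hzero : ∀ x, x ∉ Icc a' b' → θ x = 0 := fun x hx =>
    image_eq_zero_of_notMem_tsupport fun h => hx (hK h)
  have hder : ∀ x, HasDerivAt (fun x => ∫ t in a..x, θ t) (θ x) x := fun x =>
    intervalIntegral.integral_hasDerivAt_right (hθ.continuous.intervalIntegrable _ _)
      hθ.continuous.stronglyMeasurable.stronglyMeasurableAtFilter hθ.continuous.continuousAt
  have hd : deriv (fun x => ∫ t in a..x, θ t) = θ := funext fun x => (hder x).deriv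
  have hsupp : Function.support (fun x => ∫ t in a..x, θ t) ⊆ Icc a' b' := by
    intro x hx
    by_contra hx'
    apply hx
    rcases lt_or_ge x a' with h | h
    · refine intervalIntegral.integral_zero_ae (Filter.Eventually.of_forall fun t ht => hzero t ?_)
      intro ht'
      rcases le_total a x with hax | hax
      · rw [uIoc_of_le hax] at ht; linarith [ht.2, ht'.1]
      · rw [uIoc_of_ge hax] at ht; linarith [ht.2, ht'.1]
    · have hbx : b' < x := by
        by_contra hh
        exact hx' ⟨h, not_lt.1 hh⟩
      rcases le_total a x with hax | hax
      · simp only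
        rw [intervalIntegral.integral_of_le hax, ← h0, setIntegral_eq_integral_of_forall_compl_eq_zero]
        intro t ht
        apply hzero
        intro ht'
        exact ht ⟨ha'.trans_le ht'.1, ht'.2.trans hbx.le⟩
      · linarith
  have hts : tsupport (fun x => ∫ t in a..x, θ t) ⊆ Icc a' b' :=
    closure_minimal hsupp isClosed_Icc
  refine ⟨fun x => ∫ t in a..x, θ t, ?_, ?_, ?_, hd⟩
  · rw [contDiff_infty_iff_deriv, hd]
    exact ⟨fun x => (hder x).differentiableAt, hθ⟩
  · exact HasCompactSupport.of_support_subset_isCompact isCompact_Icc hsupp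
  · exact hts.trans fun x hx => ⟨ha'.trans_le hx.1, hx.2.trans_lt hb'⟩

theorem exists_test_integral_one {a b : ℝ} (hab : a < b) :
    ∃ ρ : ℝ → ℝ, ContDiff ℝ ∞ ρ ∧ HasCompactSupport ρ ∧ tsupport ρ ⊆ Ioo a b ∧ ∫ x, ρ x = 1 := by
  let f : ContDiffBump ((a + b) / 2) := ⟨(b - a) / 8, (b - a) / 4, by linarith, by linarith⟩
  refine ⟨f.normed volume, f.contDiff_normed, f.hasCompactSupport_normed, ?_, f.integral_normed⟩
  rw [f.tsupport_normed_eq, Real.closedBall_eq_Icc]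
  intro x hx
  have h1 : (a + b) / 2 - (b - a) / 4 ≤ x := hx.1
  have h2 : x ≤ (a + b) / 2 + (b - a) / 4 := hx.2
  constructor <;> linarith

theorem integrableOn_test_smul {F : Type*} [NormedAddCommGroup F] [NormedSpace ℝ F] {s : Set ℝ}
    {η : ℝ → ℝ} (hη : Continuous η) (hc : HasCompactSupport η) {p : ℝ → F}
    (hp : IntegrableOn p s) : IntegrableOn (fun x => η x • p x) s := by
  obtain ⟨C, hC⟩ := hc.exists_bound_of_continuous hη
  exact Integrable.bdd_smul hp C hη.aestronglyMeasurable (Filter.Eventually.of_forall hC)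

/-- The du Bois-Reymond lemma. Subtracting from a test function `ζ` the multiple `(∫ ζ) ρ` of a
fixed bump of mass one leaves the derivative of a test function, so `∫ ζ p = (∫ ζ) ∫ ρ p`; the
constant is `∫ ρ p`. -/
theorem ae_eq_const_of_integral_deriv_smul_eq_zero {F : Type*} [NormedAddCommGroup F]
    [NormedSpace ℝ F] [CompleteSpace F] {a b : ℝ} (hab : a < b) {p : ℝ → F}
    (hp : IntegrableOn p (Ioo a b))
    (h : ∀ η : ℝ → ℝ, ContDiff ℝ ∞ η → HasCompactSupport η → tsupport η ⊆ Ioo a b →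
      ∫ x in Ioo a b, deriv η x • p x = 0) :
    ∃ c : F, p =ᵐ[volume.restrict (Ioo a b)] fun _ => c := by
  obtain ⟨ρ, hρ, hρc, hρs, hρ1⟩ := exists_test_integral_one hab
  set c := ∫ x in Ioo a b, ρ x • p x with hcdef
  have hci : IntegrableOn (fun _ : ℝ => c) (Ioo a b) := by simp
  refine ⟨c, ?_⟩
  have key := isOpen_Ioo.ae_eq_zero_of_integral_contDiff_smul_eq_zero (μ := volume)
    (U := Ioo a b) (f := fun x => p x - c)
    (hp.sub hci).locallyIntegrableOn ?_
  · rw [Filter.EventuallyEq, ae_restrict_iff' measurableSet_Ioo]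
    filter_upwards [key] with x hx hx'
    exact sub_eq_zero.1 (hx hx')
  intro ζ hζ hζc hζs
  have hζi : Integrable ζ := hζ.continuous.integrable_of_hasCompactSupport hζc
  have hρi : Integrable ρ := hρ.continuous.integrable_of_hasCompactSupport hρc
  obtain ⟨η, h1, h2, h3, h4⟩ := exists_test_primitive hab
    (θ := fun x => ζ x - (∫ t, ζ t) * ρ x) (hζ.sub (contDiff_const.mul hρ))
    (hζc.sub hρc.mul_left)
    ((tsupport_sub _ _).trans (union_subset hζs ((tsupport_mul_subset_right).trans hρs)))
    (by rw [integral_sub hζi (hρi.const_mul _), integral_const_mul, hρ1, mul_one, sub_self])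
  · have e := h η h1 h2 h3
    rw [h4] at e
    simp_rw [sub_smul, mul_smul] at e
    rw [integral_sub (g := fun x => (∫ t, ζ t) • ρ x • p x)
      (integrableOn_test_smul hζ.continuous hζc hp)
      ((integrableOn_test_smul hρ.continuous hρc hp).smul (∫ t, ζ t)), integral_smul,
      ← hcdef, sub_eq_zero] at e
    have hfull : ∫ x, ζ x • (p x - c) = ∫ x in Ioo a b, ζ x • (p x - c) := by
      rw [setIntegral_eq_integral_of_forall_compl_eq_zero]
      intro x hx
      rw [image_eq_zero_of_notMem_tsupport fun h => hx (hζs h), zero_smul]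
    have hfull' : ∫ x, ζ x = ∫ x in Ioo a b, ζ x := by
      rw [setIntegral_eq_integral_of_forall_compl_eq_zero]
      intro x hx
      rw [image_eq_zero_of_notMem_tsupport fun h => hx (hζs h)]
    rw [hfull]
    simp_rw [smul_sub]
    rw [integral_sub (integrableOn_test_smul hζ.continuous hζc hp)
      (integrableOn_test_smul hζ.continuous hζc hci), e, integral_smul_const, hfull', sub_self]

theorem continuousOn_primitive_Ioo {F : Type*} [NormedAddCommGroup F] [NormedSpace ℝ F]
    {a b : ℝ} (hab : a ≤ b) {w : ℝ → F} (hw : IntegrableOn w (Ioo a b)) :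
    ContinuousOn (fun y => ∫ x in Ioo a y, w x) (Icc a b) := by
  have hc := intervalIntegral.continuousOn_primitive_interval (a := a) (b := b) (f := w)
    (μ := volume) (by rw [uIcc_of_le hab, integrableOn_Icc_iff_integrableOn_Ioo]; exact hw)
  rw [uIcc_of_le hab] at hc
  refine hc.congr ?_
  intro y hy
  simp only
  rw [intervalIntegral.integral_of_le hy.1, integral_Ioc_eq_integral_Ioo]

/-- The primitive of `w` also has weak derivative `w`, so its difference with `p` is constant. -/
theorem exists_primitive_of_hasWeakDeriv {F : Type*} [NormedAddCommGroup F] [NormedSpace ℝ F]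
    [CompleteSpace F] {a b : ℝ} (hab : a < b) {p w : ℝ → F}
    (hp : IntegrableOn p (Ioo a b)) (hw : IntegrableOn w (Ioo a b)) (h : HasWeakDeriv a b p w) :
    ∃ c : F, p =ᵐ[volume.restrict (Ioo a b)] fun y => c + ∫ x in Ioo a y, w x := by
  have hW := integrableOn_primitive hab.le hw
  suffices hs : ∀ η : ℝ → ℝ, ContDiff ℝ ∞ η → HasCompactSupport η → tsupport η ⊆ Ioo a b →
      ∫ x in Ioo a b, deriv η x • (p x - ∫ t in Ioo a x, w t) = 0 by
    obtain ⟨c, hc⟩ := ae_eq_const_of_integral_deriv_smul_eq_zero hab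
      (p := fun y => p y - ∫ x in Ioo a y, w x) (hp.sub hW) hs
    refine ⟨c, ?_⟩
    filter_upwards [hc] with x hx
    rw [← hx, sub_add_cancel]
  intro η h1 h2 h3
  have hd : Continuous (deriv η) := h1.continuous_deriv (by simp)
  have hη (x : ℝ) (hx : x ∉ Ioo a b) : η x = 0 :=
    image_eq_zero_of_notMem_tsupport fun h => hx (h3 h)
  have e := integral_deriv_smul_primitive hab.le hd
    (fun x => (h1.differentiable (by simp)).differentiableAt.hasDerivAt) hw 0
  simp only [zero_add, smul_zero, sub_zero, hη b (fun h => lt_irrefl _ h.2), zero_smul,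
    zero_sub] at e
  simp_rw [smul_sub]
  rw [integral_sub (integrableOn_test_smul hd h2.deriv hp)
    (integrableOn_test_smul hd h2.deriv hW), e, h η h1 h2 h3, sub_self]

/-- Integration by parts against a weak derivative, the boundary values being those of the
continuous representative. -/
theorem HasWeakDeriv.exists_integral_deriv_smul {F : Type*} [NormedAddCommGroup F]
    [NormedSpace ℝ F] [CompleteSpace F] {a b : ℝ} (hab : a < b) {p w : ℝ → F}
    (hp : IntegrableOn p (Ioo a b)) (hw : IntegrableOn w (Ioo a b)) (h : HasWeakDeriv a b p w) :
    ∃ q : ℝ → F, ContinuousOn q (Icc a b) ∧ p =ᵐ[volume.restrict (Ioo a b)] q ∧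
      ∀ s s' : ℝ → ℝ, Continuous s' → (∀ x, HasDerivAt s (s' x) x) →
        ∫ x in Ioo a b, s' x • p x = s b • q b - s a • q a - ∫ x in Ioo a b, s x • w x := by
  obtain ⟨c, hc⟩ := exists_primitive_of_hasWeakDeriv hab hp hw h
  refine ⟨_, continuousOn_const.add (continuousOn_primitive_Ioo hab.le hw), hc, ?_⟩
  intro s s' hs' hs
  have e := integral_deriv_smul_primitive hab.le hs' hs hw c
  simp only [Pi.add_apply]
  -- At the left end point the integral is over an empty interval, so the representative takes the
  -- value `c` there.
  rw [Ioo_self, Measure.restrict_empty, integral_zero_measure, add_zero, ← e]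
  refine integral_congr_ae ?_
  filter_upwards [hc] with x hx
  rw [hx]

/-- Two functions continuous on `[a, b]` that agree almost everywhere on `(a, b)` agree on
`[a, b]`. -/
theorem eqOn_Icc_of_ae_eq_Ioo {F : Type*} [TopologicalSpace F] [T2Space F] {a b : ℝ} (hab : a < b)
    {f g : ℝ → F} (hf : ContinuousOn f (Icc a b)) (hg : ContinuousOn g (Icc a b))
    (h : f =ᵐ[volume.restrict (Ioo a b)] g) : EqOn f g (Icc a b) := by
  refine Measure.eqOn_Icc_of_ae_eq volume hab.ne ?_ hf hg
  rwa [← restrict_Ioo_eq_restrict_Icc]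

/-! ### Pairing with continuous scalar functions -/

section Pairing

variable {𝕜 : Type} [RCLike 𝕜]

instance : CompleteSpace (H10 𝕜) :=
  (Submodule.isClosed_topologicalClosure _).completeSpace_coe

theorem L2.integrable (f : L2 𝕜) : Integrable f spaceMeasure :=
  (Lp.memLp f).integrable (by norm_num)

theorem memLp_of_continuous {F : Type*} [NormedAddCommGroup F] {f : ℝ → F}
    (hf : Continuous f) [SecondCountableTopology F] (p : ENNReal) : MemLp f p spaceMeasure := by
  obtain ⟨C, hC⟩ := (isCompact_Icc (a := 0) (b := Real.pi)).exists_bound_of_continuousOn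
    hf.continuousOn
  refine MemLp.of_bound hf.aestronglyMeasurable C ?_
  filter_upwards [ae_restrict_mem measurableSet_Ioo] with x hx
  exact hC x (Ioo_subset_Icc_self hx)

theorem integrable_continuous_smul (s : C(ℝ, ℝ)) (f : L2 𝕜) :
    Integrable (fun x => s x • f x) spaceMeasure := by
  obtain ⟨C, hC⟩ := (isCompact_Icc (a := 0) (b := Real.pi)).exists_bound_of_continuousOn
    s.continuous.continuousOn
  refine Integrable.bdd_smul (L2.integrable f) C s.continuous.aestronglyMeasurable ?_
  filter_upwards [ae_restrict_mem measurableSet_Ioo] with x hx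
  exact hC x (Ioo_subset_Icc_self hx)

/-- The function `x ↦ s(x) v` of `L²(0, π; 𝕜²)`. -/
def smulL2 (s : C(ℝ, ℝ)) (v : Vec 𝕜) : L2 𝕜 :=
  (memLp_of_continuous (s.continuous.smul (continuous_const (y := v))) 2).toLp

theorem coeFn_smulL2 (s : C(ℝ, ℝ)) (v : Vec 𝕜) :
    smulL2 s v =ᵐ[spaceMeasure] fun x => s x • v := MemLp.coeFn_toLp _

/-- The vector-valued integral `∫ s f` over `(0, π)`. -/
def pair (s : C(ℝ, ℝ)) (f : L2 𝕜) : Vec 𝕜 := ∫ x, s x • f x ∂spaceMeasure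

/-- Testing against all constant vectors `v` recovers `pair s f`, so the linearity of `pair` and of
`smulL2` is inherited from the inner product without further integrability arguments. -/
theorem inner_smulL2 (s : C(ℝ, ℝ)) (v : Vec 𝕜) (f : L2 𝕜) :
    inner 𝕜 (smulL2 s v) f = inner 𝕜 v (pair s f) := by
  rw [L2.inner_def, pair, ← integral_inner (integrable_continuous_smul s f)]
  refine integral_congr_ae ?_
  filter_upwards [coeFn_smulL2 s v] with x hx
  rw [hx, inner_smul_left_eq_smul, inner_smul_right_eq_smul]

theorem pair_add (s : C(ℝ, ℝ)) (f g : L2 𝕜) : pair s (f + g) = pair s f + pair s g :=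
  ext_inner_left 𝕜 fun v => by simp only [← inner_smulL2, inner_add_right]

theorem pair_smul (s : C(ℝ, ℝ)) (c : 𝕜) (f : L2 𝕜) : pair s (c • f) = c • pair s f :=
  ext_inner_left 𝕜 fun v => by simp only [← inner_smulL2, inner_smul_right]

theorem pair_neg (s : C(ℝ, ℝ)) (f : L2 𝕜) : pair s (-f) = -pair s f :=
  ext_inner_left 𝕜 fun v => by simp only [← inner_smulL2, inner_neg_right]

theorem pair_smulL2 (s r : C(ℝ, ℝ)) (v : Vec 𝕜) :
    pair s (smulL2 r v) = (∫ x in Ioo 0 Real.pi, s x * r x) • v := by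
  rw [pair, ← integral_smul_const]
  refine integral_congr_ae ?_
  filter_upwards [coeFn_smulL2 r v] with x hx
  rw [hx, mul_smul]

theorem pair_matAct (s : C(ℝ, ℝ)) (M : Matrix (Fin 2) (Fin 2) ℝ) (f : L2 𝕜) :
    pair s (matAct 𝕜 M f) =
      Matrix.toEuclideanCLM (n := Fin 2) (𝕜 := 𝕜) (M.map (algebraMap ℝ 𝕜)) (pair s f) := by
  rw [pair, pair, ← ContinuousLinearMap.integral_comp_comm _ (integrable_continuous_smul s f)]
  refine integral_congr_ae ?_
  filter_upwards [ContinuousLinearMap.coeFn_compLpL (p := 2) (μ := spaceMeasure)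
    (Matrix.toEuclideanCLM (n := Fin 2) (𝕜 := 𝕜) (M.map (algebraMap ℝ 𝕜))) f] with x hx
  rw [matAct, hx, ← algebraMap_smul 𝕜 (s x) (f x), map_smul, algebraMap_smul]

theorem matAct_smulL2 (M : Matrix (Fin 2) (Fin 2) ℝ) (s : C(ℝ, ℝ)) (v : Vec 𝕜) :
    matAct 𝕜 M (smulL2 s v) =
      smulL2 s (Matrix.toEuclideanCLM (n := Fin 2) (𝕜 := 𝕜) (M.map (algebraMap ℝ 𝕜)) v) := by
  refine Lp.ext ?_
  filter_upwards [ContinuousLinearMap.coeFn_compLpL (p := 2) (μ := spaceMeasure)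
    (Matrix.toEuclideanCLM (n := Fin 2) (𝕜 := 𝕜) (M.map (algebraMap ℝ 𝕜))) (smulL2 s v),
    coeFn_smulL2 s v, coeFn_smulL2 s (Matrix.toEuclideanCLM (n := Fin 2) (𝕜 := 𝕜)
      (M.map (algebraMap ℝ 𝕜)) v)] with x h1 h2 h3
  rw [matAct, h1, h2, h3, ← algebraMap_smul 𝕜 (s x) v, map_smul, algebraMap_smul]

theorem smulL2_smul (s : C(ℝ, ℝ)) (c : 𝕜) (v : Vec 𝕜) : smulL2 s (c • v) = c • smulL2 s v :=
  ext_inner_right 𝕜 fun f => by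
    rw [inner_smulL2, inner_smul_left, inner_smul_left, inner_smulL2]

theorem smulL2_add (s : C(ℝ, ℝ)) (v w : Vec 𝕜) : smulL2 s (v + w) = smulL2 s v + smulL2 s w :=
  ext_inner_right 𝕜 fun f => by
    rw [inner_smulL2, inner_add_left, inner_add_left, inner_smulL2, inner_smulL2]

/-- Since `p` has a representative continuous up to the boundary, compact support of `s` can be
relaxed to vanishing at the end points. -/
theorem HasWeakDeriv.pair_eq {p w : L2 𝕜} (h : HasWeakDeriv 0 Real.pi p w) {s s' : C(ℝ, ℝ)}
    (hs : ∀ x, HasDerivAt s (s' x) x) (h0 : s 0 = 0) (h1 : s Real.pi = 0) :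
    pair s' p = -pair s w := by
  obtain ⟨q, -, -, hq⟩ := h.exists_integral_deriv_smul Real.pi_pos (L2.integrable p)
    (L2.integrable w)
  have := hq s s' s'.continuous hs
  rw [h0, h1, zero_smul, zero_smul, sub_zero, zero_sub] at this
  exact this

theorem hasWeakDeriv_of_pair {p w : L2 𝕜} (h : ∀ s s' : C(ℝ, ℝ), ContDiff ℝ ∞ s →
    HasCompactSupport s → tsupport s ⊆ Ioo 0 Real.pi → (∀ x, HasDerivAt s (s' x) x) →
    pair s' p = -pair s w) : HasWeakDeriv 0 Real.pi p w := fun η h1 h2 h3 =>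
  h ⟨η, h1.continuous⟩ ⟨deriv η, h1.continuous_deriv (by simp)⟩ h1 h2 h3
    fun x => (h1.differentiable (by simp) x).hasDerivAt

/-! ### The space `H¹₀` -/

theorem valL2_add (u v : H10 𝕜) : valL2 (u + v) = valL2 u + valL2 v := rfl
theorem valL2_smul (c : 𝕜) (u : H10 𝕜) : valL2 (c • u) = c • valL2 u := rfl

theorem inner_H10 (u v : H10 𝕜) :
    inner 𝕜 u v = inner 𝕜 (valL2 u) (valL2 v) + inner 𝕜 (dxL2 u) (dxL2 v) := rfl

/-- The restriction to `(0, π)` of a `C¹` function vanishing at the end points belongs to `H¹₀`. -/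
theorem smulL2_mem_H10 {s s' : C(ℝ, ℝ)} (hs : ∀ x, HasDerivAt s (s' x) x) (h0 : s 0 = 0)
    (h1 : s Real.pi = 0) (v : Vec 𝕜) :
    WithLp.toLp 2 (smulL2 s v, smulL2 s' v) ∈ H10 𝕜 := by
  rw [H10, ← Submodule.orthogonal_orthogonal_eq_closure, Submodule.mem_orthogonal]
  intro p hp
  rw [Submodule.mem_orthogonal] at hp
  -- `H10` is the double orthogonal of the test pairs `(r, r')`. Orthogonality of `p` to all of them
  -- says exactly that `p.snd` has weak derivative `p.fst`, and integration by parts then extends it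
  -- to `s`.
  have hw : HasWeakDeriv 0 Real.pi p.snd p.fst := by
    refine hasWeakDeriv_of_pair fun r r' hr1 hr2 hr3 hr => ?_
    refine ext_inner_left 𝕜 fun w => ?_
    have hd : deriv (fun x => r x • w) = fun x => r' x • w := funext fun x =>
      ((hr x).smul_const w).deriv
    have := hp (WithLp.toLp 2 (smulL2 r w, smulL2 r' w)) (Submodule.subset_span
      ⟨fun x => r x • w, hr1.smul contDiff_const, hr2.smul_right,
        (tsupport_smul_subset_left _ _).trans hr3, coeFn_smulL2 r w, hd ▸ coeFn_smulL2 r' w⟩)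
    rw [WithLp.prod_inner_apply] at this
    simp only [inner_smulL2] at this
    rw [inner_neg_right]
    exact eq_neg_of_add_eq_zero_right this
  have := hw.pair_eq hs h0 h1
  rw [inner_eq_zero_symm, WithLp.prod_inner_apply]
  simp only [inner_smulL2]
  change inner 𝕜 v (pair s p.fst) + inner 𝕜 v (pair s' p.snd) = 0
  rw [this, inner_neg_right, add_neg_cancel]

/-- The element of `H¹₀` given by `x ↦ s(x) v`, for a `C¹` function `s` vanishing at `0`, `π`. -/
def smulH10 {s s' : C(ℝ, ℝ)} (hs : ∀ x, HasDerivAt s (s' x) x) (h0 : s 0 = 0)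
    (h1 : s Real.pi = 0) (v : Vec 𝕜) : H10 𝕜 :=
  ⟨WithLp.toLp 2 (smulL2 s v, smulL2 s' v), smulL2_mem_H10 hs h0 h1 v⟩

/-- Elements of `H¹₀` vanish at the end points: no boundary term in the integration by parts. -/
theorem pair_valL2 (u : H10 𝕜) {s s' : C(ℝ, ℝ)} (hs : ∀ x, HasDerivAt s (s' x) x) :
    pair s' (valL2 u) = -pair s (dxL2 u) := by
  refine ext_inner_left 𝕜 fun v => ?_
  -- The identity is orthogonality to one vector, a closed condition, so it need only be checked on
  -- test functions.
  suffices h : H10 𝕜 ≤ (𝕜 ∙ (WithLp.toLp 2 (smulL2 s' v, smulL2 s v)))ᗮ by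
    have := Submodule.mem_orthogonal_singleton_iff_inner_right.1 (h u.2)
    rw [WithLp.prod_inner_apply] at this
    simp only [inner_smulL2] at this
    rw [inner_neg_right]
    exact eq_neg_of_add_eq_zero_left this
  refine Submodule.topologicalClosure_minimal _ (Submodule.span_le.2 ?_)
    (Submodule.isClosed_orthogonal _)
  rintro p ⟨ζ, hζ, hζc, hζs, h1, h2⟩
  rw [SetLike.mem_coe, Submodule.mem_orthogonal_singleton_iff_inner_right,
    WithLp.prod_inner_apply]
  simp only [inner_smulL2]
  rw [← inner_add_right]
  have hzero (x : ℝ) (hx : x ∉ Ioo 0 Real.pi) : ζ x = 0 :=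
    image_eq_zero_of_notMem_tsupport fun h => hx (hζs h)
  have e := intervalIntegral.integral_eq_sub_of_hasDerivAt (a := 0) (b := Real.pi)
    (fun x _ => (hs x).smul (hζ.differentiable (by simp) x).hasDerivAt)
    (Continuous.intervalIntegrable ((s.continuous.smul (hζ.continuous_deriv (by simp))).add
      (s'.continuous.smul hζ.continuous)) _ _)
  rw [Pi.smul_apply', Pi.smul_apply', hzero 0 (fun h => lt_irrefl _ h.1),
    hzero Real.pi (fun h => lt_irrefl _ h.2), smul_zero, smul_zero, sub_zero,
    intervalIntegral.integral_of_le Real.pi_pos.le, integral_Ioc_eq_integral_Ioo] at e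
  have : pair s' p.fst + pair s p.snd = 0 := by
    rw [pair, pair, ← integral_add (integrable_continuous_smul s' _)
      (integrable_continuous_smul s _), ← e]
    refine integral_congr_ae ?_
    filter_upwards [h1, h2] with x hx hx'
    rw [hx, hx', add_comm]
  change inner 𝕜 v (pair s' p.fst + pair s p.snd) = 0
  rw [this, inner_zero_right]

/-! ### Completeness of the sine system -/

/-- The function `x ↦ sin (n x)`. -/
def sinC (n : ℕ) : C(ℝ, ℝ) := ⟨fun x => Real.sin (n * x), by fun_prop⟩

/-- The function `x ↦ n cos (n x)`, the derivative of `sinC n`. -/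
def dsinC (n : ℕ) : C(ℝ, ℝ) := ⟨fun x => n * Real.cos (n * x), by fun_prop⟩

/-- The second derivative of `sinC n`. -/
def ddsinC (n : ℕ) : C(ℝ, ℝ) := ⟨fun x => -(n ^ 2 * Real.sin (n * x)), by fun_prop⟩

theorem hasDerivAt_sinC (n : ℕ) (x : ℝ) : HasDerivAt (sinC n) (dsinC n x) x := by
  have := ((hasDerivAt_id x).const_mul (n : ℝ)).sin
  simpa [sinC, dsinC, mul_comm] using this

theorem hasDerivAt_dsinC (n : ℕ) (x : ℝ) : HasDerivAt (dsinC n) (ddsinC n x) x := by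
  have := (((hasDerivAt_id x).const_mul (n : ℝ)).cos).const_mul (n : ℝ)
  refine this.congr_deriv ?_
  simp only [ddsinC, ContinuousMap.coe_mk, id]
  ring

theorem sinC_zero (n : ℕ) : sinC n 0 = 0 := by simp [sinC]
theorem sinC_pi (n : ℕ) : sinC n Real.pi = 0 := by simp [sinC]

theorem pair_ddsinC (n : ℕ) (f : L2 𝕜) : pair (ddsinC n) f = -((n : ℝ) ^ 2 • pair (sinC n) f) := by
  rw [pair, pair, ← integral_smul, ← integral_neg]
  refine integral_congr_ae (Filter.Eventually.of_forall fun x => ?_)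
  simp [ddsinC, sinC, mul_smul]

/-- Each factor `cos x` is absorbed by `2 sin (n x) cos x = sin ((n+1) x) + sin ((n-1) x)`.
Frequency `0`, which this formula may produce, contributes nothing. -/
theorem integral_sin_mul_cos_pow_smul {f : L2 𝕜} (h : ∀ n : ℕ, 1 ≤ n → pair (sinC n) f = 0)
    (m n : ℕ) : ∫ x, (Real.sin (n * x) * Real.cos x ^ m) • f x ∂spaceMeasure = 0 := by
  induction m generalizing n with
  | zero =>
    rcases Nat.eq_zero_or_pos n with rfl | hn
    · simp
    · simpa [pair, sinC] using h n hn
  | succ m ih =>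
    rcases Nat.eq_zero_or_pos n with rfl | hn
    · simp
    obtain ⟨k, rfl⟩ : ∃ k, n = k + 1 := ⟨n - 1, by omega⟩
    have e (x : ℝ) : (Real.sin ((k + 1 : ℕ) * x) * Real.cos x ^ (m + 1)) • f x =
        (1 / 2 : ℝ) • ((Real.sin ((k + 2 : ℕ) * x) * Real.cos x ^ m) • f x +
          (Real.sin (k * x) * Real.cos x ^ m) • f x) := by
      rw [← add_smul, smul_smul]
      congr 1
      have h1 : ((k + 2 : ℕ) : ℝ) * x = (k + 1 : ℕ) * x + x := by push_cast; ring
      have h2 : (k : ℝ) * x = (k + 1 : ℕ) * x - x := by push_cast; ring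
      rw [h1, h2, Real.sin_add, Real.sin_sub]
      ring
    simp_rw [e]
    rw [integral_smul, integral_add, ih, ih, add_zero, smul_zero]
    · exact integrable_continuous_smul
        ⟨fun x => Real.sin ((k + 2 : ℕ) * x) * Real.cos x ^ m, by fun_prop⟩ f
    · exact integrable_continuous_smul ⟨fun x => Real.sin (k * x) * Real.cos x ^ m, by fun_prop⟩ f

theorem integral_sin_mul_polynomial_smul {f : L2 𝕜}
    (h : ∀ n : ℕ, 1 ≤ n → pair (sinC n) f = 0) (P : Polynomial ℝ) :
    ∫ x, (Real.sin x * P.eval (Real.cos x)) • f x ∂spaceMeasure = 0 := by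
  induction P using Polynomial.induction_on' with
  | add p q hp hq =>
    simp_rw [Polynomial.eval_add, mul_add, add_smul]
    rw [integral_add, hp, hq, add_zero]
    · exact integrable_continuous_smul ⟨fun x => Real.sin x * p.eval (Real.cos x), by fun_prop⟩ f
    · exact integrable_continuous_smul ⟨fun x => Real.sin x * q.eval (Real.cos x), by fun_prop⟩ f
  | monomial m a =>
    have e (x : ℝ) : (Real.sin x * (Polynomial.monomial m a).eval (Real.cos x)) • f x =
        a • ((Real.sin ((1 : ℕ) * x) * Real.cos x ^ m) • f x) := by
      rw [Polynomial.eval_monomial, smul_smul]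
      congr 1
      push_cast
      rw [one_mul]
      ring
    simp_rw [e]
    rw [integral_smul, integral_sin_mul_cos_pow_smul h, smul_zero]

/-- The sine system is total in `L²(0, π; 𝕜²)`. -/
theorem eq_zero_of_pair_sinC {f : L2 𝕜} (h : ∀ n : ℕ, 1 ≤ n → pair (sinC n) f = 0) : f = 0 := by
  -- Weierstrass in the variable `y = cos x`: a polynomial close to `g ∘ arccos` on `[-1, 1]` gives
  -- `P (cos x)` close to `g x` on `(0, π)`. The weight `sin x` has no zero there and is divided out
  -- at the end.
  have key (g : C(ℝ, ℝ)) : ∫ x, g x • (Real.sin x • f x) ∂spaceMeasure = 0 := by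
    have hi := (L2.integrable f).norm
    refine norm_le_zero_iff.1 (le_of_forall_pos_le_add fun ε hε => ?_)
    set C := ∫ x, ‖f x‖ ∂spaceMeasure with hC
    have hC0 : 0 ≤ C := integral_nonneg fun _ => norm_nonneg _
    obtain ⟨P, hP⟩ := exists_polynomial_near_of_continuousOn (-1) 1 (fun y => g (Real.arccos y))
      (g.continuous.comp Real.continuous_arccos).continuousOn (ε / (C + 1)) (by positivity)
    have i1 : Integrable (fun x => g x • (Real.sin x • f x)) spaceMeasure := by
      simp_rw [smul_smul]
      exact integrable_continuous_smul ⟨fun x => g x * Real.sin x, by fun_prop⟩ f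
    have i2 : Integrable (fun x => (Real.sin x * P.eval (Real.cos x)) • f x) spaceMeasure :=
      integrable_continuous_smul ⟨fun x => Real.sin x * P.eval (Real.cos x), by fun_prop⟩ f
    have e : ∫ x, g x • (Real.sin x • f x) ∂spaceMeasure =
        ∫ x, (g x • (Real.sin x • f x) - (Real.sin x * P.eval (Real.cos x)) • f x)
          ∂spaceMeasure := by
      rw [integral_sub i1 i2, integral_sin_mul_polynomial_smul h P, sub_zero]
    rw [e, zero_add]
    refine (norm_integral_le_of_norm_le (g := fun x => ε / (C + 1) * ‖f x‖) (hi.const_mul _)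
      ?_).trans ?_
    · filter_upwards [ae_restrict_mem measurableSet_Ioo] with x hx
      rw [smul_smul, ← sub_smul, norm_smul]
      refine mul_le_mul_of_nonneg_right ?_ (norm_nonneg _)
      have h1 := hP (Real.cos x) ⟨Real.neg_one_le_cos x, Real.cos_le_one x⟩
      simp only [Real.arccos_cos hx.1.le hx.2.le] at h1
      rw [show g x * Real.sin x - Real.sin x * P.eval (Real.cos x) =
        -(Real.sin x * (P.eval (Real.cos x) - g x)) by ring, norm_neg, norm_mul, Real.norm_eq_abs,
        Real.norm_eq_abs]
      exact (mul_le_of_le_one_left (abs_nonneg _) (Real.abs_sin_le_one x)).trans h1.le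
    · rw [integral_const_mul, ← hC, div_mul_eq_mul_div, div_le_iff₀ (by positivity)]
      nlinarith
  have hloc : LocallyIntegrableOn (fun x => Real.sin x • f x) (Ioo 0 Real.pi) :=
    IntegrableOn.locallyIntegrableOn
      (integrable_continuous_smul ⟨Real.sin, Real.continuous_sin⟩ f)
  have h0 := isOpen_Ioo.ae_eq_zero_of_integral_contDiff_smul_eq_zero hloc
    fun η h1 h2 h3 => by
      rw [← key ⟨η, h1.continuous⟩, setIntegral_eq_integral_of_forall_compl_eq_zero]
      · rfl
      · intro x hx
        rw [ContinuousMap.coe_mk, image_eq_zero_of_notMem_tsupport fun h => hx (h3 h), zero_smul]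
  refine Lp.ext ?_
  have h0' := (ae_restrict_iff' (μ := volume) (measurableSet_Ioo (a := 0) (b := Real.pi))).2 h0
  filter_upwards [h0', ae_restrict_mem measurableSet_Ioo,
    Lp.coeFn_zero (Vec 𝕜) 2 spaceMeasure] with x hx hx' hx''
  rw [hx'', Pi.zero_apply]
  exact (smul_eq_zero.1 hx).resolve_left (Real.sin_pos_of_mem_Ioo hx').ne'

/-- Integration by parts expresses the sine coefficients of the derivative through the function
itself, so elements of `H10` may be compared in `L²`. -/
theorem valL2_injective : Function.Injective (valL2 (𝕜 := 𝕜)) := by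
  intro u v huv
  have h0 : valL2 (u - v) = 0 := by
    change valL2 u - valL2 v = 0
    rw [huv, sub_self]
  have h1 : dxL2 (u - v) = 0 := eq_zero_of_pair_sinC fun n _ => by
    have := pair_valL2 (u - v) (hasDerivAt_sinC n)
    rw [h0] at this
    rw [← neg_eq_zero, ← this]
    simpa using pair_smul (dsinC n) (0 : 𝕜) (0 : L2 𝕜)
  rw [← sub_eq_zero]
  exact Subtype.ext ((WithLp.ofLp_injective 2) (Prod.ext h0 h1))

/-- The element `x ↦ sin (n x) v` of `H¹₀`. -/
def sinH10 (n : ℕ) (v : Vec 𝕜) : H10 𝕜 := smulH10 (hasDerivAt_sinC n) (sinC_zero n) (sinC_pi n) v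

theorem valL2_sinH10 (n : ℕ) (v : Vec 𝕜) : valL2 (sinH10 n v) = smulL2 (sinC n) v := rfl
theorem dxL2_sinH10 (n : ℕ) (v : Vec 𝕜) : dxL2 (sinH10 n v) = smulL2 (dsinC n) v := rfl

theorem hasWeakDeriv_smulL2 {s s' : C(ℝ, ℝ)} (hs : ∀ x, HasDerivAt s (s' x) x) (v : Vec 𝕜) :
    HasWeakDeriv 0 Real.pi (smulL2 s v) (smulL2 s' v) := by
  refine hasWeakDeriv_of_pair fun r r' _ _ hr3 hr => ?_
  have hzero (x : ℝ) (hx : x ∉ Ioo 0 Real.pi) : r x = 0 :=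
    image_eq_zero_of_notMem_tsupport fun h => hx (hr3 h)
  have e := intervalIntegral.integral_deriv_mul_eq_sub (a := 0) (b := Real.pi)
    (fun x _ => hr x) (fun x _ => hs x) (r'.continuous.intervalIntegrable _ _)
    (s'.continuous.intervalIntegrable _ _)
  rw [hzero 0 (fun h => lt_irrefl _ h.1), hzero Real.pi (fun h => lt_irrefl _ h.2), zero_mul,
    zero_mul, sub_zero, intervalIntegral.integral_add (f := fun x => r' x * s x)
      (g := fun x => r x * s' x) ((r'.continuous.mul s.continuous).intervalIntegrable _ _)
      ((r.continuous.mul s'.continuous).intervalIntegrable _ _),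
    intervalIntegral.integral_of_le Real.pi_pos.le,
    intervalIntegral.integral_of_le Real.pi_pos.le, integral_Ioc_eq_integral_Ioo,
    integral_Ioc_eq_integral_Ioo] at e
  rw [pair_smulL2, pair_smulL2, ← neg_smul, eq_neg_of_add_eq_zero_left e]

theorem hasWeakDeriv_dxL2_sinH10 (n : ℕ) (v : Vec 𝕜) :
    HasWeakDeriv 0 Real.pi (dxL2 (sinH10 n v))
      (-((n : 𝕜) ^ 2 • smulL2 (sinC n) v) : L2 𝕜) := by
  have := hasWeakDeriv_smulL2 (hasDerivAt_dsinC n) v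
  suffices e : (-((n : 𝕜) ^ 2 • smulL2 (sinC n) v) : L2 𝕜) = smulL2 (ddsinC n) v by
    rw [e]
    exact this
  refine ext_inner_right 𝕜 fun f => ?_
  rw [inner_neg_left, inner_smul_left, inner_smulL2, inner_smulL2, pair_ddsinC, inner_neg_right,
    inner_smul_right_eq_smul]
  simp [RCLike.real_smul_eq_coe_mul]

/-- The sine coefficients of a second derivative. -/
theorem pair_sinC_of_hasWeakDeriv_dxL2 {u : H10 𝕜} {w : L2 𝕜}
    (h : HasWeakDeriv 0 Real.pi (dxL2 u) w) (n : ℕ) :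
    pair (sinC n) w = -((n : ℝ) ^ 2 • pair (sinC n) (valL2 u)) := by
  -- This integration by parts has no boundary term because the sine vanishes at the end points, the
  -- next one because `u` does.
  have h1 := h.pair_eq (hasDerivAt_sinC n) (sinC_zero n) (sinC_pi n)
  have h2 := pair_valL2 u (hasDerivAt_dsinC n)
  rw [pair_ddsinC, h1, neg_neg] at h2
  exact h2.symm

end Pairing

/-! ### Orthogonality of the sine system -/

theorem integral_cos_mul (m : ℤ) :
    ∫ x in Ioo 0 Real.pi, Real.cos (m * x) = if m = 0 then Real.pi else 0 := by
  rw [← integral_Ioc_eq_integral_Ioo, ← intervalIntegral.integral_of_le Real.pi_pos.le]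
  split_ifs with h
  · simp [h]
  · have hm : (m : ℝ) ≠ 0 := Int.cast_ne_zero.2 h
    rw [intervalIntegral.integral_comp_mul_left (fun x => Real.cos x) hm, integral_cos]
    simp [Real.sin_int_mul_pi]

/-- Product-to-sum formula; `1 ≤ n` keeps the frequency `m + n` away from zero. -/
theorem integral_sinC_mul_sinC (m n : ℕ) (hn : 1 ≤ n) :
    ∫ x in Ioo 0 Real.pi, sinC m x * sinC n x = if m = n then Real.pi / 2 else 0 := by
  have e (x : ℝ) : sinC m x * sinC n x =
      (1 / 2 : ℝ) * (Real.cos (((m : ℤ) - n : ℤ) * x) - Real.cos (((m : ℤ) + n : ℤ) * x)) := by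
    have h1 : (((m : ℤ) - n : ℤ) : ℝ) * x = m * x - n * x := by push_cast; ring
    have h2 : (((m : ℤ) + n : ℤ) : ℝ) * x = m * x + n * x := by push_cast; ring
    rw [h1, h2, Real.cos_sub, Real.cos_add]
    simp only [sinC, ContinuousMap.coe_mk]
    ring
  have hi (m : ℤ) : Integrable (fun x => Real.cos (m * x)) spaceMeasure :=
    (memLp_of_continuous (F := ℝ) (by fun_prop) 1).integrable le_rfl
  simp_rw [e]
  rw [integral_const_mul, integral_sub (hi _) (hi _), integral_cos_mul, integral_cos_mul,
    if_neg (show ¬((m : ℤ) + n = 0) by omega)]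
  by_cases h : m = n
  · rw [if_pos h, if_pos (by omega)]; ring
  · rw [if_neg h, if_neg (by omega)]; ring

theorem pair_sinC_smulL2 {𝕜 : Type} [RCLike 𝕜] (m n : ℕ) (hn : 1 ≤ n) (v : Vec 𝕜) :
    pair (sinC m) (smulL2 (sinC n) v) = if m = n then (Real.pi / 2) • v else 0 := by
  rw [pair_smulL2, integral_sinC_mul_sinC m n hn]
  split_ifs <;> simp

/-! ### Eigenvalues -/

/-- The matrix of `-D ∂_xx + A` on the mode `sin (n x)`. -/
def modeMatrix (D A : Matrix (Fin 2) (Fin 2) ℝ) (n : ℕ) : Matrix (Fin 2) (Fin 2) ℝ :=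
  (n : ℝ) ^ 2 • D + A

/-- The matrix `modeMatrix D A n` acting on `𝕜²`. -/
def modeCLM (𝕜 : Type) [RCLike 𝕜] (D A : Matrix (Fin 2) (Fin 2) ℝ) (n : ℕ) :
    Vec 𝕜 →L[𝕜] Vec 𝕜 :=
  Matrix.toEuclideanCLM (n := Fin 2) (𝕜 := 𝕜) ((modeMatrix D A n).map (algebraMap ℝ 𝕜))

theorem modeCLM_apply {𝕜 : Type} [RCLike 𝕜] (D A : Matrix (Fin 2) (Fin 2) ℝ) (n : ℕ)
    (v : Vec 𝕜) : modeCLM 𝕜 D A n v =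
      (n : 𝕜) ^ 2 • Matrix.toEuclideanCLM (n := Fin 2) (𝕜 := 𝕜) (D.map (algebraMap ℝ 𝕜)) v
        + Matrix.toEuclideanCLM (n := Fin 2) (𝕜 := 𝕜) (A.map (algebraMap ℝ 𝕜)) v := by
  have : (modeMatrix D A n).map (algebraMap ℝ 𝕜) =
      (n : 𝕜) ^ 2 • D.map (algebraMap ℝ 𝕜) + A.map (algebraMap ℝ 𝕜) := by
    ext i j
    simp [modeMatrix]
  rw [modeCLM, this, map_add, map_smul]
  rfl

/-- Taking sine coefficients decouples the eigenvalue equation into one `2 × 2` problem per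
frequency. -/
theorem modeCLM_pair_of_mem_eigenspace {D A : Matrix (Fin 2) (Fin 2) ℝ} {μ : ℂ} {u : H10 ℂ}
    (hu : u ∈ eigenspace D A μ) (n : ℕ) :
    modeCLM ℂ D A n (pair (sinC n) (valL2 u)) = μ • pair (sinC n) (valL2 u) := by
  obtain ⟨w, hw, he⟩ := hu
  rw [modeCLM_apply, ← pair_smul, ← he, pair_add, pair_neg, pair_matAct, pair_matAct,
    pair_sinC_of_hasWeakDeriv_dxL2 hw, map_neg, neg_neg]
  congr 1
  have (x : Vec ℂ) : (n : ℝ) ^ 2 • x = (n : ℂ) ^ 2 • x := by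
    rw [← algebraMap_smul ℂ]; simp
  rw [this, map_smul]

theorem sinH10_mem_eigenspace {D A : Matrix (Fin 2) (Fin 2) ℝ} {μ : ℂ} {n : ℕ} {v : Vec ℂ}
    (hv : modeCLM ℂ D A n v = μ • v) : sinH10 n v ∈ eigenspace D A μ := by
  refine ⟨_, hasWeakDeriv_dxL2_sinH10 n v, ?_⟩
  rw [valL2_sinH10, matAct_smulL2, map_neg, neg_neg, map_smul, matAct_smulL2, ← smulL2_smul,
    ← smulL2_smul, ← smulL2_add, ← hv, modeCLM_apply]

/-- The characteristic polynomial of the mode matrix, evaluated at `μ`. -/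
def modeChar (D A : Matrix (Fin 2) (Fin 2) ℝ) (n : ℕ) (μ : ℂ) : ℂ :=
  (modeMatrix D A n 0 0 - μ) * (modeMatrix D A n 1 1 - μ)
    - modeMatrix D A n 0 1 * modeMatrix D A n 1 0

theorem modeCLM_eq_smul_iff {D A : Matrix (Fin 2) (Fin 2) ℝ} {n : ℕ} {μ : ℂ} {v : Vec ℂ} :
    modeCLM ℂ D A n v = μ • v ↔
      modeMatrix D A n 0 0 * v 0 + modeMatrix D A n 0 1 * v 1 = μ * v 0 ∧
      modeMatrix D A n 1 0 * v 0 + modeMatrix D A n 1 1 * v 1 = μ * v 1 := by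
  have e : ∀ i, modeCLM ℂ D A n v i =
      modeMatrix D A n i 0 * v 0 + modeMatrix D A n i 1 * v 1 := by
    intro i
    rw [modeCLM, Matrix.ofLp_toEuclideanCLM, Matrix.mulVec, dotProduct, Fin.sum_univ_two]
    rfl
  rw [← e, ← e, PiLp.ext_iff, Fin.forall_fin_two]
  simp

/-- The eigenvector of the mode matrix, when the lower left entry does not vanish. -/
def modeVec (D A : Matrix (Fin 2) (Fin 2) ℝ) (n : ℕ) (μ : ℂ) : Vec ℂ :=
  !₂[(μ - modeMatrix D A n 1 1) / modeMatrix D A n 1 0, 1]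

theorem modeVec_ne_zero (D A : Matrix (Fin 2) (Fin 2) ℝ) (n : ℕ) (μ : ℂ) :
    modeVec D A n μ ≠ 0 := fun h => by
  have := congrFun (congrArg WithLp.ofLp h) 1
  simp [modeVec] at this

theorem modeCLM_modeVec {D A : Matrix (Fin 2) (Fin 2) ℝ} {n : ℕ} {μ : ℂ}
    (h10 : modeMatrix D A n 1 0 ≠ 0) (h : modeChar D A n μ = 0) :
    modeCLM ℂ D A n (modeVec D A n μ) = μ • modeVec D A n μ := by
  have h10' : (modeMatrix D A n 1 0 : ℂ) ≠ 0 := Complex.ofReal_ne_zero.2 h10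
  rw [modeCLM_eq_smul_iff]
  simp only [modeVec, PiLp.toLp_apply, Matrix.cons_val_zero, Matrix.cons_val_one]
  constructor
  · rw [modeChar] at h
    field_simp
    linear_combination -h
  · field_simp
    ring

/-- The second row determines the first component from the second, so an eigenspace of one mode is
at most a line. -/
theorem eq_smul_modeVec {D A : Matrix (Fin 2) (Fin 2) ℝ} {n : ℕ} {μ : ℂ}
    (h10 : modeMatrix D A n 1 0 ≠ 0) {v : Vec ℂ} (hv : modeCLM ℂ D A n v = μ • v) :
    v = v 1 • modeVec D A n μ := by
  have h10' : (modeMatrix D A n 1 0 : ℂ) ≠ 0 := Complex.ofReal_ne_zero.2 h10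
  rw [modeCLM_eq_smul_iff] at hv
  rw [PiLp.ext_iff, Fin.forall_fin_two]
  simp only [modeVec, PiLp.smul_apply, Matrix.cons_val_zero, Matrix.cons_val_one, smul_eq_mul, mul_one,
    and_true]
  field_simp
  linear_combination hv.2

theorem modeChar_eq_zero {D A : Matrix (Fin 2) (Fin 2) ℝ} {n : ℕ} {μ : ℂ}
    (h10 : modeMatrix D A n 1 0 ≠ 0) {v : Vec ℂ} (hv : modeCLM ℂ D A n v = μ • v) (h0 : v ≠ 0) :
    modeChar D A n μ = 0 := by
  have hv1 : v 1 ≠ 0 := fun h => h0 (by rw [eq_smul_modeVec h10 hv, h, zero_smul])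
  rw [modeCLM_eq_smul_iff] at hv
  refine (mul_eq_zero.1 (?_ : modeChar D A n μ * v 1 = 0)).resolve_right hv1
  rw [modeChar]
  linear_combination (modeMatrix D A n 0 0 - μ) * hv.2 - modeMatrix D A n 1 0 * hv.1

/-- Each frequency whose matrix has eigenvalue `μ` contributes exactly one dimension to the
eigenspace, and no other frequency contributes. A double root within one mode would be harmless,
since it still has only one eigenvector. -/
theorem hasSimpleSpectrum_iff {D A : Matrix (Fin 2) (Fin 2) ℝ}
    (h10 : ∀ n, modeMatrix D A n 1 0 ≠ 0) :
    HasSimpleSpectrum D A ↔ ∀ k ℓ : ℕ, 1 ≤ k → k < ℓ → ∀ μ : ℂ,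
      ¬(modeChar D A k μ = 0 ∧ modeChar D A ℓ μ = 0) := by
  have hfree (μ : ℂ) : Module.Free ℂ (eigenspace D A μ) := Module.Free.of_divisionRing ℂ _
  constructor
  · rintro h k ℓ hk hkℓ μ ⟨h1, h2⟩
    have m1 := sinH10_mem_eigenspace (modeCLM_modeVec (h10 k) h1)
    have m2 := sinH10_mem_eigenspace (modeCLM_modeVec (h10 ℓ) h2)
    have hπ : Real.pi / 2 ≠ 0 := by positivity
    have n1 : sinH10 k (modeVec D A k μ) ≠ 0 := fun h0 => by
      have e := pair_sinC_smulL2 k k hk (modeVec D A k μ)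
      rw [if_pos rfl, ← valL2_sinH10, h0] at e
      have e0 : pair (sinC k) (valL2 (0 : H10 ℂ)) = 0 := by
        have := pair_smul (sinC k) (0 : ℂ) (0 : L2 ℂ)
        rwa [zero_smul, zero_smul] at this
      rw [e0] at e
      exact (smul_ne_zero hπ (modeVec_ne_zero D A k μ)) e.symm
    have hne : eigenspace D A μ ≠ ⊥ := fun hb => n1 (by rwa [hb, Submodule.mem_bot] at m1)
    obtain ⟨v, hv, hall⟩ := finrank_eq_one_iff'.1 (h μ hne)
    obtain ⟨c, hc⟩ := hall ⟨_, m1⟩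
    obtain ⟨d, hd⟩ := hall ⟨_, m2⟩
    have hc' : c • (v : H10 ℂ) = sinH10 k (modeVec D A k μ) := congrArg Subtype.val hc
    have hd' : d • (v : H10 ℂ) = sinH10 ℓ (modeVec D A ℓ μ) := congrArg Subtype.val hd
    have hc0 : c ≠ 0 := by
      rintro rfl
      exact n1 (by rw [← hc', zero_smul])
    have hv' : (v : H10 ℂ) = c⁻¹ • sinH10 k (modeVec D A k μ) := by
      rw [← hc', smul_smul, inv_mul_cancel₀ hc0, one_smul]
    -- If the eigenspace were a line, the two eigenfunctions would be proportional; their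
    -- coefficients at frequency `ℓ` exclude this.
    have e := pair_sinC_smulL2 ℓ ℓ (by omega) (modeVec D A ℓ μ)
    rw [if_pos rfl, ← valL2_sinH10, ← hd', hv', valL2_smul, valL2_smul, pair_smul, pair_smul,
      valL2_sinH10, pair_sinC_smulL2 ℓ k hk, if_neg (by omega), smul_zero, smul_zero] at e
    exact (smul_ne_zero hπ (modeVec_ne_zero D A ℓ μ)) e.symm
  · intro h μ hne
    obtain ⟨u, hu, hu0⟩ := Submodule.exists_mem_ne_zero_of_ne_bot hne
    have hex : ∃ n : ℕ, 1 ≤ n ∧ pair (sinC n) (valL2 u) ≠ 0 := by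
      by_contra! hall
      exact hu0 (valL2_injective (eq_zero_of_pair_sinC hall))
    obtain ⟨n, hn, hpn⟩ := hex
    have hun := modeCLM_pair_of_mem_eigenspace hu n
    have hchar := modeChar_eq_zero (h10 n) hun hpn
    have hother (w : H10 ℂ) (hw : w ∈ eigenspace D A μ) (m : ℕ) (hm : 1 ≤ m) (hmn : m ≠ n) :
        pair (sinC m) (valL2 w) = 0 := by
      by_contra hpm
      have hc := modeChar_eq_zero (h10 m) (modeCLM_pair_of_mem_eigenspace hw m) hpm
      rcases lt_or_gt_of_ne hmn with hlt | hlt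
      · exact h m n hm hlt μ ⟨hc, hchar⟩
      · exact h n m hn hlt μ ⟨hchar, hc⟩
    have hu1 : pair (sinC n) (valL2 u) 1 ≠ 0 := fun h0 => hpn (by
      rw [eq_smul_modeVec (h10 n) hun, h0, zero_smul])
    refine finrank_eq_one_iff'.2 ⟨⟨u, hu⟩, fun h0 => hu0 (congrArg Subtype.val h0), ?_⟩
    rintro ⟨w, hw⟩
    -- Both functions live on the frequency `n` alone, where their coefficients are multiples of
    -- `modeVec` given by the second components.
    refine ⟨pair (sinC n) (valL2 w) 1 / pair (sinC n) (valL2 u) 1, Subtype.ext ?_⟩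
    refine valL2_injective ?_
    change _ • valL2 u = valL2 w
    rw [← sub_eq_zero]
    refine eq_zero_of_pair_sinC fun m hm => ?_
    rw [sub_eq_add_neg, pair_add, pair_neg, pair_smul]
    by_cases hmn : m = n
    · subst hmn
      have hwn := modeCLM_pair_of_mem_eigenspace hw m
      have e := congrArg ((pair (sinC m) (valL2 w) 1 / pair (sinC m) (valL2 u) 1) • ·)
        (eq_smul_modeVec (h10 m) hun)
      simp only at e
      rw [e, smul_smul, div_mul_cancel₀ _ hu1, ← eq_smul_modeVec (h10 m) hwn, add_neg_cancel]
    · rw [hother u hu m hm hmn, hother w hw m hm hmn]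
      simp

theorem modeMatrix_transpose (D A : Matrix (Fin 2) (Fin 2) ℝ) (n : ℕ) :
    modeMatrix D.transpose A.transpose n = (modeMatrix D A n).transpose := by
  simp [modeMatrix]

theorem modeChar_transpose (D A : Matrix (Fin 2) (Fin 2) ℝ) (n : ℕ) (μ : ℂ) :
    modeChar D.transpose A.transpose n μ = modeChar D A n μ := by
  rw [modeChar, modeChar, modeMatrix_transpose]
  simp only [Matrix.transpose_apply]
  ring

/-! ### Resonance as a common eigenvalue of two modes -/

section Parameters

variable {ξ ρ τ : ℝ}

theorem modeMatrix_eq (ξ ρ τ : ℝ) (n : ℕ) : modeMatrix (matD ξ ρ) (matA ρ τ) n =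
    !![ξ * n ^ 2 + ρ / τ, -(ρ / 2) * (ξ * n ^ 2 + 1 / τ); -(2 / τ), ξ * n ^ 2 + 1 / τ] := by
  ext i j
  fin_cases i <;> fin_cases j <;> simp [modeMatrix, matD, matA] <;> ring

/-- The two characteristic polynomials differ by an affine function of `μ` (`hdiff`), so a common
root can only be its zero; the value there is the nonresonance expression divided by `4τ²` (`hkey`).
-/
theorem nonresonance_iff (hξ : 0 < ξ) (hτ : 0 < τ) :
    Nonresonance ξ ρ τ ↔ ∀ k ℓ : ℕ, 1 ≤ k → k < ℓ → ∀ μ : ℂ,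
      ¬(modeChar (matD ξ ρ) (matA ρ τ) k μ = 0 ∧ modeChar (matD ξ ρ) (matA ρ τ) ℓ μ = 0) := by
  have hξ' : (ξ : ℂ) ≠ 0 := Complex.ofReal_ne_zero.2 hξ.ne'
  have hτ' : (τ : ℂ) ≠ 0 := Complex.ofReal_ne_zero.2 hτ.ne'
  have hchar (n : ℕ) (μ : ℂ) : modeChar (matD ξ ρ) (matA ρ τ) n μ =
      (ξ * n ^ 2 + ρ / τ - μ) * (ξ * n ^ 2 + 1 / τ - μ)
        - (ρ / τ) * (ξ * n ^ 2 + 1 / τ) := by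
    rw [modeChar, modeMatrix_eq]
    simp
    ring
  have hkey (k ℓ : ℕ) : modeChar (matD ξ ρ) (matA ρ τ) k ((ξ * (k ^ 2 + ℓ ^ 2) + 1 / τ) / 2) *
      (4 * τ ^ 2) = ((ξ ^ 2 * τ ^ 2 * ((ℓ : ℝ) ^ 2 - (k : ℝ) ^ 2) ^ 2
      - 2 * ξ * ρ * τ * ((ℓ : ℝ) ^ 2 + (k : ℝ) ^ 2) - 2 * ρ - 1 : ℝ) : ℂ) := by
    rw [hchar]
    push_cast
    field_simp
    ring
  have hdiff (k ℓ : ℕ) (μ : ℂ) : modeChar (matD ξ ρ) (matA ρ τ) k μ -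
      modeChar (matD ξ ρ) (matA ρ τ) ℓ μ =
      2 * ξ * ((ℓ : ℂ) ^ 2 - k ^ 2) * (μ - (ξ * (k ^ 2 + ℓ ^ 2) + 1 / τ) / 2) := by
    rw [hchar, hchar]
    field_simp
    ring
  refine forall_congr' fun k => forall_congr' fun ℓ => forall_congr' fun hk =>
    forall_congr' fun hkℓ => ?_
  have h4 : (4 * (τ : ℂ) ^ 2) ≠ 0 := by simpa using hτ.ne'
  constructor
  · rintro h μ ⟨h1, h2⟩
    have e := hdiff k ℓ μ
    rw [h1, h2, sub_zero] at e
    have hne : (2 * ξ * ((ℓ : ℂ) ^ 2 - k ^ 2)) ≠ 0 := by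
      have : ((ℓ : ℝ) ^ 2 - k ^ 2) ≠ 0 := by
        have : (k : ℝ) < ℓ := by exact_mod_cast hkℓ
        have h0 : (0 : ℝ) ≤ k := Nat.cast_nonneg k
        nlinarith
      have h' : ((ℓ : ℂ) ^ 2 - k ^ 2) ≠ 0 := by exact_mod_cast this
      exact mul_ne_zero (mul_ne_zero two_ne_zero hξ') h'
    have hμ := sub_eq_zero.1 ((mul_eq_zero.1 e.symm).resolve_left hne)
    have := hkey k ℓ
    rw [← hμ, h1, zero_mul] at this
    exact h (by exact_mod_cast this.symm)
  · intro h h0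
    have e := hkey k ℓ
    rw [h0, Complex.ofReal_zero] at e
    have e1 := (mul_eq_zero.1 e).resolve_right h4
    refine h _ ⟨e1, ?_⟩
    have := hdiff k ℓ ((ξ * (k ^ 2 + ℓ ^ 2) + 1 / τ) / 2)
    rw [sub_self, mul_zero, e1, zero_sub, neg_eq_zero] at this
    exact this

theorem nonresonance_iff_hasSimpleSpectrum (hξ : 0 < ξ) (hτ : 0 < τ) :
    Nonresonance ξ ρ τ ↔ HasSimpleSpectrum (matD ξ ρ) (matA ρ τ) := by
  rw [nonresonance_iff hξ hτ, hasSimpleSpectrum_iff]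
  intro n
  rw [modeMatrix_eq]
  simpa using hτ.ne'

/-- Transposition preserves the characteristic polynomial. The lower left entry is now `-(ρ/2)(ξn² +
1/τ)`, whence the need for `ρ ≠ 0`. -/
theorem nonresonance_iff_hasSimpleSpectrum_transpose (hξ : 0 < ξ) (hρ : 0 < ρ) (hτ : 0 < τ) :
    Nonresonance ξ ρ τ ↔ HasSimpleSpectrum (matD ξ ρ).transpose (matA ρ τ).transpose := by
  rw [nonresonance_iff hξ hτ, hasSimpleSpectrum_iff]
  · simp_rw [modeChar_transpose]
  intro n
  rw [modeMatrix_transpose, modeMatrix_eq]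
  have : 0 < ρ / 2 * (ξ * n ^ 2 + 1 / τ) := by positivity
  simp only [Matrix.transpose_apply, Matrix.of_apply, Matrix.cons_val_zero, Matrix.cons_val_one]
  linarith

end Parameters

/-! ### Resonance prevents controllability -/

theorem hasWeakDeriv_smul_const {F : Type*} [NormedAddCommGroup F] [NormedSpace ℝ F]
    [CompleteSpace F] {a b : ℝ} (hab : a ≤ b) {s s' : ℝ → ℝ} (hs' : Continuous s')
    (hs : ∀ x, HasDerivAt s (s' x) x) (v : F) :
    HasWeakDeriv a b (fun x => s x • v) (fun x => s' x • v) := by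
  intro η h1 h2 h3
  have hsc : Continuous s := continuous_iff_continuousAt.2 fun x => (hs x).continuousAt
  have hd : Continuous (deriv η) := h1.continuous_deriv (by simp)
  have hzero (x : ℝ) (hx : x ∉ Ioo a b) : η x = 0 :=
    image_eq_zero_of_notMem_tsupport fun h => hx (h3 h)
  have e := intervalIntegral.integral_deriv_mul_eq_sub (a := a) (b := b)
    (fun x _ => (h1.differentiable (by simp) x).hasDerivAt) (fun x _ => hs x)
    (hd.intervalIntegrable _ _) (hs'.intervalIntegrable _ _)
  rw [hzero a (fun h => lt_irrefl _ h.1), hzero b (fun h => lt_irrefl _ h.2), zero_mul,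
    zero_mul, sub_zero, intervalIntegral.integral_add (f := fun x => deriv η x * s x)
      (g := fun x => η x * s' x) ((hd.mul hsc).intervalIntegrable _ _) ((h1.continuous.mul hs').intervalIntegrable _ _),
    intervalIntegral.integral_of_le hab, intervalIntegral.integral_of_le hab,
    integral_Ioc_eq_integral_Ioo, integral_Ioc_eq_integral_Ioo] at e
  simp_rw [smul_smul]
  rw [integral_smul_const, integral_smul_const, ← neg_smul, eq_neg_of_add_eq_zero_left e]

/-- The solution of `λ s - s' = w`, `s(T) = 0`. -/
def backwardScalar (lam T : ℝ) (w : ℝ → ℝ) (t : ℝ) : ℝ :=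
  -(Real.exp (lam * t) * ∫ r in T..t, Real.exp (-(lam * r)) * w r)

theorem hasDerivAt_backwardScalar (lam T : ℝ) {w : ℝ → ℝ} (hw : Continuous w) (t : ℝ) :
    HasDerivAt (backwardScalar lam T w) (lam * backwardScalar lam T w t - w t) t := by
  have hc : Continuous fun r => Real.exp (-(lam * r)) * w r := by fun_prop
  have h1 := intervalIntegral.integral_hasDerivAt_right (hc.intervalIntegrable T t)
    hc.stronglyMeasurable.stronglyMeasurableAtFilter hc.continuousAt
  have h2 := ((hasDerivAt_id t).const_mul lam).exp
  refine (h2.mul h1).neg.congr_deriv ?_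
  have : Real.exp (lam * t) * (Real.exp (-(lam * t)) * w t) = w t := by
    rw [← mul_assoc, ← Real.exp_add, add_neg_cancel, Real.exp_zero, one_mul]
  simp only [id, backwardScalar, this]
  ring

theorem memLp_continuous_smul_const {F : Type*} [NormedAddCommGroup F] [NormedSpace ℝ F] {T : ℝ}
    {s : ℝ → ℝ} (hs : Continuous s) (v : F) : MemLp (fun t => s t • v) 2 (timeMeasure T) := by
  obtain ⟨C, hC⟩ := (isCompact_Icc (a := 0) (b := T)).exists_bound_of_continuousOn
    hs.continuousOn
  refine MemLp.of_bound (hs.smul continuous_const).aestronglyMeasurable (C * ‖v‖) ?_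
  filter_upwards [ae_restrict_mem measurableSet_Ioo] with x hx
  rw [norm_smul]
  exact mul_le_mul_of_nonneg_right (hC x (Ioo_subset_Icc_self hx)) (norm_nonneg _)

theorem toHneg1_apply (f : L2 ℝ) (φ : H10 ℝ) : toHneg1 f φ = inner ℝ f (valL2 φ) := rfl

theorem HasTraceZero.smul {p : L2 ℝ} {c : Vec ℝ} (h : HasTraceZero p c) (r : ℝ) :
    HasTraceZero (r • p) (r • c) := by
  obtain ⟨q, h1, h2, h3⟩ := h
  refine ⟨fun x => r • q x, h1.const_smul r, ?_, by rw [← h3]⟩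
  filter_upwards [h2, Lp.coeFn_smul r p] with x hx hx'
  rw [hx', Pi.smul_apply, hx]

/-- An unobservable eigenfunction of the adjoint operator prevents controllability. -/
theorem not_approximatelyControllable {D A : Matrix (Fin 2) (Fin 2) ℝ} {B : Vec ℝ} {T : ℝ}
    (hT : 0 < T) {φ₀ : H10 ℝ} (hφ₀ : φ₀ ≠ 0) {W : L2 ℝ} (hW : HasWeakDeriv 0 Real.pi (dxL2 φ₀) W)
    {lam : ℝ} (heq : -matAct ℝ D.transpose W + matAct ℝ A.transpose (valL2 φ₀) = lam • valL2 φ₀)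
    {c : Vec ℝ} (hc : HasTraceZero (dxL2 φ₀) c)
    (hB : inner ℝ B (Matrix.toEuclideanCLM (𝕜 := ℝ) D.transpose c) = 0) :
    ¬ApproximatelyControllable D A B T := by
  intro hAC
  have hpos : 0 < ‖φ₀‖ := norm_pos_iff.2 hφ₀
  -- From the initial datum zero, the functional `⟨φ₀, ·⟩` cannot be approached closer than `‖φ₀‖`.
  obtain ⟨v, y, Y, hv, hy, ⟨hYc, hYy⟩, hε⟩ :=
    hAC 0 (innerSL ℝ φ₀) (‖φ₀‖ / 2) (by positivity)
  have hh : ContinuousOn (fun t => Y t φ₀) (Icc 0 T) := hYc.clm_apply continuousOn_const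
  -- Test with the separated solution `s(t) φ₀` and source `w(t) φ₀`: the boundary term vanishes by
  -- `hB`, the initial term because the datum is zero.
  have hzero (w : ℝ → ℝ) (hw : Continuous w) : ∫ t in Ioo 0 T, w t * Y t φ₀ = 0 := by
    set s := backwardScalar lam T w with hs
    have hd := hasDerivAt_backwardScalar lam T hw
    have hsc : Continuous s := continuous_iff_continuousAt.2 fun x => (hd x).continuousAt
    have hdc : Continuous fun t => lam * s t - w t := by fun_prop
    have hsol : IsBackwardSolution D A T (fun t => w t • valL2 φ₀) 0 (fun t => s t • φ₀)
        (fun t => s t • W) (fun t => (lam * s t - w t) • valL2 φ₀) := by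
      refine ⟨(hsc.smul continuous_const).continuousOn, memLp_continuous_smul_const hsc W,
        memLp_continuous_smul_const hdc _, ?_, ?_, ?_, ?_⟩
      · exact Filter.Eventually.of_forall fun t => hW.smul (s t)
      · exact hasWeakDeriv_smul_const hT.le hdc hd (valL2 φ₀)
      · refine Filter.Eventually.of_forall fun t => ?_
        simp only [valL2_smul, map_smul]
        have : s t • (-matAct ℝ D.transpose W + matAct ℝ A.transpose (valL2 φ₀)) =
            (lam * s t) • valL2 φ₀ := by rw [heq, smul_smul, mul_comm]
        rw [smul_add, smul_neg] at this
        rw [sub_smul, ← this]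
        abel
      · simp [hs, backwardScalar]
    have hid := hy.identity _ _ _ _ (fun t => s t • c)
      (memLp_continuous_smul_const hw (valL2 φ₀)) hsol
      (Filter.Eventually.of_forall fun t => hc.smul (s t))
    simp only [map_smul, inner_smul_right, hB, mul_zero, zero_mul, integral_zero, add_zero,
      zero_apply, smul_zero] at hid
    refine (integral_congr_ae ?_).trans hid
    filter_upwards [hYy] with t ht
    rw [ht, toHneg1_apply]
  have hT' : T ∈ Icc 0 T := right_mem_Icc.2 hT.le
  have hYT : Y T φ₀ = 0 := by
    -- The choice `w = ⟨Y, φ₀⟩`, extended continuously to the line, gives `∫ ⟨Y, φ₀⟩² = 0`;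
    -- continuity carries the conclusion to the end point `T`.
    set h : ℝ → ℝ := IccExtend hT.le ((Icc 0 T).domRestrict fun t => Y t φ₀) with hdef
    have hcont : Continuous h := (continuousOn_iff_continuous_domRestrict.1 hh).Icc_extend'
    have heqh : ∀ t ∈ Icc 0 T, h t = Y t φ₀ := fun t ht => IccExtend_of_mem hT.le _ ht
    have h2 : ∫ t in Ioo 0 T, h t * h t = 0 := by
      refine (setIntegral_congr_fun measurableSet_Ioo fun t ht => ?_).trans (hzero h hcont)
      simp only [heqh t (Ioo_subset_Icc_self ht)]
    have h3 : (fun t => h t * h t) =ᵐ[timeMeasure T] 0 := by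
      refine (integral_eq_zero_iff_of_nonneg (fun t => mul_self_nonneg _) ?_).1 h2
      exact ((hcont.mul hcont).integrableOn_Icc).mono_set Ioo_subset_Icc_self
    have h4 := eqOn_Icc_of_ae_eq_Ioo hT (hcont.mul hcont).continuousOn continuousOn_const h3
    rw [← heqh T hT']
    exact mul_self_eq_zero.1 (h4 hT')
  have h1 := (Y T - innerSL ℝ φ₀).le_opNorm φ₀
  rw [sub_apply, hYT, zero_sub, norm_neg, innerSL_apply_apply, real_inner_self_eq_norm_sq,
    Real.norm_of_nonneg (by positivity)] at h1
  nlinarith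

theorem hasTraceZero_smulL2 (s : C(ℝ, ℝ)) (v : Vec ℝ) : HasTraceZero (smulL2 s v) (s 0 • v) :=
  ⟨_, (s.continuous.smul continuous_const).continuousOn, coeFn_smulL2 s v, rfl⟩

theorem HasTraceZero.add {p q : L2 ℝ} {c d : Vec ℝ} (h : HasTraceZero p c)
    (h' : HasTraceZero q d) : HasTraceZero (p + q) (c + d) := by
  obtain ⟨f, h1, h2, h3⟩ := h
  obtain ⟨g, h1', h2', h3'⟩ := h'
  refine ⟨fun x => f x + g x, h1.add h1', ?_, by rw [← h3, ← h3']⟩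
  filter_upwards [h2, h2', Lp.coeFn_add p q] with x hx hx' hx''
  rw [hx'', Pi.add_apply, hx, hx']

/-- The eigenvector for the eigenvalue `μ` of the transposed mode matrix. -/
def adjointVec (ξ ρ τ : ℝ) (n : ℕ) (μ : ℝ) : Vec ℝ := !₂[1, τ / 2 * (ξ * n ^ 2 + ρ / τ - μ)]

/-- The second component is chosen to satisfy the first row; the second row is then the
characteristic equation. -/
theorem modeCLM_adjointVec {ξ ρ τ : ℝ} (hτ : 0 < τ) {n : ℕ} {μ : ℝ}
    (h : (ξ * n ^ 2 + ρ / τ - μ) * (ξ * n ^ 2 + 1 / τ - μ) = ρ / τ * (ξ * n ^ 2 + 1 / τ)) :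
    modeCLM ℝ (matD ξ ρ).transpose (matA ρ τ).transpose n (adjointVec ξ ρ τ n μ) =
      μ • adjointVec ξ ρ τ n μ := by
  have hτ' := hτ.ne'
  rw [PiLp.ext_iff, Fin.forall_fin_two, modeCLM, Matrix.ofLp_toEuclideanCLM, Matrix.mulVec,
    Matrix.mulVec, dotProduct, dotProduct, Fin.sum_univ_two, Fin.sum_univ_two,
    modeMatrix_transpose, modeMatrix_eq]
  simp only [adjointVec, Matrix.map_apply, Matrix.transpose_apply, Matrix.of_apply,
    Matrix.cons_val_zero, Matrix.cons_val_one, Algebra.algebraMap_self, RingHom.id_apply,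
    PiLp.smul_apply, smul_eq_mul]
  constructor
  · field_simp
    ring
  · have e : τ / 2 * (ρ / τ) = ρ / 2 := by field_simp
    linear_combination (τ / 2) * h + (ξ * n ^ 2 + 1 / τ) * e

theorem sinH10_eigen {D A : Matrix (Fin 2) (Fin 2) ℝ} {μ : ℝ} {n : ℕ} {v : Vec ℝ}
    (hv : modeCLM ℝ D A n v = μ • v) :
    -matAct ℝ D (-((n : ℝ) ^ 2 • smulL2 (sinC n) v)) + matAct ℝ A (valL2 (sinH10 n v)) =
      μ • valL2 (sinH10 n v) := by
  rw [valL2_sinH10, matAct_smulL2, map_neg, neg_neg, map_smul, matAct_smulL2, ← smulL2_smul,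
    ← smulL2_smul, ← smulL2_add, ← hv, modeCLM_apply]

/-- The observation is `ξ` times the first component of `φ_x(0)`. With adjoint eigenvectors
normalized to first component `1` it equals `ξ k` and `ξ ℓ`, and it cancels in `ℓ φ_k - k φ_ℓ`. -/
theorem nonresonance_of_approximatelyControllable {ξ ρ τ T : ℝ} (hτ : 0 < τ)
    (hT : 0 < T) (h : ApproximatelyControllable (matD ξ ρ) (matA ρ τ) vecB T) :
    Nonresonance ξ ρ τ := by
  intro k ℓ hk hkℓ hres
  have hτ' := hτ.ne'
  have hk0 : (k : ℝ) ≠ 0 := by positivity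
  have hℓ0 : (ℓ : ℝ) ≠ 0 := by
    have : 0 < ℓ := by omega
    positivity
  -- The only possible common eigenvalue of the two modes; it is real.
  obtain ⟨μ, hμ⟩ : ∃ μ, μ = (ξ * ((k : ℝ) ^ 2 + ℓ ^ 2) + 1 / τ) / 2 := ⟨_, rfl⟩
  have hck : (ξ * k ^ 2 + ρ / τ - μ) * (ξ * k ^ 2 + 1 / τ - μ) = ρ / τ * (ξ * k ^ 2 + 1 / τ) := by
    rw [hμ]
    field_simp
    linear_combination hres
  have hcℓ : (ξ * ℓ ^ 2 + ρ / τ - μ) * (ξ * ℓ ^ 2 + 1 / τ - μ) = ρ / τ * (ξ * ℓ ^ 2 + 1 / τ) := by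
    rw [hμ]
    field_simp
    linear_combination hres
  set a := adjointVec ξ ρ τ k μ with ha
  set b := adjointVec ξ ρ τ ℓ μ with hb
  have ek := sinH10_eigen (modeCLM_adjointVec hτ hck)
  have el := sinH10_eigen (modeCLM_adjointVec hτ hcℓ)
  rw [← ha] at ek
  rw [← hb] at el
  set φ₀ : H10 ℝ := (ℓ : ℝ) • sinH10 k a + (-(k : ℝ)) • sinH10 ℓ b with hφ₀
  have hne : φ₀ ≠ 0 := by
    intro h0
    have e : pair (sinC k) (valL2 φ₀) = (ℓ : ℝ) • (Real.pi / 2) • a := by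
      rw [hφ₀, valL2_add, valL2_smul, valL2_smul, valL2_sinH10, valL2_sinH10, pair_add, pair_smul,
        pair_smul, pair_sinC_smulL2 k k hk, pair_sinC_smulL2 k ℓ (by omega), if_pos rfl,
        if_neg (by omega), smul_zero, add_zero]
    have e0 : pair (sinC k) (valL2 (0 : H10 ℝ)) = 0 := by
      have := pair_smul (sinC k) (0 : ℝ) (0 : L2 ℝ)
      rwa [zero_smul, zero_smul] at this
    rw [h0, e0] at e
    have := congrFun (congrArg WithLp.ofLp e) 0
    simp [ha, adjointVec, Real.pi_ne_zero, hℓ0] at this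
  refine not_approximatelyControllable (lam := μ) (c := (ℓ : ℝ) • dsinC k 0 • a +
      (-(k : ℝ)) • dsinC ℓ 0 • b) hT hne
    (((hasWeakDeriv_dxL2_sinH10 k a).smul (ℓ : ℝ)).add
      ((hasWeakDeriv_dxL2_sinH10 ℓ b).smul (-(k : ℝ)))) ?_
    (((hasTraceZero_smulL2 _ a).smul _).add ((hasTraceZero_smulL2 _ b).smul _)) ?_ h
  · rw [hφ₀, valL2_add, valL2_smul, valL2_smul, map_add, map_add, map_smul, map_smul,
      map_smul (matAct ℝ (matA ρ τ).transpose), map_smul (matAct ℝ (matA ρ τ).transpose),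
      smul_add, smul_comm μ, smul_comm μ (-(k : ℝ)), ← ek, ← el, smul_add, smul_add, smul_neg,
      smul_neg]
    abel
  · have e : ∀ x : Vec ℝ, inner ℝ vecB
        (Matrix.toEuclideanCLM (𝕜 := ℝ) (matD ξ ρ).transpose x) = ξ * x 0 := by
      intro x
      rw [PiLp.inner_apply, Fin.sum_univ_two, Matrix.ofLp_toEuclideanCLM]
      simp [vecB, matD, Matrix.mulVec, dotProduct, Fin.sum_univ_two]
    rw [e]
    simp [ha, hb, adjointVec, dsinC]
    right
    ring

/-! ### Uniqueness for Dirichlet series -/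

/-- The series converges uniformly on every half-plane `Re z > δ > 0`, hence is holomorphic on `Re z
> 0`, and the identity theorem applies. -/
theorem tsum_exp_eq_zero_of_Ioo {ι : Type*} {lam d : ι → ℝ} (hpos : ∀ j, 0 ≤ lam j)
    (hsum : ∀ δ : ℝ, 0 < δ → Summable fun j => |d j| * Real.exp (-(lam j * δ))) {a b : ℝ}
    (ha : 0 ≤ a) (hab : a < b)
    (h : ∀ s ∈ Ioo a b, ∑' j, d j * Real.exp (-(lam j * s)) = 0) {s : ℝ} (hs : 0 < s) :
    ∑' j, d j * Real.exp (-(lam j * s)) = 0 := by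
  set F : ℂ → ℂ := fun z => ∑' j, (d j : ℂ) * Complex.exp (-(lam j * z)) with hF
  have hFr (s : ℝ) : F s = ((∑' j, d j * Real.exp (-(lam j * s)) : ℝ) : ℂ) := by
    rw [Complex.ofReal_tsum]
    simp [hF]
  have hdiff (δ : ℝ) (hδ : 0 < δ) : DifferentiableOn ℂ F {z | δ < z.re} := by
    refine Complex.differentiableOn_tsum_of_summable_norm (hsum δ hδ) (fun j => ?_)
      (isOpen_lt continuous_const Complex.continuous_re) fun j z hz => ?_
    · exact Differentiable.differentiableOn (by fun_prop)
    · rw [norm_mul, Complex.norm_real, Real.norm_eq_abs, Complex.norm_exp]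
      refine mul_le_mul_of_nonneg_left (Real.exp_le_exp.2 ?_) (abs_nonneg _)
      simp only [Complex.neg_re, Complex.re_ofReal_mul]
      exact neg_le_neg (mul_le_mul_of_nonneg_left (le_of_lt hz) (hpos j))
  have hU : IsOpen {z : ℂ | 0 < z.re} := isOpen_lt continuous_const Complex.continuous_re
  have hdiff0 : DifferentiableOn ℂ F {z | 0 < z.re} := by
    intro z hz
    have hz' : 0 < z.re := hz
    refine ((hdiff (z.re / 2) (by linarith)).differentiableAt ?_).differentiableWithinAt
    exact (isOpen_lt continuous_const Complex.continuous_re).mem_nhds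
      (show z.re / 2 < z.re by linarith)
  have han := hdiff0.analyticOnNhd hU
  have hpre : IsPreconnected {z : ℂ | 0 < z.re} := (convex_halfSpace_re_gt 0).isPreconnected
  set m := (a + b) / 2 with hm
  have hmab : m ∈ Ioo a b := ⟨by linarith, by linarith⟩
  have htend : Filter.Tendsto (fun x : ℝ => (x : ℂ)) (nhdsWithin m {m}ᶜ)
      (nhdsWithin (m : ℂ) {(m : ℂ)}ᶜ) := by
    refine tendsto_nhdsWithin_iff.2 ⟨?_, ?_⟩
    · exact (Complex.continuous_ofReal.tendsto m).mono_left nhdsWithin_le_nhds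
    · filter_upwards [self_mem_nhdsWithin] with x hx
      simpa using hx
  have hfreq : ∃ᶠ z in nhdsWithin (m : ℂ) {(m : ℂ)}ᶜ, F z = 0 := by
    refine htend.frequently (Filter.Eventually.frequently ?_)
    filter_upwards [mem_nhdsWithin_of_mem_nhds (isOpen_Ioo.mem_nhds hmab)] with x hx
    rw [hFr, h x hx, Complex.ofReal_zero]
  have hzero := han.eqOn_zero_of_preconnected_of_frequently_eq_zero hpre
    (show (m : ℂ) ∈ {z : ℂ | 0 < z.re} by simpa using ha.trans_lt hmab.1) hfreq
  have := hzero (show (s : ℂ) ∈ {z : ℂ | 0 < z.re} by simpa using hs)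
  rw [hFr, Pi.zero_apply] at this
  exact_mod_cast this

/-- A Dirichlet series with distinct exponents that vanishes on an interval has no nonzero
coefficient. -/
theorem eq_zero_of_tsum_exp_eq_zero {ι : Type*} {lam d : ι → ℝ}
    (hinj : Function.Injective lam) (hfin : ∀ R, {j | lam j ≤ R}.Finite) (hpos : ∀ j, 0 ≤ lam j)
    (hsum : ∀ δ : ℝ, 0 < δ → Summable fun j => |d j| * Real.exp (-(lam j * δ))) {a b : ℝ}
    (ha : 0 ≤ a) (hab : a < b)
    (h : ∀ s ∈ Ioo a b, ∑' j, d j * Real.exp (-(lam j * s)) = 0) (j : ι) : d j = 0 := by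
  classical
  by_contra hj
  have hfin' : {i | d i ≠ 0 ∧ lam i ≤ lam j}.Finite := (hfin (lam j)).subset fun i hi => hi.2
  -- The smallest exponent with a nonzero coefficient. Multiplying the series by `exp (lam i₀ * s)`
  -- and letting `s → ∞` isolates `d i₀`.
  obtain ⟨i₀, hi₀, hmin⟩ := Set.exists_min_image _ lam hfin' ⟨j, hj, le_rfl⟩
  have hmin' : ∀ i, d i ≠ 0 → lam i₀ ≤ lam i := by
    intro i hi
    rcases le_total (lam i) (lam j) with h1 | h1
    · exact hmin i ⟨hi, h1⟩
    · exact hi₀.2.trans h1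
  have hlim : Filter.Tendsto (fun s : ℝ => ∑' i, d i * Real.exp (-((lam i - lam i₀) * s)))
      Filter.atTop (nhds (∑' i, if i = i₀ then d i₀ else 0)) := by
    refine tendsto_tsum_of_dominated_convergence
      (bound := fun i => |d i| * Real.exp (-(lam i * 1)) * Real.exp (lam i₀))
      ((hsum 1 one_pos).mul_right _) (fun i => ?_) ?_
    · split_ifs with hi
      · subst hi
        simp
      · by_cases hd : d i = 0
        · simp [hd]
        · have hlt : 0 < lam i - lam i₀ :=
            sub_pos.2 (lt_of_le_of_ne (hmin' i hd) fun he => hi (hinj he).symm)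
          have h1 : Filter.Tendsto (fun s : ℝ => -((lam i - lam i₀) * s)) Filter.atTop
              Filter.atBot :=
            Filter.tendsto_neg_atTop_atBot.comp (Filter.tendsto_id.const_mul_atTop hlt)
          simpa using (Real.tendsto_exp_atBot.comp h1).const_mul (d i)
    · filter_upwards [Filter.eventually_ge_atTop (1 : ℝ)] with s hs i
      by_cases hd : d i = 0
      · simp [hd]
      · rw [norm_mul, Real.norm_eq_abs, Real.norm_of_nonneg (Real.exp_pos _).le, mul_assoc,
          ← Real.exp_add]
        refine mul_le_mul_of_nonneg_left (Real.exp_le_exp.2 ?_) (abs_nonneg _)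
        nlinarith [hmin' i hd]
  have hzero : ∀ᶠ s : ℝ in Filter.atTop,
      ∑' i, d i * Real.exp (-((lam i - lam i₀) * s)) = 0 := by
    filter_upwards [Filter.eventually_gt_atTop (0 : ℝ)] with s hs
    have := tsum_exp_eq_zero_of_Ioo hpos hsum ha hab h hs
    have e (i : ι) : d i * Real.exp (-((lam i - lam i₀) * s)) =
        d i * Real.exp (-(lam i * s)) * Real.exp (lam i₀ * s) := by
      rw [mul_assoc, ← Real.exp_add]
      ring_nf
    simp_rw [e]
    rw [tsum_mul_right, this, zero_mul]
  have := tendsto_nhds_unique (hlim.congr' hzero) tendsto_const_nhds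
  rw [tsum_ite_eq] at this
  exact hi₀.1 this

/-! ### Functions with values in a Hilbert space, given by their coordinates -/

section HilbertCoordinates

variable {ι : Type*} {H : Type*} [NormedAddCommGroup H] [InnerProductSpace ℝ H]

theorem _root_.HilbertBasis.hasSum_sq_inner (b : HilbertBasis ι ℝ H) (x : H) :
    HasSum (fun j => inner ℝ (b j) x ^ 2) (‖x‖ ^ 2) := by
  have := b.hasSum_inner_mul_inner x x
  rw [real_inner_self_eq_norm_sq] at this
  refine this.congr_fun fun j => ?_
  rw [real_inner_comm, sq]

theorem _root_.HilbertBasis.exists_inner_eq (b : HilbertBasis ι ℝ H) {a : ι → ℝ}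
    (ha : Summable fun j => a j ^ 2) :
    ∃ x : H, (∀ j, inner ℝ (b j) x = a j) ∧ HasSum (fun j => a j • b j) x := by
  have hmem : Memℓp a 2 := by
    rw [memℓp_gen_iff (by norm_num)]
    simpa using ha
  refine ⟨b.repr.symm ⟨a, hmem⟩, fun j => ?_, b.hasSum_repr_symm _⟩
  rw [← b.repr_apply_apply, LinearIsometryEquiv.apply_symm_apply]

theorem _root_.HilbertBasis.ext_inner (b : HilbertBasis ι ℝ H) {x y : H}
    (h : ∀ j, inner ℝ (b j) x = inner ℝ (b j) y) : x = y := by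
  refine b.repr.injective (lp.ext (funext fun j => ?_))
  rw [b.repr_apply_apply, b.repr_apply_apply, h]

/-- A function with values in a Hilbert space exists as soon as the squares of its coordinates
have summable integrals. -/
theorem exists_memLp_of_coordinates [Countable ι] (b : HilbertBasis ι ℝ H) {α : Type*}
    [MeasurableSpace α] {μ : Measure α} {a : ι → α → ℝ}
    (hm : ∀ j, AEStronglyMeasurable (a j) μ) (hi : ∀ j, Integrable (fun t => a j t ^ 2) μ)
    (hs : Summable fun j => ∫ t, a j t ^ 2 ∂μ) :
    ∃ y : α → H, MemLp y 2 μ ∧ ∀ᵐ t ∂μ, ∀ j, inner ℝ (b j) (y t) = a j t := by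
  classical
  have hm2 (j : ι) : AEMeasurable (fun t => ENNReal.ofReal (a j t ^ 2)) μ :=
    ((hm j).aemeasurable.pow_const 2).ennreal_ofReal
  -- By Tonelli the sum of squares is integrable, hence finite almost everywhere; on the exceptional
  -- null set the function is set to `0`.
  have hlint : ∫⁻ t, ∑' j, ENNReal.ofReal (a j t ^ 2) ∂μ ≠ ⊤ := by
    rw [lintegral_tsum hm2]
    have (j : ι) : ∫⁻ t, ENNReal.ofReal (a j t ^ 2) ∂μ = ENNReal.ofReal (∫ t, a j t ^ 2 ∂μ) :=
      (ofReal_integral_eq_lintegral_ofReal (hi j)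
        (Filter.Eventually.of_forall fun t => sq_nonneg _)).symm
    simp_rw [this]
    exact hs.tsum_ofReal_ne_top
  have hae : ∀ᵐ t ∂μ, Summable fun j => a j t ^ 2 := by
    have hmeas : AEMeasurable (fun t => ∑' j, ENNReal.ofReal (a j t ^ 2)) μ :=
      AEMeasurable.tsum hm2
    filter_upwards [ae_lt_top' hmeas hlint] with t ht
    have := ENNReal.summable_toReal ht.ne
    refine this.congr fun j => ?_
    rw [ENNReal.toReal_ofReal (sq_nonneg _)]
  set y : α → H := fun t => if h : Summable fun j => a j t ^ 2 then
    (b.exists_inner_eq h).choose else 0 with hy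
  have hy1 : ∀ᵐ t ∂μ, ∀ j, inner ℝ (b j) (y t) = a j t := by
    filter_upwards [hae] with t ht j
    simp only [hy, dif_pos ht]
    exact (b.exists_inner_eq ht).choose_spec.1 j
  have hy2 : ∀ᵐ t ∂μ, HasSum (fun j => a j t • b j) (y t) := by
    filter_upwards [hae] with t ht
    simp only [hy, dif_pos ht]
    exact (b.exists_inner_eq ht).choose_spec.2
  have hym : AEStronglyMeasurable y μ :=
    aestronglyMeasurable_of_tendsto_ae Filter.atTop
      (f := fun (s : Finset ι) t => ∑ j ∈ s, a j t • b j)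
      (fun s => Finset.aestronglyMeasurable_fun_sum _ fun j _ => (hm j).smul_const (b j)) hy2
  refine ⟨y, ?_, hy1⟩
  rw [memLp_two_iff_integrable_sq_norm hym]
  refine ⟨(hym.norm.pow 2), ?_⟩
  rw [hasFiniteIntegral_iff_ofReal (Filter.Eventually.of_forall fun t => sq_nonneg _)]
  refine lt_of_le_of_lt (le_of_eq ?_) hlint.lt_top
  refine lintegral_congr_ae ?_
  filter_upwards [hy1] with t ht
  have h1 := b.hasSum_sq_inner (y t)
  rw [← h1.tsum_eq, ENNReal.ofReal_tsum_of_nonneg (fun j => sq_nonneg _) h1.summable]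
  simp_rw [ht]

/-- Parseval's identity for square integrable functions with values in a Hilbert space. -/
theorem hasSum_integral_inner_mul_inner [Countable ι] (b : HilbertBasis ι ℝ H) {α : Type*}
    [MeasurableSpace α] {μ : Measure α} {f g : α → H} (hf : MemLp f 2 μ) (hg : MemLp g 2 μ) :
    HasSum (fun j => ∫ t, inner ℝ (b j) (f t) * inner ℝ (b j) (g t) ∂μ)
      (∫ t, inner ℝ (f t) (g t) ∂μ) := by
  have hmf (j : ι) : AEStronglyMeasurable (fun t => inner ℝ (b j) (f t)) μ :=
    hf.1.const_inner
  have hmg (j : ι) : AEStronglyMeasurable (fun t => inner ℝ (b j) (g t)) μ :=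
    hg.1.const_inner
  -- Domination by `|xy| ≤ (x² + y²)/2`, summed with the pointwise Parseval identity.
  have hB (t : α) : HasSum (fun j => (inner ℝ (b j) (f t) ^ 2 + inner ℝ (b j) (g t) ^ 2) / 2)
      ((‖f t‖ ^ 2 + ‖g t‖ ^ 2) / 2) :=
    ((b.hasSum_sq_inner _).add (b.hasSum_sq_inner _)).div_const 2
  refine hasSum_integral_of_dominated_convergence
    (fun j t => (inner ℝ (b j) (f t) ^ 2 + inner ℝ (b j) (g t) ^ 2) / 2)
    (fun j => (hmf j).mul (hmg j)) (fun j => Filter.Eventually.of_forall fun t => ?_)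
    (Filter.Eventually.of_forall fun t => (hB t).summable) ?_
    (Filter.Eventually.of_forall fun t => ?_)
  · rw [Real.norm_eq_abs, abs_mul]
    nlinarith [sq_nonneg (|inner ℝ (b j) (f t)| - |inner ℝ (b j) (g t)|),
      sq_abs (inner ℝ (b j) (f t)), sq_abs (inner ℝ (b j) (g t))]
  · simp_rw [fun t => (hB t).tsum_eq]
    exact (((memLp_two_iff_integrable_sq_norm hf.1).1 hf).add
      ((memLp_two_iff_integrable_sq_norm hg.1).1 hg)).div_const 2
  · refine (b.hasSum_inner_mul_inner (f t) (g t)).congr_fun fun j => ?_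
    rw [real_inner_comm]

/-- A function with values in a Hilbert space is continuous if its coordinates are, and are
dominated by a square summable sequence. -/
theorem exists_continuousOn_of_coordinates (b : HilbertBasis ι ℝ H) {α : Type*}
    [TopologicalSpace α] {K : Set α} {a : ι → α → ℝ} (hc : ∀ j, ContinuousOn (a j) K)
    {B : ι → ℝ} (hB : Summable fun j => B j ^ 2) (hle : ∀ j, ∀ t ∈ K, |a j t| ≤ B j) :
    ∃ Y : α → H, ContinuousOn Y K ∧ ∀ t ∈ K, ∀ j, inner ℝ (b j) (Y t) = a j t := by
  classical
  have hsq : ∀ j, ∀ t ∈ K, a j t ^ 2 ≤ B j ^ 2 := fun j t ht =>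
    sq_le_sq' (neg_le_of_abs_le (hle j t ht)) (le_of_abs_le (hle j t ht))
  have hs : ∀ t ∈ K, Summable fun j => a j t ^ 2 := fun t ht =>
    hB.of_nonneg_of_le (fun j => sq_nonneg _) fun j => hsq j t ht
  choose! Y hY using fun t ht => b.exists_inner_eq (hs t ht)
  refine ⟨Y, ?_, fun t ht => (hY t ht).1⟩
  -- The squared error of a partial sum is a tail of `∑ a j t ^ 2`, bounded by the tail of `∑ B j ^
  -- 2` uniformly in `t`.
  have hunif : TendstoUniformlyOn (fun (s : Finset ι) t => ∑ j ∈ s, a j t • b j) Y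
      Filter.atTop K := by
    rw [Metric.tendstoUniformlyOn_iff]
    intro ε hε
    have := tendsto_tsum_compl_atTop_zero fun j => B j ^ 2
    filter_upwards [this.eventually (gt_mem_nhds (show (0 : ℝ) < ε ^ 2 by positivity))]
      with s hs' t ht
    rw [dist_eq_norm]
    refine lt_of_pow_lt_pow_left₀ 2 hε.le (lt_of_le_of_lt ?_ hs')
    have h1 := b.hasSum_sq_inner (Y t - ∑ j ∈ s, a j t • b j)
    have h2 (j : ι) : inner ℝ (b j) (Y t - ∑ i ∈ s, a i t • b i) =
        if j ∈ s then 0 else a j t := by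
      rw [inner_sub_right, (hY t ht).1, inner_sum]
      simp_rw [inner_smul_right, orthonormal_iff_ite.1 b.orthonormal j]
      simp only [mul_ite, mul_one, mul_zero, Finset.sum_ite_eq]
      split_ifs <;> simp
    simp_rw [h2] at h1
    rw [← h1.tsum_eq]
    have h3 : (∑' j, (if j ∈ s then 0 else a j t) ^ 2) = ∑' j : {j // j ∉ s}, a j t ^ 2 := by
      refine Eq.trans (tsum_congr fun j => ?_)
        (tsum_subtype {j | j ∉ s} fun j => a j t ^ 2).symm
      by_cases hj : j ∈ s <;> simp [hj]
    rw [h3]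
    exact Summable.tsum_le_tsum (fun j => hsq j t ht) ((hs t ht).subtype _) (hB.subtype _)
  exact hunif.continuousOn (Filter.Eventually.of_forall fun s =>
    continuousOn_finsetSum _ fun j _ => (hc j).smul continuousOn_const).frequently

end HilbertCoordinates

/-! ### The sine bases of `L²` and of `H¹₀` -/

/-- The Fourier sine coefficient of frequency `k + 1`, for the orthonormal system
`√(2/π) sin ((k + 1) x)`. -/
def coef (k : ℕ) (f : L2 ℝ) : Vec ℝ := √(2 / Real.pi) • pair (sinC (k + 1)) f

theorem coef_add (k : ℕ) (f g : L2 ℝ) : coef k (f + g) = coef k f + coef k g := by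
  rw [coef, pair_add, smul_add]; rfl

theorem coef_neg (k : ℕ) (f : L2 ℝ) : coef k (-f) = -coef k f := by
  rw [coef, pair_neg, smul_neg]; rfl

theorem coef_smul (k : ℕ) (c : ℝ) (f : L2 ℝ) : coef k (c • f) = c • coef k f := by
  rw [coef, pair_smul, smul_comm]; rfl

theorem coef_matAct (k : ℕ) (M : Matrix (Fin 2) (Fin 2) ℝ) (f : L2 ℝ) :
    coef k (matAct ℝ M f) = Matrix.toEuclideanCLM (n := Fin 2) (𝕜 := ℝ) M (coef k f) := by
  rw [coef, pair_matAct, coef, map_smul]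
  rfl

theorem coef_of_hasWeakDeriv_dxL2 {u : H10 ℝ} {w : L2 ℝ}
    (h : HasWeakDeriv 0 Real.pi (dxL2 u) w) (k : ℕ) :
    coef k w = -((k + 1 : ℝ) ^ 2 • coef k (valL2 u)) := by
  rw [coef, pair_sinC_of_hasWeakDeriv_dxL2 h, smul_neg, smul_comm, coef]
  push_cast
  rfl

theorem inner_H10_smul_left (r : ℝ) (u v : H10 ℝ) : inner ℝ (r • u) v = r * inner ℝ u v :=
  real_inner_smul_left u v r

theorem inner_H10_smul_right (r : ℝ) (u v : H10 ℝ) : inner ℝ u (r • v) = r * inner ℝ u v :=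
  real_inner_smul_right u v r

/-- The element `√(2/π) sin ((k + 1) x) e_i` of `H¹₀`. -/
def sinVec (j : ℕ × Fin 2) : H10 ℝ :=
  √(2 / Real.pi) • sinH10 (j.1 + 1) (EuclideanSpace.single j.2 1)

theorem valL2_sinVec (j : ℕ × Fin 2) : valL2 (sinVec j) =
    √(2 / Real.pi) • smulL2 (sinC (j.1 + 1)) (EuclideanSpace.single j.2 1) := rfl

theorem inner_valL2_sinVec (j : ℕ × Fin 2) (f : L2 ℝ) :
    inner ℝ (valL2 (sinVec j)) f = coef j.1 f j.2 := by
  rw [valL2_sinVec, real_inner_smul_left, inner_smulL2, coef,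
    EuclideanSpace.inner_single_left]
  simp

theorem coef_sinVec (k : ℕ) (j : ℕ × Fin 2) :
    coef k (valL2 (sinVec j)) = if k = j.1 then EuclideanSpace.single j.2 1 else 0 := by
  rw [valL2_sinVec, coef_smul, coef, pair_sinC_smulL2 _ _ (by omega)]
  have : √(2 / Real.pi) * √(2 / Real.pi) * (Real.pi / 2) = 1 := by
    rw [Real.mul_self_sqrt (by positivity)]
    field_simp
  by_cases h : k = j.1
  · rw [if_pos (by omega), if_pos h, smul_smul, smul_smul, this, one_smul]
  · rw [if_neg (by omega), if_neg h, smul_zero, smul_zero]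

theorem orthonormal_valL2_sinVec : Orthonormal ℝ fun j => valL2 (sinVec j) := by
  rw [orthonormal_iff_ite]
  rintro ⟨k, i⟩ ⟨l, m⟩
  rw [inner_valL2_sinVec, coef_sinVec]
  by_cases h : k = l
  · subst h
    by_cases h' : i = m <;> simp [h', PiLp.single_apply]
  · simp [h]

theorem eq_zero_of_coef {f : L2 ℝ} (h : ∀ k, coef k f = 0) : f = 0 := by
  refine eq_zero_of_pair_sinC fun n hn => ?_
  obtain ⟨k, rfl⟩ : ∃ k, n = k + 1 := ⟨n - 1, by omega⟩
  exact (smul_eq_zero.1 (h k)).resolve_left (by positivity)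

theorem span_valL2_sinVec_orthogonal :
    (Submodule.span ℝ (range fun j => valL2 (sinVec j)))ᗮ = ⊥ := by
  rw [Submodule.eq_bot_iff]
  intro f hf
  rw [Submodule.mem_orthogonal] at hf
  refine eq_zero_of_coef fun k => ?_
  ext i
  rw [← inner_valL2_sinVec (k, i)]
  exact hf _ (Submodule.subset_span ⟨(k, i), rfl⟩)

/-- The Hilbert basis `√(2/π) sin ((k + 1) x) e_i` of `L²(0, π; ℝ²)`. -/
def basisL2 : HilbertBasis (ℕ × Fin 2) ℝ (L2 ℝ) :=
  HilbertBasis.mkOfOrthogonalEqBot orthonormal_valL2_sinVec span_valL2_sinVec_orthogonal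

theorem basisL2_apply (j : ℕ × Fin 2) : basisL2 j = valL2 (sinVec j) := by
  rw [basisL2, HilbertBasis.coe_mkOfOrthogonalEqBot]

theorem inner_basisL2 (j : ℕ × Fin 2) (f : L2 ℝ) : inner ℝ (basisL2 j) f = coef j.1 f j.2 := by
  rw [basisL2_apply, inner_valL2_sinVec]

/-- The `H¹` norm of `√(2/π) sin ((k + 1) x)`. -/
def h1norm (k : ℕ) : ℝ := √(1 + (k + 1 : ℝ) ^ 2)

theorem h1norm_pos (k : ℕ) : 0 < h1norm k := Real.sqrt_pos.2 (by positivity)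

theorem h1norm_sq (k : ℕ) : h1norm k ^ 2 = 1 + (k + 1 : ℝ) ^ 2 := Real.sq_sqrt (by positivity)

/-- Integration by parts turns the derivative term into `(k+1)²` times the `L²` term, so the sines
are orthogonal in `H¹₀` as well. -/
theorem inner_sinVec (j : ℕ × Fin 2) (u : H10 ℝ) :
    inner ℝ (sinVec j) u = h1norm j.1 ^ 2 * coef j.1 (valL2 u) j.2 := by
  have h := pair_valL2 u (hasDerivAt_dsinC (j.1 + 1))
  rw [pair_ddsinC, neg_inj] at h
  rw [sinVec, inner_H10_smul_left, inner_H10, valL2_sinH10, dxL2_sinH10, inner_smulL2,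
    inner_smulL2, ← h, h1norm_sq, coef, inner_smul_right, EuclideanSpace.inner_single_left]
  push_cast
  simp only [map_one, one_mul, PiLp.smul_apply, smul_eq_mul]
  ring

theorem orthonormal_sinVec : Orthonormal ℝ fun j => (h1norm j.1)⁻¹ • sinVec j := by
  rw [orthonormal_iff_ite]
  intro j l
  have h := orthonormal_iff_ite.1 orthonormal_valL2_sinVec j l
  simp only [inner_valL2_sinVec] at h
  rw [inner_H10_smul_left, inner_H10_smul_right, inner_sinVec, h]
  have := (h1norm_pos j.1).ne'
  by_cases hjl : j = l
  · subst hjl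
    rw [if_pos rfl]
    field_simp
  · simp [hjl]

theorem span_sinVec_orthogonal :
    (Submodule.span ℝ (range fun j => (h1norm j.1)⁻¹ • sinVec j))ᗮ = ⊥ := by
  rw [Submodule.eq_bot_iff]
  intro u hu
  rw [Submodule.mem_orthogonal] at hu
  refine valL2_injective (eq_zero_of_coef fun k => ?_)
  ext i
  have h := hu _ (Submodule.subset_span ⟨(k, i), rfl⟩)
  simp only at h
  rw [inner_H10_smul_left, inner_sinVec] at h
  have := (h1norm_pos k).ne'
  simpa [this] using h

/-- The Hilbert basis of `H¹₀(0, π; ℝ²)` proportional to `sin ((k + 1) x) e_i`. -/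
def basisH10 : HilbertBasis (ℕ × Fin 2) ℝ (H10 ℝ) :=
  HilbertBasis.mkOfOrthogonalEqBot orthonormal_sinVec span_sinVec_orthogonal

theorem basisH10_apply (j : ℕ × Fin 2) : basisH10 j = (h1norm j.1)⁻¹ • sinVec j := by
  rw [basisH10, HilbertBasis.coe_mkOfOrthogonalEqBot]

theorem inner_basisH10 (j : ℕ × Fin 2) (u : H10 ℝ) :
    inner ℝ (basisH10 j) u = h1norm j.1 * coef j.1 (valL2 u) j.2 := by
  rw [basisH10_apply, inner_H10_smul_left, inner_sinVec]
  have := (h1norm_pos j.1).ne'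
  field_simp

/-- The two components of a frequency are coupled, so termwise identities hold only after they are
grouped. -/
theorem hasSum_of_prod_fin_two {f : ℕ × Fin 2 → ℝ} {a : ℝ} (h : HasSum f a) :
    HasSum (fun k => f (k, 0) + f (k, 1)) a := by
  refine h.prod_fiberwise fun k => ?_
  have := hasSum_fintype fun i : Fin 2 => f (k, i)
  rwa [Fin.sum_univ_two] at this

/-! ### The boundary observation -/

/-- The lifting `x ↦ (x - π) / π` of the boundary value. -/
def liftC : C(ℝ, ℝ) := ⟨fun x => (x - Real.pi) / Real.pi, by fun_prop⟩

theorem hasDerivAt_liftC (x : ℝ) :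
    HasDerivAt liftC (ContinuousMap.const ℝ (1 / Real.pi) x) x := by
  simpa [liftC] using ((hasDerivAt_id x).sub_const Real.pi).div_const Real.pi

theorem pair_const (c : ℝ) (f : L2 ℝ) :
    pair (ContinuousMap.const ℝ c) f = c • ∫ x, f x ∂spaceMeasure := by
  rw [pair, ← integral_smul]
  rfl

/-- The trace at `0` of the derivative of a function of `H² ∩ H¹₀`, as an `L²` inner product with
the second derivative. -/
theorem eq_pair_liftC_of_hasTraceZero {u : H10 ℝ} {w : L2 ℝ}
    (hw : HasWeakDeriv 0 Real.pi (dxL2 u) w) {c : Vec ℝ} (hc : HasTraceZero (dxL2 u) c) :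
    c = pair liftC w := by
  obtain ⟨q, hq, hpq, rfl⟩ := hc
  obtain ⟨p, hp, hpp, hparts⟩ := hw.exists_integral_deriv_smul Real.pi_pos (L2.integrable (dxL2 u))
    (L2.integrable w)
  have hqp : q 0 = p 0 := eqOn_Icc_of_ae_eq_Ioo Real.pi_pos hq hp (hpq.symm.trans hpp)
    (left_mem_Icc.2 Real.pi_pos.le)
  have h1 := hparts liftC _ (ContinuousMap.const ℝ (1 / Real.pi)).continuous hasDerivAt_liftC
  -- The mean of `u_x` is zero, because `u` vanishes at both ends. As `liftC` has constant slope,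
  -- its integration by parts then leaves only the boundary value at `0`.
  have h2 := pair_valL2 u (s := ContinuousMap.const ℝ 1) (s' := ContinuousMap.const ℝ 0)
    fun x => hasDerivAt_const x (1 : ℝ)
  rw [pair_const, zero_smul, pair_const, one_smul, eq_comm, neg_eq_zero] at h2
  have h3 : pair (ContinuousMap.const ℝ (1 / Real.pi)) (dxL2 u) = 0 := by
    rw [pair_const, h2, smul_zero]
  change pair (ContinuousMap.const ℝ (1 / Real.pi)) (dxL2 u) = _ at h1
  have e0 : liftC 0 = -1 := by
    simp [liftC, Real.pi_ne_zero]
  have e1 : liftC Real.pi = 0 := by simp [liftC]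
  rw [h3, e0, e1, zero_smul, neg_smul, one_smul, zero_sub, neg_neg] at h1
  rw [hqp]
  exact (sub_eq_zero.1 h1.symm)

theorem integral_sinC_mul_liftC (k : ℕ) :
    ∫ x in Ioo 0 Real.pi, sinC (k + 1) x * liftC x = -(1 / (k + 1 : ℝ)) := by
  have hk : (k + 1 : ℝ) ≠ 0 := by positivity
  have hd : ∀ x : ℝ, HasDerivAt (fun x : ℝ => -(Real.cos ((k + 1 : ℝ) * x) / (k + 1))
      * ((x - Real.pi) / Real.pi) + Real.sin ((k + 1 : ℝ) * x) / ((k + 1) ^ 2 * Real.pi))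
      (Real.sin ((k + 1 : ℝ) * x) * ((x - Real.pi) / Real.pi)) x := by
    intro x
    have h1 := ((hasDerivAt_id x).const_mul (k + 1 : ℝ)).cos
    have h2 := ((hasDerivAt_id x).const_mul (k + 1 : ℝ)).sin
    have h3 := ((hasDerivAt_id x).sub_const Real.pi).div_const Real.pi
    refine (((h1.div_const (k + 1 : ℝ)).neg.mul h3).add
      (h2.div_const ((k + 1 : ℝ) ^ 2 * Real.pi))).congr_deriv ?_
    simp only [id, Pi.neg_apply]
    field_simp
    ring
  have e := intervalIntegral.integral_eq_sub_of_hasDerivAt (a := 0) (b := Real.pi)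
    (fun x _ => hd x) (Continuous.intervalIntegrable (by fun_prop) _ _)
  rw [intervalIntegral.integral_of_le Real.pi_pos.le, integral_Ioc_eq_integral_Ioo] at e
  have hs : Real.sin ((k + 1 : ℝ) * Real.pi) = 0 := by exact_mod_cast Real.sin_nat_mul_pi (k + 1)
  rw [hs] at e
  simp only [sinC, liftC, ContinuousMap.coe_mk]
  push_cast
  rw [e]
  simp

/-- Multiplied by the factor `-(k+1)²` of a second derivative, this yields the boundary forcing
`√(2/π) (k+1)` of the mode equations. -/
theorem coef_smulL2_liftC (k : ℕ) (w : Vec ℝ) :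
    coef k (smulL2 liftC w) = (-(√(2 / Real.pi) / (k + 1 : ℝ))) • w := by
  rw [coef, pair_smulL2, integral_sinC_mul_liftC, smul_smul]
  congr 1
  ring

theorem inner_toEuclideanCLM_transpose (M : Matrix (Fin 2) (Fin 2) ℝ) (v w : Vec ℝ) :
    inner ℝ v (Matrix.toEuclideanCLM (n := Fin 2) (𝕜 := ℝ) M.transpose w) =
      inner ℝ (Matrix.toEuclideanCLM (n := Fin 2) (𝕜 := ℝ) M v) w := by
  simp only [PiLp.inner_apply, Fin.sum_univ_two, Matrix.ofLp_toEuclideanCLM, Matrix.mulVec,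
    dotProduct, Matrix.transpose_apply, RCLike.inner_apply, conj_trivial]
  ring

theorem toEuclideanCLM_apply (M : Matrix (Fin 2) (Fin 2) ℝ) (v : Vec ℝ) (i : Fin 2) :
    Matrix.toEuclideanCLM (n := Fin 2) (𝕜 := ℝ) M v i = M i 0 * v 0 + M i 1 * v 1 := by
  rw [Matrix.ofLp_toEuclideanCLM, Matrix.mulVec, dotProduct, Fin.sum_univ_two]

/-! ### Solutions by transposition from their sine coefficients -/

/-- The functions `c (k, i)` are the sine coefficients of the solution with initial datum `y₀` and
control `v`, with the bounds that make the series converge. -/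
structure IsModeFamily (D A : Matrix (Fin 2) (Fin 2) ℝ) (B : Vec ℝ) (T : ℝ) (y₀ : Hneg1)
    (v : ℝ → ℝ) (c : ℕ × Fin 2 → ℝ → ℝ) : Prop where
  hasDerivAt : ∀ k i t, HasDerivAt (c (k, i))
    (√(2 / Real.pi) * (k + 1) * v t * Matrix.toEuclideanCLM (n := Fin 2) (𝕜 := ℝ) D B i
      - (modeMatrix D A (k + 1) i 0 * c (k, 0) t + modeMatrix D A (k + 1) i 1 * c (k, 1) t)) t
  initial : ∀ j, c j 0 = y₀ (sinVec j)
  bound : ∃ b : ℕ × Fin 2 → ℝ, Summable (fun j => b j ^ 2) ∧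
    ∀ j, ∀ t ∈ Icc 0 T, |c j t| ≤ h1norm j.1 * b j
  summable : Summable fun j => ∫ t in Ioo 0 T, c j t ^ 2

section Transposition

variable {D A : Matrix (Fin 2) (Fin 2) ℝ} {B : Vec ℝ} {T : ℝ} {y₀ : Hneg1} {v : ℝ → ℝ}
  {c : ℕ × Fin 2 → ℝ → ℝ}

theorem IsModeFamily.continuous (h : IsModeFamily D A B T y₀ v c) (j : ℕ × Fin 2) :
    Continuous (c j) :=
  continuous_iff_continuousAt.2 fun t => (h.hasDerivAt j.1 j.2 t).continuousAt

/-- Integration by parts in time, carried out in `L²` and then projected on a basis vector; the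
final condition removes the term at `T`. -/
theorem IsBackwardSolution.integral_deriv_mul {g : ℝ → L2 ℝ} {φ : ℝ → H10 ℝ}
    {φxx φt : ℝ → L2 ℝ} (hT : 0 < T) (hφ : IsBackwardSolution D A T g 0 φ φxx φt) {s s' : ℝ → ℝ}
    (hs' : Continuous s') (hs : ∀ t, HasDerivAt s (s' t) t) (j : ℕ × Fin 2) :
    ∫ t in Ioo 0 T, s' t * coef j.1 (valL2 (φ t)) j.2 =
      -(s 0 * coef j.1 (valL2 (φ 0)) j.2) - ∫ t in Ioo 0 T, s t * coef j.1 (φt t) j.2 := by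
  have hval : ContinuousOn (fun t => valL2 (φ t)) (Icc 0 T) :=
    (((WithLp.fstL 2 ℝ (L2 ℝ) (L2 ℝ)) ∘L (H10 ℝ).subtypeL).continuous).comp_continuousOn
      hφ.continuousOn
  have hi1 : IntegrableOn (fun t => valL2 (φ t)) (Ioo 0 T) :=
    hval.integrableOn_Icc.mono_set Ioo_subset_Icc_self
  have hi2 : IntegrableOn φt (Ioo 0 T) := hφ.memLp_t.integrable (by norm_num)
  have hsc : Continuous s := continuous_iff_continuousAt.2 fun t => (hs t).continuousAt
  have hbdd (f : ℝ → ℝ) (hf : Continuous f) (g : ℝ → L2 ℝ) (hg : IntegrableOn g (Ioo 0 T)) :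
      IntegrableOn (fun x => f x • g x) (Ioo 0 T) := by
    obtain ⟨C, hC⟩ := (isCompact_Icc (a := 0) (b := T)).exists_bound_of_continuousOn
      hf.continuousOn
    refine Integrable.bdd_smul hg C hf.aestronglyMeasurable ?_
    filter_upwards [ae_restrict_mem measurableSet_Ioo] with x hx
    exact hC x (Ioo_subset_Icc_self hx)
  obtain ⟨q, hq, hqe, hparts⟩ := hφ.hasWeakDeriv_t.exists_integral_deriv_smul hT hi1 hi2
  have heq := eqOn_Icc_of_ae_eq_Ioo hT hval hq hqe
  have e := hparts s s' hs' hs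
  have h0 : valL2 (φ T) = 0 := by rw [hφ.final]; rfl
  rw [← heq (left_mem_Icc.2 hT.le), ← heq (right_mem_Icc.2 hT.le)] at e
  simp only [h0, smul_zero, zero_sub] at e
  have e' := congrArg (inner ℝ (basisL2 j)) e
  rw [inner_sub_right, inner_neg_right, real_inner_smul_right,
    ← integral_inner (hbdd s' hs' _ hi1), ← integral_inner (hbdd s hsc _ hi2)] at e'
  simp only [real_inner_smul_right, inner_basisL2] at e'
  exact e'

theorem integrableOn_mul_coef {f : ℝ → ℝ} (hf : Continuous f) {g : ℝ → L2 ℝ}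
    (hg : MemLp g 2 (timeMeasure T)) (k : ℕ) (i : Fin 2) :
    IntegrableOn (fun t => f t * coef k (g t) i) (Ioo 0 T) := by
  obtain ⟨C, hC⟩ := (isCompact_Icc (a := 0) (b := T)).exists_bound_of_continuousOn
    hf.continuousOn
  have : Integrable (fun t => coef k (g t) i) (timeMeasure T) := by
    simp_rw [← inner_basisL2 (k, i)]
    exact (hg.integrable (by norm_num)).const_inner _
  refine Integrable.bdd_mul this hf.aestronglyMeasurable (c := C) ?_
  filter_upwards [ae_restrict_mem measurableSet_Ioo] with x hx
  exact hC x (Ioo_subset_Icc_self hx)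

/-- The transposition identity on one mode. -/
theorem IsModeFamily.integral_mode (hT : 0 < T) (hv : Continuous v)
    (h : IsModeFamily D A B T y₀ v c) {g : ℝ → L2 ℝ} {φ : ℝ → H10 ℝ} {φxx φt : ℝ → L2 ℝ}
    (hφ : IsBackwardSolution D A T g 0 φ φxx φt) (k : ℕ) :
    (∫ t in Ioo 0 T, c (k, 0) t * coef k (g t) 0) + ∫ t in Ioo 0 T, c (k, 1) t * coef k (g t) 1 =
      (c (k, 0) 0 * coef k (valL2 (φ 0)) 0 + c (k, 1) 0 * coef k (valL2 (φ 0)) 1) +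
      ∫ t in Ioo 0 T, √(2 / Real.pi) * (k + 1) * v t *
        inner ℝ (Matrix.toEuclideanCLM (n := Fin 2) (𝕜 := ℝ) D B) (coef k (valL2 (φ t))) := by
  set w := Matrix.toEuclideanCLM (n := Fin 2) (𝕜 := ℝ) D B with hw
  have hval : MemLp (fun t => valL2 (φ t)) 2 (timeMeasure T) := by
    have hc : ContinuousOn (fun t => valL2 (φ t)) (Icc 0 T) :=
      (((WithLp.fstL 2 ℝ (L2 ℝ) (L2 ℝ)) ∘L (H10 ℝ).subtypeL).continuous).comp_continuousOn
        hφ.continuousOn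
    obtain ⟨C, hC⟩ := (isCompact_Icc (a := 0) (b := T)).exists_bound_of_continuousOn hc
    refine MemLp.of_bound ((hc.mono Ioo_subset_Icc_self).aestronglyMeasurable measurableSet_Ioo)
      C ?_
    filter_upwards [ae_restrict_mem measurableSet_Ioo] with x hx
    exact hC x (Ioo_subset_Icc_self hx)
  have hcc := h.continuous
  have hg : MemLp g 2 (timeMeasure T) := by
    refine MemLp.ae_eq hφ.equation ?_
    exact (hφ.memLp_t.neg.sub ((matAct ℝ D.transpose).comp_memLp' hφ.memLp_xx)).add
      ((matAct ℝ A.transpose).comp_memLp' hval)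
  obtain ⟨d, hd⟩ : ∃ d : Fin 2 → ℝ → ℝ, ∀ i t, d i t = √(2 / Real.pi) * (k + 1) * v t * w i
      - (modeMatrix D A (k + 1) i 0 * c (k, 0) t + modeMatrix D A (k + 1) i 1 * c (k, 1) t) :=
    ⟨_, fun _ _ => rfl⟩
  have hcd (i : Fin 2) : Continuous (d i) := by
    have := hcc (k, 0); have := hcc (k, 1)
    rw [funext (hd i)]
    fun_prop
  have hder (i : Fin 2) := hφ.integral_deriv_mul hT (hcd i)
    (fun t => hd i t ▸ h.hasDerivAt k i t) (k, i)
  have ig (i : Fin 2) := integrableOn_mul_coef (hcc (k, i)) hg k i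
  have it (i : Fin 2) := integrableOn_mul_coef (hcc (k, i)) hφ.memLp_t k i
  have id (i : Fin 2) := integrableOn_mul_coef (hcd i) hval k i
  have h0 := hder 0
  have h1 := hder 1
  simp only at h0 h1
  -- Pairing the adjoint equation with `c`: as `d = c'`, the mode matrix acting on `c` cancels its
  -- transpose acting on the coefficients of `φ`, and only the forcing and the time derivatives
  -- remain.
  have key : (∫ t in Ioo 0 T, c (k, 0) t * coef k (g t) 0) +
      (∫ t in Ioo 0 T, c (k, 1) t * coef k (g t) 1) =
      (∫ t in Ioo 0 T, √(2 / Real.pi) * (k + 1) * v t * inner ℝ w (coef k (valL2 (φ t)))) -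
      ((∫ t in Ioo 0 T, c (k, 0) t * coef k (φt t) 0) +
      (∫ t in Ioo 0 T, c (k, 1) t * coef k (φt t) 1)) -
      ((∫ t in Ioo 0 T, d 0 t * coef k (valL2 (φ t)) 0) +
      (∫ t in Ioo 0 T, d 1 t * coef k (valL2 (φ t)) 1)) := by
    have iw : IntegrableOn (fun t => √(2 / Real.pi) * (k + 1) * v t *
        inner ℝ w (coef k (valL2 (φ t)))) (Ioo 0 T) := by
      have e (t : ℝ) : √(2 / Real.pi) * (k + 1) * v t * inner ℝ w (coef k (valL2 (φ t))) =
          (√(2 / Real.pi) * (k + 1) * w 0 * v t) * coef k (valL2 (φ t)) 0 +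
          (√(2 / Real.pi) * (k + 1) * w 1 * v t) * coef k (valL2 (φ t)) 1 := by
        rw [PiLp.inner_apply, Fin.sum_univ_two]
        simp only [RCLike.inner_apply, conj_trivial]
        ring
      simp_rw [e]
      exact (integrableOn_mul_coef (by fun_prop) hval k 0).add
        (integrableOn_mul_coef (by fun_prop) hval k 1)
    have it' : IntegrableOn (fun t => c (k, 0) t * coef k (φt t) 0 +
      c (k, 1) t * coef k (φt t) 1) (Ioo 0 T) := (it 0).add (it 1)
    have id' : IntegrableOn (fun t => d 0 t * coef k (valL2 (φ t)) 0 +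
      d 1 t * coef k (valL2 (φ t)) 1) (Ioo 0 T) := (id 0).add (id 1)
    have iw' : IntegrableOn (fun t => √(2 / Real.pi) * (k + 1) * v t *
        inner ℝ w (coef k (valL2 (φ t))) - (c (k, 0) t * coef k (φt t) 0 +
      c (k, 1) t * coef k (φt t) 1)) (Ioo 0 T) := iw.sub it'
    rw [← integral_add (ig 0) (ig 1), ← integral_add (it 0) (it 1), ← integral_add (id 0) (id 1),
      ← integral_sub iw it', ← integral_sub iw' id']
    refine integral_congr_ae ?_
    filter_upwards [hφ.equation, hφ.hasWeakDeriv_xx] with t ht hxx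
    have hcg : coef k (g t) = -coef k (φt t) +
        ((k + 1 : ℝ) ^ 2 • Matrix.toEuclideanCLM (n := Fin 2) (𝕜 := ℝ) D.transpose
          (coef k (valL2 (φ t))) + Matrix.toEuclideanCLM (n := Fin 2) (𝕜 := ℝ) A.transpose
          (coef k (valL2 (φ t)))) := by
      rw [← ht, coef_add, sub_eq_add_neg, coef_add, coef_neg, coef_neg, coef_matAct, coef_matAct,
        coef_of_hasWeakDeriv_dxL2 hxx, map_neg, neg_neg, map_smul, add_assoc]
    rw [hd, hd, hcg, PiLp.inner_apply, Fin.sum_univ_two]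
    simp only [PiLp.add_apply, PiLp.neg_apply, PiLp.smul_apply, toEuclideanCLM_apply,
      RCLike.inner_apply, conj_trivial, smul_eq_mul, Matrix.transpose_apply, modeMatrix,
      Matrix.add_apply, Matrix.smul_apply, Nat.cast_add, Nat.cast_one]
    ring
  rw [key, h0, h1]
  ring

/-- The series with the coefficients of a mode family is the solution by transposition. -/
theorem IsModeFamily.exists_solution (hT : 0 < T) (hv : Continuous v)
    (h : IsModeFamily D A B T y₀ v c) :
    ∃ (y : ℝ → L2 ℝ) (Y : ℝ → Hneg1), IsTranspositionSolution D A B T y₀ v y ∧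
      IsContinuousRepresentative T y Y ∧ ∃ w : H10 ℝ, Y T = innerSL ℝ w ∧
        ∀ j, inner ℝ (basisH10 j) w = (h1norm j.1)⁻¹ * c j T := by
  have hcc := h.continuous
  obtain ⟨y, hy, hyc⟩ := exists_memLp_of_coordinates (μ := timeMeasure T) basisL2
    (fun j => (hcc j).aestronglyMeasurable)
    (fun j => (((hcc j).pow 2).integrableOn_Icc).mono_set Ioo_subset_Icc_self) h.summable
  obtain ⟨b, hb, hle⟩ := h.bound
  -- `Z` is the Riesz representative of the state. Since `basisH10 j` is `sinVec j` divided by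
  -- `h1norm`, so are its coordinates, and `bound` makes them uniformly square summable.
  obtain ⟨Z, hZ, hZc⟩ := exists_continuousOn_of_coordinates basisH10 (K := Icc 0 T)
    (a := fun j t => (h1norm j.1)⁻¹ * c j t)
    (fun j => (continuous_const.mul (hcc j)).continuousOn) hb fun j t ht => by
      rw [abs_mul, abs_of_pos (inv_pos.2 (h1norm_pos _)), inv_mul_le_iff₀ (h1norm_pos _)]
      exact hle j t ht
  refine ⟨y, fun t => innerSL ℝ (Z t), ⟨hy, ?_⟩, ⟨?_, ?_⟩, Z T, rfl,
    hZc T (right_mem_Icc.2 hT.le)⟩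
  -- All three terms of the transposition identity become series over the frequencies, which agree
  -- term by term by `integral_mode`.
  · intro g φ φxx φt γ hg hφ hγ
    have hsum1 : HasSum (fun k => (∫ t in Ioo 0 T, c (k, 0) t * coef k (g t) 0) +
        ∫ t in Ioo 0 T, c (k, 1) t * coef k (g t) 1) (∫ t in Ioo 0 T, inner ℝ (y t) (g t)) := by
      refine hasSum_of_prod_fin_two (f := fun j => ∫ t in Ioo 0 T, c j t * coef j.1 (g t) j.2)
        ((hasSum_integral_inner_mul_inner basisL2 hy hg).congr_fun fun j => ?_)
      refine integral_congr_ae ?_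
      filter_upwards [hyc] with t ht
      rw [ht, inner_basisL2]
    have hsum2 : HasSum (fun k => c (k, 0) 0 * coef k (valL2 (φ 0)) 0 +
        c (k, 1) 0 * coef k (valL2 (φ 0)) 1) (y₀ (φ 0)) := by
      refine hasSum_of_prod_fin_two (f := fun j => c j 0 * coef j.1 (valL2 (φ 0)) j.2)
        ((y₀.hasSum (basisH10.hasSum_repr (φ 0))).congr_fun fun j => ?_)
      rw [map_smul, basisH10.repr_apply_apply, inner_basisH10, basisH10_apply, map_smul,
        h.initial]
      have := (h1norm_pos j.1).ne'
      simp only [smul_eq_mul]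
      field_simp
    set w := Matrix.toEuclideanCLM (n := Fin 2) (𝕜 := ℝ) D B with hw
    have hlift : MemLp (fun t => v t • smulL2 liftC w) 2 (timeMeasure T) :=
      memLp_continuous_smul_const hv _
    have hsum3 : HasSum (fun k => ∫ t in Ioo 0 T, √(2 / Real.pi) * (k + 1) * v t *
        inner ℝ w (coef k (valL2 (φ t)))) (∫ t in Ioo 0 T,
        inner ℝ B (Matrix.toEuclideanCLM (𝕜 := ℝ) D.transpose (γ t)) * v t) := by
      have hP := hasSum_integral_inner_mul_inner basisL2 hlift hφ.memLp_xx
      -- The boundary term is an `L²` pairing of the lifting with `φ_xx`, so Parseval applies to it.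
      have e1 : ∫ t in Ioo 0 T, inner ℝ (v t • smulL2 liftC w) (φxx t) =
          ∫ t in Ioo 0 T, inner ℝ B (Matrix.toEuclideanCLM (𝕜 := ℝ) D.transpose (γ t)) * v t := by
        refine integral_congr_ae ?_
        filter_upwards [hφ.hasWeakDeriv_xx, hγ] with t hxx ht
        rw [real_inner_smul_left, inner_smulL2, ← eq_pair_liftC_of_hasTraceZero hxx ht,
          inner_toEuclideanCLM_transpose, mul_comm]
      rw [e1] at hP
      refine (hasSum_of_prod_fin_two hP).congr_fun fun k => ?_
      have hi (i : Fin 2) : Integrable (fun t => inner ℝ (basisL2 (k, i))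
          (v t • smulL2 liftC w) * inner ℝ (basisL2 (k, i)) (φxx t)) (timeMeasure T) :=
        (hlift.const_inner _).integrable_mul (hφ.memLp_xx.const_inner _)
      rw [← integral_add (hi 0) (hi 1)]
      refine integral_congr_ae ?_
      filter_upwards [hφ.hasWeakDeriv_xx] with t hxx
      have hk : (k + 1 : ℝ) ≠ 0 := by positivity
      simp only [inner_basisL2, coef_smul, coef_smulL2_liftC, coef_of_hasWeakDeriv_dxL2 hxx,
        PiLp.smul_apply, PiLp.neg_apply, smul_eq_mul, PiLp.inner_apply, Fin.sum_univ_two,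
        RCLike.inner_apply, conj_trivial]
      field_simp
    refine hsum1.unique (((hsum2.add hsum3)).congr_fun fun k => ?_)
    exact h.integral_mode hT hv hφ k
  · exact (innerSL ℝ).continuous.comp_continuousOn hZ
  · filter_upwards [hyc, ae_restrict_mem measurableSet_Ioo] with t ht htm
    refine ContinuousLinearMap.ext fun φ => ?_
    rw [innerSL_apply_apply, toHneg1_apply]
    -- The factors `h1norm` cancel: the expansions in `H¹₀` and in `L²` have the same terms.
    refine ((basisH10.hasSum_inner_mul_inner (Z t) φ).congr_fun fun j => ?_).unique
      (basisL2.hasSum_inner_mul_inner (y t) (valL2 φ)) |>.symm ▸ rfl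
    rw [real_inner_comm (basisH10 j), hZc t (Ioo_subset_Icc_self htm), inner_basisH10,
      real_inner_comm (basisL2 j), ht, inner_basisL2]
    have := (h1norm_pos j.1).ne'
    field_simp

end Transposition

/-! ### The eigenvalues of the modes -/

/-- Half the gap between the two eigenvalues of frequency `k + 1`. -/
def halfGap (ξ ρ τ : ℝ) (k : ℕ) : ℝ :=
  √((ρ + 1) ^ 2 / (4 * τ ^ 2) + ρ * ξ * (k + 1 : ℝ) ^ 2 / τ)

/-- The eigenvalues of the modes: `(k, 0)` and `(k, 1)` are the smaller and the larger eigenvalue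
of frequency `k + 1`. -/
def eig (ξ ρ τ : ℝ) (j : ℕ × Fin 2) : ℝ :=
  ξ * (j.1 + 1 : ℝ) ^ 2 + (ρ + 1) / (2 * τ) +
    if j.2 = 0 then -halfGap ξ ρ τ j.1 else halfGap ξ ρ τ j.1

/-- The constant in the quadratic lower bound of the eigenvalues. -/
def eigBound (ξ ρ : ℝ) : ℝ := ξ / (2 * (ρ + 1))

section Eigenvalues

variable {ξ ρ τ : ℝ}

theorem eig_fst (k : ℕ) : eig ξ ρ τ (k, 0) =
    ξ * (k + 1 : ℝ) ^ 2 + (ρ + 1) / (2 * τ) - halfGap ξ ρ τ k := by simp [eig, sub_eq_add_neg]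

theorem eig_snd (k : ℕ) : eig ξ ρ τ (k, 1) =
    ξ * (k + 1 : ℝ) ^ 2 + (ρ + 1) / (2 * τ) + halfGap ξ ρ τ k := by simp [eig]

theorem halfGap_sq (hξ : 0 < ξ) (hρ : 0 < ρ) (hτ : 0 < τ) (k : ℕ) : halfGap ξ ρ τ k ^ 2 =
    (ρ + 1) ^ 2 / (4 * τ ^ 2) + ρ * ξ * (k + 1 : ℝ) ^ 2 / τ := Real.sq_sqrt (by positivity)

theorem le_halfGap (hξ : 0 < ξ) (hρ : 0 < ρ) (hτ : 0 < τ) (k : ℕ) :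
    (ρ + 1) / (2 * τ) ≤ halfGap ξ ρ τ k := by
  refine Real.le_sqrt_of_sq_le ?_
  have : 0 ≤ ρ * ξ * (k + 1 : ℝ) ^ 2 / τ := by positivity
  rw [div_pow, mul_pow]
  norm_num
  exact this

theorem halfGap_pos (hξ : 0 < ξ) (hρ : 0 < ρ) (hτ : 0 < τ) (k : ℕ) : 0 < halfGap ξ ρ τ k :=
  lt_of_lt_of_le (by positivity) (le_halfGap hξ hρ hτ k)

theorem abs_le_halfGap (hξ : 0 < ξ) (hρ : 0 < ρ) (hτ : 0 < τ) (k : ℕ) :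
    |(1 - ρ) / (2 * τ)| ≤ halfGap ξ ρ τ k := by
  refine le_trans ?_ (le_halfGap hξ hρ hτ k)
  rw [abs_div, abs_of_pos (show 0 < 2 * τ by positivity)]
  refine div_le_div_of_nonneg_right (abs_le.2 ⟨by linarith, by linarith⟩) (by positivity)

theorem eigBound_pos (hξ : 0 < ξ) (hρ : 0 < ρ) : 0 < eigBound ξ ρ := by
  rw [eigBound]; positivity

/-- With `n = k + 1`, the product of the two eigenvalues is the determinant `ξn²(ξn² + 1/τ)`, while
the larger one is at most the trace, hence at most `2(ρ+1)(ξn² + 1/τ)`. Dividing bounds the smaller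
one from below. -/
theorem le_eig_fst (hξ : 0 < ξ) (hρ : 0 < ρ) (hτ : 0 < τ) (k : ℕ) :
    eigBound ξ ρ * (k + 1 : ℝ) ^ 2 ≤ eig ξ ρ τ (k, 0) := by
  have hq := halfGap_sq hξ hρ hτ k
  have hq0 := halfGap_pos hξ hρ hτ k
  have hprod : eig ξ ρ τ (k, 0) * eig ξ ρ τ (k, 1) =
      ξ * (k + 1 : ℝ) ^ 2 * (ξ * (k + 1 : ℝ) ^ 2 + 1 / τ) := by
    rw [eig_fst, eig_snd]
    have : (ξ * (k + 1 : ℝ) ^ 2 + (ρ + 1) / (2 * τ) - halfGap ξ ρ τ k) *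
      (ξ * (k + 1 : ℝ) ^ 2 + (ρ + 1) / (2 * τ) + halfGap ξ ρ τ k) =
      (ξ * (k + 1 : ℝ) ^ 2 + (ρ + 1) / (2 * τ)) ^ 2 - halfGap ξ ρ τ k ^ 2 := by ring
    rw [this, hq]
    field_simp
    ring
  have hpos1 : 0 < eig ξ ρ τ (k, 1) := by
    rw [eig_snd]; positivity
  have hpos0 : 0 < eig ξ ρ τ (k, 0) := by
    have : 0 < eig ξ ρ τ (k, 0) * eig ξ ρ τ (k, 1) := by
      rw [hprod]; positivity
    exact pos_of_mul_pos_left this hpos1.le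
  have hle : eig ξ ρ τ (k, 1) ≤ 2 * (ρ + 1) * (ξ * (k + 1 : ℝ) ^ 2 + 1 / τ) := by
    have h1 : eig ξ ρ τ (k, 1) ≤ 2 * (ξ * (k + 1 : ℝ) ^ 2 + (ρ + 1) / (2 * τ)) := by
      have := eig_fst (ξ := ξ) (ρ := ρ) (τ := τ) k
      have := eig_snd (ξ := ξ) (ρ := ρ) (τ := τ) k
      linarith
    refine h1.trans (le_of_sub_nonneg ?_)
    have : 2 * (ρ + 1) * (ξ * (k + 1 : ℝ) ^ 2 + 1 / τ) -
        2 * (ξ * (k + 1 : ℝ) ^ 2 + (ρ + 1) / (2 * τ)) =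
        2 * ρ * ξ * (k + 1 : ℝ) ^ 2 + (ρ + 1) / τ := by
      field_simp
      ring
    rw [this]
    positivity
  refine le_of_mul_le_mul_right ?_ hpos1
  rw [hprod, eigBound]
  calc ξ / (2 * (ρ + 1)) * (k + 1 : ℝ) ^ 2 * eig ξ ρ τ (k, 1)
      ≤ ξ / (2 * (ρ + 1)) * (k + 1 : ℝ) ^ 2 *
        (2 * (ρ + 1) * (ξ * (k + 1 : ℝ) ^ 2 + 1 / τ)) := by gcongr
    _ = _ := by field_simp

theorem eig_fst_le (hξ : 0 < ξ) (hρ : 0 < ρ) (hτ : 0 < τ) (j : ℕ × Fin 2) :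
    eig ξ ρ τ (j.1, 0) ≤ eig ξ ρ τ j := by
  have := halfGap_pos hξ hρ hτ j.1
  rw [eig_fst, eig]
  split_ifs <;> linarith

theorem le_eig (hξ : 0 < ξ) (hρ : 0 < ρ) (hτ : 0 < τ) (j : ℕ × Fin 2) :
    eigBound ξ ρ * (j.1 + 1 : ℝ) ^ 2 ≤ eig ξ ρ τ j :=
  (le_eig_fst hξ hρ hτ j.1).trans (eig_fst_le hξ hρ hτ j)

theorem eig_pos (hξ : 0 < ξ) (hρ : 0 < ρ) (hτ : 0 < τ) (j : ℕ × Fin 2) : 0 < eig ξ ρ τ j := by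
  have := eigBound_pos hξ hρ
  exact lt_of_lt_of_le (by positivity) (le_eig hξ hρ hτ j)

theorem modeChar_eig (hξ : 0 < ξ) (hρ : 0 < ρ) (hτ : 0 < τ) (j : ℕ × Fin 2) :
    modeChar (matD ξ ρ) (matA ρ τ) (j.1 + 1) (eig ξ ρ τ j : ℝ) = 0 := by
  have hq := halfGap_sq hξ hρ hτ j.1
  have : (ξ * (j.1 + 1 : ℝ) ^ 2 + ρ / τ - eig ξ ρ τ j) *
      (ξ * (j.1 + 1 : ℝ) ^ 2 + 1 / τ - eig ξ ρ τ j) -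
      -(ρ / 2) * (ξ * (j.1 + 1 : ℝ) ^ 2 + 1 / τ) * (-(2 / τ)) = 0 := by
    have e : (eig ξ ρ τ j - (ξ * (j.1 + 1 : ℝ) ^ 2 + (ρ + 1) / (2 * τ))) ^ 2 =
        (ρ + 1) ^ 2 / (4 * τ ^ 2) + ρ * ξ * (j.1 + 1 : ℝ) ^ 2 / τ := by
      rw [← hq, eig]
      split_ifs <;> ring
    linear_combination e
  rw [modeChar, modeMatrix_eq]
  simp only [Matrix.of_apply, Matrix.cons_val_zero, Matrix.cons_val_one]
  have := congrArg (fun x : ℝ => (x : ℂ)) this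
  push_cast at this ⊢
  exact this

/-- Nonresonance separates different frequencies; within one frequency the gap is positive. -/
theorem eig_injective (hξ : 0 < ξ) (hρ : 0 < ρ) (hτ : 0 < τ) (h : Nonresonance ξ ρ τ) :
    Function.Injective (eig ξ ρ τ) := by
  rw [nonresonance_iff hξ hτ] at h
  intro j l hjl
  have h1 := modeChar_eig hξ hρ hτ j
  have h2 := modeChar_eig hξ hρ hτ l
  rw [hjl] at h1
  rcases lt_trichotomy j.1 l.1 with hlt | heq | hlt
  · exact absurd ⟨h1, h2⟩ (h _ _ (by omega) (by omega) _)
  · have hq := halfGap_pos hξ hρ hτ l.1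
    obtain ⟨k, i⟩ := j
    obtain ⟨k', i'⟩ := l
    simp only at heq hq
    subst heq
    fin_cases i <;> fin_cases i' <;> simp [eig] at hjl ⊢ <;> linarith
  · exact absurd ⟨h2, h1⟩ (h _ _ (by omega) (by omega) _)

theorem finite_eig_le (hξ : 0 < ξ) (hρ : 0 < ρ) (hτ : 0 < τ) (R : ℝ) :
    {j | eig ξ ρ τ j ≤ R}.Finite := by
  have hc := eigBound_pos hξ hρ
  obtain ⟨N, hN⟩ := exists_nat_ge (R / eigBound ξ ρ)
  refine ((Set.finite_Iic N).prod (Set.finite_univ (α := Fin 2))).subset fun j hj => ⟨?_, trivial⟩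
  have h1 := (le_eig hξ hρ hτ j).trans hj
  rw [div_le_iff₀ hc] at hN
  have h2 : (j.1 + 1 : ℝ) ^ 2 ≤ N := by
    refine le_of_mul_le_mul_left ?_ hc
    linarith
  have h3 : (j.1 : ℝ) ≤ N := by
    have : (0 : ℝ) ≤ j.1 := Nat.cast_nonneg _
    nlinarith
  exact_mod_cast h3

end Eigenvalues

/-! ### Explicit solutions of the mode equations -/

/-- The components of `C p - S (M - c) p`, where `M` is the matrix of frequency `k + 1`, `c` is half
its trace and `p = (p₀, p₁)`. -/
def comb (ξ ρ τ : ℝ) (k : ℕ) (p₀ p₁ C S : ℝ) (i : Fin 2) : ℝ :=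
  if i = 0 then
    (C + (1 - ρ) / (2 * τ) * S) * p₀ + ρ / 2 * (ξ * (k + 1 : ℝ) ^ 2 + 1 / τ) * S * p₁
  else 2 / τ * S * p₀ + (C - (1 - ρ) / (2 * τ) * S) * p₁

section Modes

variable {ξ ρ τ : ℝ}

/-- Cayley–Hamilton: with `c` half the trace of `M`, `(M - c)² = r`. Thus `C p - S (M - c) p` solves
`y' = f p - M y` as soon as `C' = f - c C + r S` and `S' = C - c S`. -/
theorem hasDerivAt_comb (hτ : 0 < τ) {k : ℕ} {p₀ p₁ r : ℝ} {C S : ℝ → ℝ} {f t : ℝ}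
    (hr : r = (ρ + 1) ^ 2 / (4 * τ ^ 2) + ρ * ξ * (k + 1 : ℝ) ^ 2 / τ)
    (hC : HasDerivAt C (f - (ξ * (k + 1 : ℝ) ^ 2 + (ρ + 1) / (2 * τ)) * C t + r * S t) t)
    (hS : HasDerivAt S (C t - (ξ * (k + 1 : ℝ) ^ 2 + (ρ + 1) / (2 * τ)) * S t) t) (i : Fin 2) :
    HasDerivAt (fun t => comb ξ ρ τ k p₀ p₁ (C t) (S t) i)
      (f * (if i = 0 then p₀ else p₁) -
        (modeMatrix (matD ξ ρ) (matA ρ τ) (k + 1) i 0 * comb ξ ρ τ k p₀ p₁ (C t) (S t) 0 +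
        modeMatrix (matD ξ ρ) (matA ρ τ) (k + 1) i 1 * comb ξ ρ τ k p₀ p₁ (C t) (S t) 1)) t := by
  rw [modeMatrix_eq]
  fin_cases i
  · have := ((hC.add (hS.const_mul ((1 - ρ) / (2 * τ)))).mul_const p₀).add
      ((hS.const_mul (ρ / 2 * (ξ * (k + 1 : ℝ) ^ 2 + 1 / τ))).mul_const p₁)
    refine this.congr_deriv ?_
    simp [comb]
    subst hr
    field_simp
    ring
  · have := ((hS.const_mul (2 / τ)).mul_const p₀).add
      ((hC.sub (hS.const_mul ((1 - ρ) / (2 * τ)))).mul_const p₁)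
    refine this.congr_deriv ?_
    simp [comb]
    subst hr
    field_simp
    ring

/-- The half sum and the divided difference of the scalar solutions for the two eigenvalues satisfy
the system for `C` and `S`. -/
theorem hasDerivAt_comb_exp (hξ : 0 < ξ) (hρ : 0 < ρ) (hτ : 0 < τ) {k : ℕ} {p₀ p₁ : ℝ}
    {e₀ e₁ : ℝ → ℝ} {f t : ℝ} (h₀ : HasDerivAt e₀ (f - eig ξ ρ τ (k, 0) * e₀ t) t)
    (h₁ : HasDerivAt e₁ (f - eig ξ ρ τ (k, 1) * e₁ t) t) (i : Fin 2) :
    HasDerivAt (fun t => comb ξ ρ τ k p₀ p₁ ((e₀ t + e₁ t) / 2)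
        ((e₀ t - e₁ t) / (2 * halfGap ξ ρ τ k)) i)
      (f * (if i = 0 then p₀ else p₁) -
        (modeMatrix (matD ξ ρ) (matA ρ τ) (k + 1) i 0 * comb ξ ρ τ k p₀ p₁ ((e₀ t + e₁ t) / 2)
          ((e₀ t - e₁ t) / (2 * halfGap ξ ρ τ k)) 0 +
        modeMatrix (matD ξ ρ) (matA ρ τ) (k + 1) i 1 * comb ξ ρ τ k p₀ p₁ ((e₀ t + e₁ t) / 2)
          ((e₀ t - e₁ t) / (2 * halfGap ξ ρ τ k)) 1)) t := by
  have hq := (halfGap_pos hξ hρ hτ k).ne'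
  refine hasDerivAt_comb hτ (halfGap_sq hξ hρ hτ k) (C := fun t => (e₀ t + e₁ t) / 2)
    (S := fun t => (e₀ t - e₁ t) / (2 * halfGap ξ ρ τ k)) ?_ ?_ i
  · refine ((h₀.add h₁).div_const 2).congr_deriv ?_
    rw [eig_fst, eig_snd]
    field_simp
    ring
  · refine ((h₀.sub h₁).div_const (2 * halfGap ξ ρ τ k)).congr_deriv ?_
    rw [eig_fst, eig_snd]
    field_simp
    ring

/-- The sine coefficients of the solution without control and with initial coefficients `p`. -/
def homMode (ξ ρ τ : ℝ) (p : ℕ × Fin 2 → ℝ) (j : ℕ × Fin 2) (t : ℝ) : ℝ :=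
  comb ξ ρ τ j.1 (p (j.1, 0)) (p (j.1, 1))
    ((Real.exp (-(eig ξ ρ τ (j.1, 0) * t)) + Real.exp (-(eig ξ ρ τ (j.1, 1) * t))) / 2)
    ((Real.exp (-(eig ξ ρ τ (j.1, 0) * t)) - Real.exp (-(eig ξ ρ τ (j.1, 1) * t))) /
      (2 * halfGap ξ ρ τ j.1)) j.2

/-- The solution of `e' = v - λ e`, `e(0) = 0`. -/
def duhamel (lam : ℝ) (v : ℝ → ℝ) (t : ℝ) : ℝ :=
  Real.exp (-(lam * t)) * ∫ r in 0..t, Real.exp (lam * r) * v r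

/-- The sine coefficients of the solution with control `v` and zero initial datum. -/
def ctrlMode (ξ ρ τ : ℝ) (v : ℝ → ℝ) (j : ℕ × Fin 2) (t : ℝ) : ℝ :=
  comb ξ ρ τ j.1 (√(2 / Real.pi) * (j.1 + 1) * ξ) 0
    ((duhamel (eig ξ ρ τ (j.1, 0)) v t + duhamel (eig ξ ρ τ (j.1, 1)) v t) / 2)
    ((duhamel (eig ξ ρ τ (j.1, 0)) v t - duhamel (eig ξ ρ τ (j.1, 1)) v t) /
      (2 * halfGap ξ ρ τ j.1)) j.2

theorem hasDerivAt_exp_neg_mul (lam t : ℝ) : HasDerivAt (fun t => Real.exp (-(lam * t)))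
    (0 - lam * Real.exp (-(lam * t))) t := by
  refine (((hasDerivAt_id t).const_mul lam).neg.exp).congr_deriv ?_
  simp only [id, Pi.neg_apply]
  ring

theorem hasDerivAt_duhamel (lam : ℝ) {v : ℝ → ℝ} (hv : Continuous v) (t : ℝ) :
    HasDerivAt (duhamel lam v) (v t - lam * duhamel lam v t) t := by
  have hc : Continuous fun r => Real.exp (lam * r) * v r := by fun_prop
  have h1 := intervalIntegral.integral_hasDerivAt_right (hc.intervalIntegrable 0 t)
    hc.stronglyMeasurable.stronglyMeasurableAtFilter hc.continuousAt
  refine ((hasDerivAt_exp_neg_mul lam t).mul h1).congr_deriv ?_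
  have : Real.exp (-(lam * t)) * (Real.exp (lam * t) * v t) = v t := by
    rw [← mul_assoc, ← Real.exp_add, neg_add_cancel, Real.exp_zero, one_mul]
  rw [this, duhamel]
  ring

/-- The kernel `exp (-λ(t - r))` has mass at most `1/λ`. -/
theorem abs_duhamel_le {lam V T : ℝ} (hlam : 0 < lam) {v : ℝ → ℝ}
    (hV : ∀ t ∈ Icc 0 T, |v t| ≤ V) {t : ℝ} (ht : t ∈ Icc 0 T) : |duhamel lam v t| ≤ V / lam := by
  have hV0 : 0 ≤ V := (abs_nonneg _).trans (hV t ht)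
  have hint : ∫ r in 0..t, Real.exp (lam * r) * V = (Real.exp (lam * t) - 1) / lam * V := by
    have hd (x : ℝ) : HasDerivAt (fun r => Real.exp (lam * r) / lam * V)
        (Real.exp (lam * x) * V) x := by
      refine ((((hasDerivAt_id x).const_mul lam).exp.div_const lam).mul_const V).congr_deriv ?_
      simp only [id]
      field_simp
    rw [intervalIntegral.integral_eq_sub_of_hasDerivAt (fun x _ => hd x)
      (Continuous.intervalIntegrable (by fun_prop) _ _)]
    rw [mul_zero, Real.exp_zero]
    ring
  have h1 : |∫ r in 0..t, Real.exp (lam * r) * v r| ≤ (Real.exp (lam * t) - 1) / lam * V := by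
    rw [← hint, ← Real.norm_eq_abs]
    refine intervalIntegral.norm_integral_le_of_norm_le ht.1 ?_
      (Continuous.intervalIntegrable (by fun_prop) _ _)
    refine Filter.Eventually.of_forall fun r hr => ?_
    rw [norm_mul, Real.norm_of_nonneg (Real.exp_pos _).le, Real.norm_eq_abs]
    exact mul_le_mul_of_nonneg_left (hV r ⟨hr.1.le, hr.2.trans ht.2⟩) (Real.exp_pos _).le
  rw [duhamel, abs_mul, abs_of_pos (Real.exp_pos _)]
  calc Real.exp (-(lam * t)) * |∫ r in 0..t, Real.exp (lam * r) * v r|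
      ≤ Real.exp (-(lam * t)) * ((Real.exp (lam * t) - 1) / lam * V) := by gcongr
    _ = (1 - Real.exp (-(lam * t))) * (V / lam) := by
        have : Real.exp (-(lam * t)) * Real.exp (lam * t) = 1 := by
          rw [← Real.exp_add, neg_add_cancel, Real.exp_zero]
        linear_combination (V / lam) * this
    _ ≤ V / lam := by
        refine mul_le_of_le_one_left (by positivity) ?_
        linarith [Real.exp_pos (-(lam * t))]

theorem summable_of_fin_two {f : ℕ × Fin 2 → ℝ} (h0 : ∀ j, 0 ≤ f j)
    (h : ∀ i, Summable fun k => f (k, i)) : Summable f := by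
  refine (summable_prod_of_nonneg h0).2 ⟨fun k => (hasSum_fintype _).summable, ?_⟩
  simp_rw [tsum_fintype, Fin.sum_univ_two]
  exact (h 0).add (h 1)

/-- Both coefficients of a mode bounded in terms of one square summable family. -/
theorem summable_sq_add {β : ℕ × Fin 2 → ℝ} (hβ : Summable fun j => β j ^ 2) :
    Summable fun j : ℕ × Fin 2 => (|β (j.1, 0)| + |β (j.1, 1)|) ^ 2 := by
  have hi (i : Fin 2) : Summable fun k : ℕ => β (k, i) ^ 2 :=
    hβ.comp_injective (i := fun k : ℕ => (k, i)) fun a b h => (Prod.ext_iff.1 h).1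
  refine summable_of_fin_two (fun j => sq_nonneg _) fun i => ?_
  refine Summable.of_nonneg_of_le (fun k => sq_nonneg _) (fun k => ?_)
    (((hi 0).mul_left 2).add ((hi 1).mul_left 2))
  simp only
  nlinarith [sq_nonneg (|β (k, 0)| - |β (k, 1)|), sq_abs (β (k, 0)), sq_abs (β (k, 1))]

/-- The factor `1 / halfGap` in the bound of `S` absorbs the entries that do not grow with the
frequency. The entry growing like `(k+1)²` only meets `p₁` and has its own bound `y`. -/
theorem abs_comb_le (hξ : 0 < ξ) (hρ : 0 < ρ) (hτ : 0 < τ) {k : ℕ} {p₀ p₁ C S x y : ℝ}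
    (hC : |C| ≤ x) (hS : |S| ≤ x / halfGap ξ ρ τ k)
    (hS' : ρ / 2 * (ξ * (k + 1 : ℝ) ^ 2 + 1 / τ) * |S| ≤ y) (i : Fin 2) :
    |comb ξ ρ τ k p₀ p₁ C S i| ≤ 4 * x * |p₀| + (2 * x + y) * |p₁| := by
  have hq := halfGap_pos hξ hρ hτ k
  have hx : 0 ≤ x := (abs_nonneg _).trans hC
  have hy : 0 ≤ y := le_trans (by positivity) hS'
  have h1 : |(1 - ρ) / (2 * τ) * S| ≤ x := by
    rw [abs_mul]
    calc |(1 - ρ) / (2 * τ)| * |S| ≤ halfGap ξ ρ τ k * (x / halfGap ξ ρ τ k) :=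
          mul_le_mul (abs_le_halfGap hξ hρ hτ k) hS (abs_nonneg _) hq.le
      _ = x := by field_simp
  have h2 : |2 / τ * S| ≤ 4 * x := by
    rw [abs_mul, abs_of_pos (show 0 < 2 / τ by positivity)]
    have h3 : 2 / τ ≤ 4 * halfGap ξ ρ τ k := by
      have := le_halfGap hξ hρ hτ k
      have h4 : 1 / (2 * τ) ≤ (ρ + 1) / (2 * τ) :=
        div_le_div_of_nonneg_right (by linarith) (by positivity)
      have h5 : 2 / τ = 4 * (1 / (2 * τ)) := by field_simp; norm_num
      rw [h5]
      linarith
    calc 2 / τ * |S| ≤ 4 * halfGap ξ ρ τ k * (x / halfGap ξ ρ τ k) :=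
          mul_le_mul h3 hS (abs_nonneg _) (by positivity)
      _ = 4 * x := by field_simp
  have h3 : |ρ / 2 * (ξ * (k + 1 : ℝ) ^ 2 + 1 / τ) * S| ≤ y := by
    rwa [abs_mul, abs_of_pos (show 0 < ρ / 2 * (ξ * (k + 1 : ℝ) ^ 2 + 1 / τ) by positivity)]
  have hp0 := abs_nonneg p₀
  have hp1 := abs_nonneg p₁
  rw [comb]
  split_ifs
  · refine (abs_add_le _ _).trans (add_le_add ?_ ?_)
    · rw [abs_mul]
      refine mul_le_mul_of_nonneg_right ?_ hp0
      linarith [abs_add_le C ((1 - ρ) / (2 * τ) * S)]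
    · rw [abs_mul]
      refine mul_le_mul_of_nonneg_right ?_ hp1
      linarith
  · refine (abs_add_le _ _).trans (add_le_add ?_ ?_)
    · rw [abs_mul]
      exact mul_le_mul_of_nonneg_right h2 hp0
    · rw [abs_mul]
      refine mul_le_mul_of_nonneg_right ?_ hp1
      linarith [abs_sub C ((1 - ρ) / (2 * τ) * S)]

theorem toEuclideanCLM_matD_vecB (i : Fin 2) :
    Matrix.toEuclideanCLM (n := Fin 2) (𝕜 := ℝ) (matD ξ ρ) vecB i = if i = 0 then ξ else 0 := by
  rw [toEuclideanCLM_apply]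
  fin_cases i <;> simp [matD, vecB]

/-- The forcing grows like `k+1` and Duhamel's formula gains the inverse of an eigenvalue, of order
`(k+1)⁻²`. The growing matrix entry plays no role, because the forcing has no second component. -/
theorem ctrlMode_bound (hξ : 0 < ξ) (hρ : 0 < ρ) (hτ : 0 < τ) {T : ℝ} {v : ℝ → ℝ}
    (hv : Continuous v) : ∃ K : ℝ, ∀ j, ∀ t ∈ Icc 0 T, |ctrlMode ξ ρ τ v j t| ≤ K / (j.1 + 1) := by
  obtain ⟨V, hV⟩ := (isCompact_Icc (a := 0) (b := T)).exists_bound_of_continuousOn hv.continuousOn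
  simp only [Real.norm_eq_abs] at hV
  have hc := eigBound_pos hξ hρ
  refine ⟨4 * (V / eigBound ξ ρ) * (√(2 / Real.pi) * ξ), fun j t ht => ?_⟩
  have hV0 : 0 ≤ V := (abs_nonneg _).trans (hV t ht)
  have hk : (0 : ℝ) < j.1 + 1 := by positivity
  have hq := halfGap_pos hξ hρ hτ j.1
  set x := V / (eigBound ξ ρ * (j.1 + 1 : ℝ) ^ 2) with hx
  have hd (i : Fin 2) : |duhamel (eig ξ ρ τ (j.1, i)) v t| ≤ x :=
    (abs_duhamel_le (eig_pos hξ hρ hτ _) hV ht).trans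
      (div_le_div_of_nonneg_left hV0 (by positivity) (le_eig hξ hρ hτ (j.1, i)))
  have h0 := abs_le.1 (hd 0)
  have h1 := abs_le.1 (hd 1)
  have hb := abs_comb_le hξ hρ hτ (k := j.1) (p₀ := √(2 / Real.pi) * (j.1 + 1) * ξ) (p₁ := 0)
    (C := (duhamel (eig ξ ρ τ (j.1, 0)) v t + duhamel (eig ξ ρ τ (j.1, 1)) v t) / 2)
    (S := (duhamel (eig ξ ρ τ (j.1, 0)) v t - duhamel (eig ξ ρ τ (j.1, 1)) v t) /
      (2 * halfGap ξ ρ τ j.1)) (x := x)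
    (abs_le.2 ⟨by linarith, by linarith⟩) (by
      rw [abs_div, abs_of_pos (show 0 < 2 * halfGap ξ ρ τ j.1 by positivity),
        div_le_div_iff₀ (by positivity) hq]
      have : |duhamel (eig ξ ρ τ (j.1, 0)) v t - duhamel (eig ξ ρ τ (j.1, 1)) v t| ≤ 2 * x :=
        abs_le.2 ⟨by linarith, by linarith⟩
      nlinarith) le_rfl j.2
  rw [abs_zero, mul_zero, add_zero] at hb
  refine hb.trans (le_of_eq ?_)
  rw [abs_of_nonneg (by positivity), hx]
  field_simp

theorem summable_ctrl (K : ℝ) : Summable fun j : ℕ × Fin 2 => (K / (j.1 + 1 : ℝ)) ^ 2 := by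
  refine summable_of_fin_two (fun j => sq_nonneg _) fun i => ?_
  have h1 : Summable fun n : ℕ => 1 / ((n : ℝ) + 1) ^ 2 := by
    have := (summable_nat_add_iff 1).2 (Real.summable_one_div_nat_pow.2 one_lt_two)
    simpa using this
  refine (h1.mul_left (K ^ 2)).congr fun k => ?_
  rw [div_pow]
  ring

theorem isModeFamily_ctrlMode (hξ : 0 < ξ) (hρ : 0 < ρ) (hτ : 0 < τ) {T : ℝ} (hT : 0 < T)
    {v : ℝ → ℝ} (hv : Continuous v) :
    IsModeFamily (matD ξ ρ) (matA ρ τ) vecB T 0 v (ctrlMode ξ ρ τ v) := by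
  have hder (k : ℕ) (i : Fin 2) (t : ℝ) := hasDerivAt_comb_exp hξ hρ hτ
    (p₀ := √(2 / Real.pi) * (k + 1) * ξ) (p₁ := 0)
    (hasDerivAt_duhamel (eig ξ ρ τ (k, 0)) hv t) (hasDerivAt_duhamel (eig ξ ρ τ (k, 1)) hv t) i
  have hcont (j : ℕ × Fin 2) : Continuous (ctrlMode ξ ρ τ v j) :=
    continuous_iff_continuousAt.2 fun t => (hder j.1 j.2 t).continuousAt
  obtain ⟨K, hK⟩ := ctrlMode_bound hξ hρ hτ (T := T) hv
  refine ⟨fun k i t => ?_, fun j => ?_, ⟨fun j => K / (j.1 + 1 : ℝ), summable_ctrl K, ?_⟩, ?_⟩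
  · refine (hder k i t).congr_deriv ?_
    rw [toEuclideanCLM_matD_vecB]
    congr 1
    split_ifs <;> ring
  · simp [ctrlMode, duhamel, comb]
  · intro j t ht
    have h1 := hK j t ht
    have h2 : 1 ≤ h1norm j.1 := by
      rw [h1norm]
      refine Real.one_le_sqrt.2 ?_
      have : 0 ≤ (j.1 + 1 : ℝ) ^ 2 := sq_nonneg _
      linarith
    have h3 : 0 ≤ K / (j.1 + 1 : ℝ) := (abs_nonneg _).trans h1
    nlinarith
  · refine Summable.of_nonneg_of_le (fun j => integral_nonneg fun t => sq_nonneg _) (fun j => ?_)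
      ((summable_ctrl K).mul_left T)
    have e : T * (K / (j.1 + 1 : ℝ)) ^ 2 = ∫ t in Ioo 0 T, (K / (j.1 + 1 : ℝ)) ^ 2 := by
      simp [hT.le]
    rw [e]
    refine setIntegral_mono_on
      ((((hcont j).pow 2).integrableOn_Icc (a := 0) (b := T)).mono_set Ioo_subset_Icc_self)
      (by simp) measurableSet_Ioo fun t ht => ?_
    have h1 := hK j t (Ioo_subset_Icc_self ht)
    exact sq_le_sq' (neg_le_of_abs_le h1) (le_of_abs_le h1)

/-- The growing matrix entry is multiplied by a divided difference of exponentials, at most `t`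
times the larger one. Half of the exponential decay pays for the resulting factor `(k+1)² t`, which
leaves half the rate and a constant independent of the frequency. -/
theorem homMode_bound (hξ : 0 < ξ) (hρ : 0 < ρ) (hτ : 0 < τ) : ∃ K : ℝ, 0 ≤ K ∧
    ∀ (p : ℕ × Fin 2 → ℝ) (j : ℕ × Fin 2) (t : ℝ), 0 ≤ t → |homMode ξ ρ τ p j t| ≤
      K * (|p (j.1, 0)| + |p (j.1, 1)|) *
        Real.exp (-(eigBound ξ ρ * (j.1 + 1 : ℝ) ^ 2 * t / 2)) := by
  have hc := eigBound_pos hξ hρ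
  set c := eigBound ξ ρ with hcdef
  set K₂ := (ρ + 1) ^ 2 / (4 * τ ^ 2) + ρ * ξ / τ with hK₂
  have hK₂0 : 0 ≤ K₂ := by positivity
  refine ⟨4 + τ / 2 * K₂ * (2 / c), by positivity, fun p j t ht => ?_⟩
  have hn : (1 : ℝ) ≤ (j.1 + 1 : ℝ) ^ 2 := by
    have : (0 : ℝ) ≤ j.1 := Nat.cast_nonneg _
    nlinarith
  have hq := halfGap_pos hξ hρ hτ j.1
  have hqs := halfGap_sq hξ hρ hτ j.1
  set n2 := (j.1 + 1 : ℝ) ^ 2 with hn2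
  set q := halfGap ξ ρ τ j.1 with hqdef
  set E := Real.exp (-(c * n2 * t / 2)) with hE
  set E₀ := Real.exp (-(eig ξ ρ τ (j.1, 0) * t)) with hE₀
  set E₁ := Real.exp (-(eig ξ ρ τ (j.1, 1) * t)) with hE₁
  have hE₀pos : 0 < E₀ := Real.exp_pos _
  have hE₁pos : 0 < E₁ := Real.exp_pos _
  have hEpos : 0 < E := Real.exp_pos _
  have hE₀E : E₀ ≤ E * E := by
    rw [hE₀, hE, ← Real.exp_add]
    refine Real.exp_le_exp.2 ?_
    have := mul_le_mul_of_nonneg_right (le_eig_fst hξ hρ hτ j.1) ht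
    rw [← hcdef, ← hn2] at this
    linarith
  have hE1 : E ≤ 1 := Real.exp_le_one_iff.2 (by
    have : 0 ≤ c * n2 * t := by positivity
    linarith)
  have hE₀E' : E₀ ≤ E := hE₀E.trans (mul_le_of_le_one_left hEpos.le hE1)
  have hgap : E₁ = E₀ * Real.exp (-(2 * q * t)) := by
    rw [hE₁, hE₀, ← Real.exp_add, eig_fst, eig_snd]
    congr 1
    ring
  have hE₁E₀ : E₁ ≤ E₀ := by
    rw [hgap]
    refine mul_le_of_le_one_right hE₀pos.le (Real.exp_le_one_iff.2 ?_)
    have : 0 ≤ 2 * q * t := by positivity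
    linarith
  have hdiff : E₀ - E₁ ≤ E₀ * (2 * q * t) := by
    have := Real.add_one_le_exp (-(2 * q * t))
    rw [hgap]
    nlinarith
  -- This is `x exp(-x) ≤ 1` at `x = c n2 t / 2`.
  have hxE : n2 * t * E ≤ 2 / c := by
    have h1 := Real.add_one_le_exp (c * n2 * t / 2)
    have h2 : Real.exp (c * n2 * t / 2) * E = 1 := by
      rw [hE, ← Real.exp_add, add_neg_cancel, Real.exp_zero]
    rw [le_div_iff₀ hc]
    nlinarith
  have habs : |(E₀ - E₁) / (2 * q)| = (E₀ - E₁) / (2 * q) :=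
    abs_of_nonneg (div_nonneg (by linarith) (by positivity))
  have hb := abs_comb_le hξ hρ hτ (k := j.1) (p₀ := p (j.1, 0)) (p₁ := p (j.1, 1))
    (C := (E₀ + E₁) / 2) (S := (E₀ - E₁) / (2 * q)) (x := E) (y := τ / 2 * K₂ * (2 / c) * E)
    (abs_le.2 ⟨by linarith, by linarith⟩) (by
      rw [habs, div_le_div_iff₀ (by positivity) hq]
      nlinarith) (by
      rw [habs]
      have h1 : (E₀ - E₁) / (2 * q) ≤ E₀ * t := by
        rw [div_le_iff₀ (by positivity)]
        linarith
      have h2 : ρ / 2 * (ξ * n2 + 1 / τ) ≤ τ / 2 * K₂ * n2 := by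
        -- Both terms on the right are nonnegative; the splitting is `(ρ+1)² = (ρ-1)² + 4ρ`.
        have e : τ / 2 * K₂ * n2 - ρ / 2 * (ξ * n2 + 1 / τ) =
            (ρ - 1) ^ 2 / (8 * τ) * n2 + ρ / (2 * τ) * (n2 - 1) := by
          rw [hK₂]
          field_simp
          ring
        have h3 : 0 ≤ ρ / (2 * τ) * (n2 - 1) := mul_nonneg (by positivity) (by linarith)
        have h4 : 0 ≤ (ρ - 1) ^ 2 / (8 * τ) * n2 := by positivity
        linarith
      calc ρ / 2 * (ξ * n2 + 1 / τ) * ((E₀ - E₁) / (2 * q))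
          ≤ τ / 2 * K₂ * n2 * (E₀ * t) := by
            refine mul_le_mul h2 h1 (div_nonneg (by linarith) (by positivity)) (by positivity)
        _ ≤ τ / 2 * K₂ * n2 * (E * E * t) := by gcongr
        _ = τ / 2 * K₂ * (n2 * t * E) * E := by ring
        _ ≤ τ / 2 * K₂ * (2 / c) * E := by gcongr) j.2
  refine hb.trans ?_
  have hp0 := abs_nonneg (p (j.1, 0))
  have hp1 := abs_nonneg (p (j.1, 1))
  have hy : 0 ≤ τ / 2 * K₂ * (2 / c) := by positivity
  have e : (4 + τ / 2 * K₂ * (2 / c)) * (|p (j.1, 0)| + |p (j.1, 1)|) * E -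
      (4 * E * |p (j.1, 0)| + (2 * E + τ / 2 * K₂ * (2 / c) * E) * |p (j.1, 1)|) =
      τ / 2 * K₂ * (2 / c) * |p (j.1, 0)| * E + 2 * |p (j.1, 1)| * E := by ring
  have h1 : 0 ≤ τ / 2 * K₂ * (2 / c) * |p (j.1, 0)| * E := by positivity
  have h2 : 0 ≤ 2 * |p (j.1, 1)| * E := by positivity
  linarith

theorem setIntegral_exp_neg_le {b T : ℝ} (hb : 0 < b) (hT : 0 < T) :
    ∫ t in Ioo 0 T, Real.exp (-(b * t)) ≤ 1 / b := by
  have hd (x : ℝ) : HasDerivAt (fun t => -(Real.exp (-(b * t)) / b)) (Real.exp (-(b * x))) x := by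
    refine ((hasDerivAt_exp_neg_mul b x).div_const b).neg.congr_deriv ?_
    field_simp
    ring
  rw [← integral_Ioc_eq_integral_Ioo, ← intervalIntegral.integral_of_le hT.le,
    intervalIntegral.integral_eq_sub_of_hasDerivAt (fun x _ => hd x)
      (Continuous.intervalIntegrable (by fun_prop) _ _), mul_zero, neg_zero, Real.exp_zero]
  have : 0 < Real.exp (-(b * T)) / b := by positivity
  linarith

theorem summable_sq_apply_basisH10 (y₀ : Hneg1) : Summable fun j => y₀ (basisH10 j) ^ 2 := by
  refine (basisH10.hasSum_sq_inner ((InnerProductSpace.toDual ℝ (H10 ℝ)).symm y₀)).summable.congr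
    fun j => ?_
  rw [real_inner_comm, InnerProductSpace.toDual_symm_apply]

/-- Parabolic smoothing: coefficients of a datum in `H⁻¹` are `h1norm` times a square summable
sequence, and integrating the squared exponential in time gains `(k+1)⁻²`, which compensates
`h1norm²`. -/
theorem isModeFamily_homMode (hξ : 0 < ξ) (hρ : 0 < ρ) (hτ : 0 < τ) {T : ℝ} (hT : 0 < T)
    (y₀ : Hneg1) : IsModeFamily (matD ξ ρ) (matA ρ τ) vecB T y₀ 0
      (homMode ξ ρ τ fun j => y₀ (sinVec j)) := by
  set p : ℕ × Fin 2 → ℝ := fun j => y₀ (sinVec j) with hp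
  have hder (k : ℕ) (i : Fin 2) (t : ℝ) := hasDerivAt_comb_exp hξ hρ hτ
    (p₀ := p (k, 0)) (p₁ := p (k, 1)) (hasDerivAt_exp_neg_mul (eig ξ ρ τ (k, 0)) t)
    (hasDerivAt_exp_neg_mul (eig ξ ρ τ (k, 1)) t) i
  have hcont (j : ℕ × Fin 2) : Continuous (homMode ξ ρ τ p j) :=
    continuous_iff_continuousAt.2 fun t => (hder j.1 j.2 t).continuousAt
  obtain ⟨K, hK0, hK⟩ := homMode_bound hξ hρ hτ
  have hβ := summable_sq_add (summable_sq_apply_basisH10 y₀)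
  have hpβ (j : ℕ × Fin 2) : |p j| = h1norm j.1 * |y₀ (basisH10 j)| := by
    rw [basisH10_apply, map_smul, smul_eq_mul, abs_mul, abs_of_pos (inv_pos.2 (h1norm_pos _)),
      ← mul_assoc, mul_inv_cancel₀ (h1norm_pos _).ne', one_mul]
  have hc := eigBound_pos hξ hρ
  refine ⟨fun k i t => ?_, fun j => ?_,
    ⟨fun j => K * (|y₀ (basisH10 (j.1, 0))| + |y₀ (basisH10 (j.1, 1))|), ?_, ?_⟩, ?_⟩
  · refine (hder k i t).congr_deriv ?_
    simp [homMode]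
  · obtain ⟨k, i⟩ := j
    fin_cases i <;> simp [homMode, comb, hp]
  · simp_rw [mul_pow]
    exact hβ.mul_left _
  · intro j t ht
    refine (hK p j t ht.1).trans ?_
    rw [hpβ, hpβ]
    have h1 : Real.exp (-(eigBound ξ ρ * (j.1 + 1 : ℝ) ^ 2 * t / 2)) ≤ 1 :=
      Real.exp_le_one_iff.2 (by
        have : 0 ≤ eigBound ξ ρ * (j.1 + 1 : ℝ) ^ 2 * t := mul_nonneg (by positivity) ht.1
        linarith)
    have h2 := (h1norm_pos j.1).le
    refine (mul_le_of_le_one_right (by positivity) h1).trans (le_of_eq ?_)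
    ring
  -- The factor `2` comes from `1 + (k+1)² ≤ 2 (k+1)²`.
  · refine Summable.of_nonneg_of_le (fun j => integral_nonneg fun t => sq_nonneg _) (fun j => ?_)
      (hβ.mul_left (2 * K ^ 2 / eigBound ξ ρ))
    set P := |y₀ (basisH10 (j.1, 0))| + |y₀ (basisH10 (j.1, 1))| with hP
    have hn : (1 : ℝ) ≤ (j.1 + 1 : ℝ) ^ 2 := by
      have : (0 : ℝ) ≤ j.1 := Nat.cast_nonneg _
      nlinarith
    have hb : 0 < eigBound ξ ρ * (j.1 + 1 : ℝ) ^ 2 := by positivity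
    calc ∫ t in Ioo 0 T, homMode ξ ρ τ p j t ^ 2
        ≤ ∫ t in Ioo 0 T, (K * (h1norm j.1 * P)) ^ 2 *
            Real.exp (-(eigBound ξ ρ * (j.1 + 1 : ℝ) ^ 2 * t)) := by
          refine setIntegral_mono_on
            ((((hcont j).pow 2).integrableOn_Icc (a := 0) (b := T)).mono_set Ioo_subset_Icc_self)
            ((Continuous.integrableOn_Icc (a := 0) (b := T) (by fun_prop)).mono_set
              Ioo_subset_Icc_self) measurableSet_Ioo fun t ht => ?_
          have h1 := hK p j t ht.1.le
          rw [hpβ, hpβ, ← mul_add, ← hP] at h1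
          refine (sq_le_sq' (neg_le_of_abs_le h1) (le_of_abs_le h1)).trans (le_of_eq ?_)
          rw [mul_pow, ← Real.exp_nat_mul]
          congr 2
          push_cast
          ring
      _ ≤ (K * (h1norm j.1 * P)) ^ 2 * (1 / (eigBound ξ ρ * (j.1 + 1 : ℝ) ^ 2)) := by
          rw [integral_const_mul]
          exact mul_le_mul_of_nonneg_left (setIntegral_exp_neg_le hb hT) (sq_nonneg _)
      _ ≤ 2 * K ^ 2 / eigBound ξ ρ * P ^ 2 := by
          rw [mul_pow, mul_pow, h1norm_sq, mul_one_div, div_le_iff₀ hb]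
          have e : 2 * K ^ 2 / eigBound ξ ρ * P ^ 2 * (eigBound ξ ρ * (j.1 + 1 : ℝ) ^ 2) =
              K ^ 2 * ((2 * (j.1 + 1 : ℝ) ^ 2) * P ^ 2) := by
            field_simp
          rw [e]
          gcongr
          linarith

theorem IsModeFamily.add {D A : Matrix (Fin 2) (Fin 2) ℝ} {B : Vec ℝ} {T : ℝ} {y₀ y₀' : Hneg1}
    {v v' : ℝ → ℝ} {c c' : ℕ × Fin 2 → ℝ → ℝ} (h : IsModeFamily D A B T y₀ v c)
    (h' : IsModeFamily D A B T y₀' v' c') :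
    IsModeFamily D A B T (y₀ + y₀') (v + v') (fun j t => c j t + c' j t) := by
  have hsq (f g : ℕ × Fin 2 → ℝ) (j) : (f j + g j) ^ 2 ≤ 2 * f j ^ 2 + 2 * g j ^ 2 := by
    nlinarith [sq_nonneg (f j - g j)]
  obtain ⟨b, hb, hle⟩ := h.bound
  obtain ⟨b', hb', hle'⟩ := h'.bound
  refine ⟨fun k i t => ?_, fun j => ?_, ⟨fun j => b j + b' j, ?_, fun j t ht => ?_⟩, ?_⟩
  · refine ((h.hasDerivAt k i t).add (h'.hasDerivAt k i t)).congr_deriv ?_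
    rw [Pi.add_apply]
    ring
  · rw [h.initial, h'.initial, add_apply]
  · exact Summable.of_nonneg_of_le (fun j => sq_nonneg _) (hsq b b')
      ((hb.mul_left 2).add (hb'.mul_left 2))
  · rw [mul_add]
    exact (abs_add_le _ _).trans (add_le_add (hle j t ht) (hle' j t ht))
  · refine Summable.of_nonneg_of_le (fun j => integral_nonneg fun t => sq_nonneg _) (fun j => ?_)
      ((h.summable.mul_left 2).add (h'.summable.mul_left 2))
    have hi (f : ℝ → ℝ) (hf : Continuous f) : IntegrableOn (fun t => 2 * f t ^ 2) (Ioo 0 T) :=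
      (Continuous.integrableOn_Icc (a := 0) (b := T) (by fun_prop)).mono_set Ioo_subset_Icc_self
    have h1 := h.continuous j
    have h2 := h'.continuous j
    rw [← integral_const_mul, ← integral_const_mul, ← integral_add (hi _ h1) (hi _ h2)]
    refine setIntegral_mono_on
      ((Continuous.integrableOn_Icc (a := 0) (b := T) (by fun_prop)).mono_set Ioo_subset_Icc_self)
      ((hi _ h1).add (hi _ h2)) measurableSet_Ioo fun t _ => hsq (c · t) (c' · t) j

end Modes

/-! ### Density of the reachable states -/

/-- Reversing time in the control turns the final state into exponential moments. -/
theorem duhamel_comp_sub (lam : ℝ) (u : ℝ → ℝ) (T : ℝ) :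
    duhamel lam (fun r => u (T - r)) T = ∫ s in 0..T, Real.exp (-(lam * s)) * u s := by
  have h := intervalIntegral.integral_comp_sub_left (a := 0) (b := T)
    (fun s => Real.exp (-(lam * s)) * u s) T
  rw [sub_self, sub_zero] at h
  rw [← h, duhamel, ← intervalIntegral.integral_const_mul]
  refine intervalIntegral.integral_congr fun r _ => ?_
  rw [← mul_assoc, ← Real.exp_add]
  congr 2
  ring

/-- Let `G` be the Dirichlet series with coefficients `d`. The time-reversed control `(s - δ)₊ G(s)`
turns the hypothesis into `∫ (s - δ)₊ G² = 0`, so `G` vanishes on `(δ, T)` and its coefficients are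
zero. -/
theorem eq_zero_of_tsum_duhamel_eq_zero {ι : Type*} [Countable ι] {lam d : ι → ℝ}
    (hinj : Function.Injective lam) (hfin : ∀ R, {j | lam j ≤ R}.Finite) (hpos : ∀ j, 0 ≤ lam j)
    (hsum : ∀ δ > 0, Summable fun j => |d j| * Real.exp (-(lam j * δ))) {T : ℝ} (hT : 0 < T)
    (h : ∀ v, Continuous v → ∑' j, d j * duhamel (lam j) v T = 0) (j : ι) : d j = 0 := by
  set δ := T / 2 with hδ
  have hδ0 : 0 < δ := by positivity
  have hδT : δ < T := by linarith
  -- The series need not converge at `s = 0`. Freezing it below `δ` makes `G` continuous everywhere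
  -- and changes nothing, since `u` vanishes there.
  set G : ℝ → ℝ := fun s => ∑' j, d j * Real.exp (-(lam j * max s δ)) with hG
  have hle (j : ι) (s : ℝ) :
      ‖d j * Real.exp (-(lam j * max s δ))‖ ≤ |d j| * Real.exp (-(lam j * δ)) := by
    rw [norm_mul, Real.norm_eq_abs, Real.norm_of_nonneg (Real.exp_pos _).le]
    refine mul_le_mul_of_nonneg_left (Real.exp_le_exp.2 (neg_le_neg ?_)) (abs_nonneg _)
    exact mul_le_mul_of_nonneg_left (le_max_right _ _) (hpos j)
  have hGs (s : ℝ) : HasSum (fun j => d j * Real.exp (-(lam j * max s δ))) (G s) :=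
    (Summable.of_norm_bounded (hsum δ hδ0) fun j => hle j s).hasSum
  have hGc : Continuous G := continuous_tsum (fun j => by fun_prop) (hsum δ hδ0) hle
  set u : ℝ → ℝ := fun s => max (s - δ) 0 * G s with hu
  have huc : Continuous u := by fun_prop
  have hterm (j : ι) : d j * duhamel (lam j) (fun r => u (T - r)) T =
      ∫ s in 0..T, d j * Real.exp (-(lam j * max s δ)) * u s := by
    rw [duhamel_comp_sub, ← intervalIntegral.integral_const_mul]
    refine intervalIntegral.integral_congr fun s _ => ?_
    rcases le_total s δ with hs | hs
    · have : u s = 0 := by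
        simp only [hu]
        rw [max_eq_right (by linarith), zero_mul]
      rw [this, mul_zero, mul_zero, mul_zero]
    · rw [max_eq_left hs, mul_assoc]
  have hint : HasSum (fun j => ∫ s in 0..T, d j * Real.exp (-(lam j * max s δ)) * u s)
      (∫ s in 0..T, G s * u s) := by
    refine intervalIntegral.hasSum_integral_of_dominated_convergence
      (fun j s => |d j| * Real.exp (-(lam j * δ)) * |u s|)
      (fun j => (Continuous.aestronglyMeasurable (by fun_prop))) ?_ ?_ ?_ ?_
    · refine fun j => Filter.Eventually.of_forall fun s _ => ?_
      rw [norm_mul, Real.norm_eq_abs (u s)]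
      exact mul_le_mul_of_nonneg_right (hle j s) (abs_nonneg _)
    · exact Filter.Eventually.of_forall fun s _ => (hsum δ hδ0).mul_right _
    · simp_rw [tsum_mul_right]
      exact Continuous.intervalIntegrable (by fun_prop) _ _
    · exact Filter.Eventually.of_forall fun s _ => (hGs s).mul_right _
  have h0 := h (fun r => u (T - r)) (by fun_prop)
  simp_rw [hterm] at h0
  rw [hint.tsum_eq] at h0
  refine eq_zero_of_tsum_exp_eq_zero hinj hfin hpos hsum hδ0.le hδT (fun s hs => ?_) j
  by_contra hne
  have hGs0 : G s ≠ 0 := by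
    simp only [hG]
    rwa [max_eq_left hs.1.le]
  have e (x : ℝ) : G x * u x = max (x - δ) 0 * G x ^ 2 := by
    simp only [hu]
    ring
  refine (intervalIntegral.integral_pos hT (f := fun s => G s * u s)
    (Continuous.continuousOn (by fun_prop)) (fun x _ => ?_)
    ⟨s, ⟨(hδ0.trans hs.1).le, hs.2.le⟩, ?_⟩).ne' h0
  · rw [e]
    positivity
  · rw [e, max_eq_left (by linarith [hs.1])]
    have := sub_pos.2 hs.1
    positivity

theorem duhamel_add (lam : ℝ) {v v' : ℝ → ℝ} (hv : Continuous v) (hv' : Continuous v') (t : ℝ) :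
    duhamel lam (v + v') t = duhamel lam v t + duhamel lam v' t := by
  have hi (w : ℝ → ℝ) (hw : Continuous w) :
      IntervalIntegrable (fun r => Real.exp (lam * r) * w r) volume 0 t :=
    Continuous.intervalIntegrable (by fun_prop) _ _
  rw [duhamel, duhamel, duhamel, ← mul_add, ← intervalIntegral.integral_add (hi v hv) (hi v' hv')]
  simp_rw [Pi.add_apply, mul_add]

theorem duhamel_smul (lam c : ℝ) (v : ℝ → ℝ) (t : ℝ) :
    duhamel lam (c • v) t = c * duhamel lam v t := by
  simp_rw [duhamel, Pi.smul_apply, smul_eq_mul, mul_left_comm _ c,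
    intervalIntegral.integral_const_mul, mul_left_comm _ c]

theorem ctrlMode_add (ξ ρ τ : ℝ) {v v' : ℝ → ℝ} (hv : Continuous v) (hv' : Continuous v')
    (j : ℕ × Fin 2) (t : ℝ) :
    ctrlMode ξ ρ τ (v + v') j t = ctrlMode ξ ρ τ v j t + ctrlMode ξ ρ τ v' j t := by
  simp only [ctrlMode, comb, duhamel_add _ hv hv']
  split_ifs <;> ring

theorem ctrlMode_smul (ξ ρ τ c : ℝ) (v : ℝ → ℝ) (j : ℕ × Fin 2) (t : ℝ) :
    ctrlMode ξ ρ τ (c • v) j t = c * ctrlMode ξ ρ τ v j t := by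
  simp only [ctrlMode, comb, duhamel_smul]
  split_ifs <;> ring

/-- The states, represented in `H¹₀`, reached at time `T` from the initial datum zero with a
continuous control. -/
def reachable (ξ ρ τ T : ℝ) : Submodule ℝ (H10 ℝ) where
  carrier := {w | ∃ v : ℝ → ℝ, Continuous v ∧
    ∀ j, inner ℝ (basisH10 j) w = (h1norm j.1)⁻¹ * ctrlMode ξ ρ τ v j T}
  zero_mem' := by
    refine ⟨0, continuous_zero, fun j => ?_⟩
    have := ctrlMode_smul ξ ρ τ 0 0 j T
    rw [zero_smul, zero_mul] at this
    rw [inner_zero_right, this, mul_zero]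
  add_mem' := by
    rintro w w' ⟨v, hv, h⟩ ⟨v', hv', h'⟩
    refine ⟨v + v', hv.add hv', fun j => ?_⟩
    rw [inner_add_right, h, h', ctrlMode_add ξ ρ τ hv hv', mul_add]
  smul_mem' := by
    rintro c w ⟨v, hv, h⟩
    refine ⟨c • v, continuous_const.smul hv, fun j => ?_⟩
    rw [inner_H10_smul_right, h, ctrlMode_smul, mul_left_comm]

/-- The coefficients, in the functions `duhamel (eig ξ ρ τ j) v T`, of the pairing of the state with
a function of sine coefficients `p`. -/
def obsWeight (ξ ρ τ : ℝ) (p : ℕ → Fin 2 → ℝ) (j : ℕ × Fin 2) : ℝ :=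
  √(2 / Real.pi) * (j.1 + 1) * ξ * if j.2 = 0 then
    (1 / 2 + (1 - ρ) / (2 * τ) / (2 * halfGap ξ ρ τ j.1)) * p j.1 0
      + 1 / (τ * halfGap ξ ρ τ j.1) * p j.1 1
  else
    (1 / 2 - (1 - ρ) / (2 * τ) / (2 * halfGap ξ ρ τ j.1)) * p j.1 0
      - 1 / (τ * halfGap ξ ρ τ j.1) * p j.1 1

/-! ### States orthogonal to the reachable space -/

variable {ξ ρ τ T : ℝ}

theorem ctrlMode_mul_add (hξ : 0 < ξ) (hρ : 0 < ρ) (hτ : 0 < τ) (v : ℝ → ℝ) (p : ℕ → Fin 2 → ℝ)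
    (k : ℕ) (t : ℝ) :
    ctrlMode ξ ρ τ v (k, 0) t * p k 0 + ctrlMode ξ ρ τ v (k, 1) t * p k 1 =
      obsWeight ξ ρ τ p (k, 0) * duhamel (eig ξ ρ τ (k, 0)) v t +
      obsWeight ξ ρ τ p (k, 1) * duhamel (eig ξ ρ τ (k, 1)) v t := by
  have hq := (halfGap_pos hξ hρ hτ k).ne'
  simp only [ctrlMode, comb, obsWeight, if_true, one_ne_zero, if_false]
  field_simp
  ring

theorem abs_obsWeight_le (hξ : 0 < ξ) (hρ : 0 < ρ) (hτ : 0 < τ) (p : ℕ → Fin 2 → ℝ)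
    (j : ℕ × Fin 2) : |obsWeight ξ ρ τ p j| ≤
      √(2 / Real.pi) * ξ * ((j.1 + 1) * (|p j.1 0| + 2 * |p j.1 1|)) := by
  have hq := halfGap_pos hξ hρ hτ j.1
  have ha := abs_le.1 (show |(1 - ρ) / (2 * τ) / (2 * halfGap ξ ρ τ j.1)| ≤ 1 / 2 by
    rw [abs_div, abs_of_pos (show 0 < 2 * halfGap ξ ρ τ j.1 by positivity),
      div_le_iff₀ (by positivity)]
    linarith [abs_le_halfGap hξ hρ hτ j.1])
  have hb : |1 / (τ * halfGap ξ ρ τ j.1)| ≤ 2 := by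
    rw [abs_of_pos (by positivity), div_le_iff₀ (by positivity)]
    have h1 := mul_le_mul_of_nonneg_left (le_halfGap hξ hρ hτ j.1) hτ.le
    have h2 : τ * ((ρ + 1) / (2 * τ)) = (ρ + 1) / 2 := by field_simp
    linarith
  have hle {α β : ℝ} (hα : |α| ≤ 1) (hβ : |β| ≤ 2) :
      |α * p j.1 0 + β * p j.1 1| ≤ |p j.1 0| + 2 * |p j.1 1| := by
    refine (abs_add_le _ _).trans (add_le_add ?_ ?_)
    · rw [abs_mul]
      exact mul_le_of_le_one_left (abs_nonneg _) hα
    · rw [abs_mul]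
      exact mul_le_mul_of_nonneg_right hβ (abs_nonneg _)
  rw [obsWeight, abs_mul, abs_of_nonneg (by positivity)]
  refine (mul_le_mul_of_nonneg_left (b := _) (c := |p j.1 0| + 2 * |p j.1 1|) ?_
    (by positivity)).trans (le_of_eq (by ring))
  split_ifs
  · exact hle (abs_le.2 ⟨by linarith, by linarith⟩) hb
  · rw [sub_eq_add_neg (_ * _), ← neg_mul]
    exact hle (abs_le.2 ⟨by linarith, by linarith⟩) (by rwa [abs_neg])

/-- Up to a common nonzero factor the two weights add up to `p k 0`; once this vanishes, each is a
nonzero multiple of `p k 1`. Both eigendirections of every frequency are thus observed. -/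
theorem eq_zero_of_obsWeight (hξ : 0 < ξ) (hρ : 0 < ρ) (hτ : 0 < τ) {p : ℕ → Fin 2 → ℝ} {k : ℕ}
    (h : ∀ i, obsWeight ξ ρ τ p (k, i) = 0) (i : Fin 2) : p k i = 0 := by
  have hq := halfGap_pos hξ hρ hτ k
  have hc : √(2 / Real.pi) * (k + 1 : ℝ) * ξ ≠ 0 := by positivity
  have h0 := h 0
  have h1 := h 1
  simp only [obsWeight, if_true, one_ne_zero, if_false] at h0 h1
  replace h0 := (mul_eq_zero.1 h0).resolve_left hc
  replace h1 := (mul_eq_zero.1 h1).resolve_left hc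
  have hp0 : p k 0 = 0 := by linarith
  have hp1 : p k 1 = 0 := by
    rw [hp0, mul_zero, zero_add] at h0
    exact (mul_eq_zero.1 h0).resolve_left (by positivity)
  fin_cases i
  · exact hp0
  · exact hp1

theorem summable_exp_neg_eig (hξ : 0 < ξ) (hρ : 0 < ρ) (hτ : 0 < τ) {δ : ℝ} (hδ : 0 < δ) :
    Summable fun j => Real.exp (-(eig ξ ρ τ j * δ)) := by
  refine summable_of_fin_two (fun j => (Real.exp_pos _).le) fun i => ?_
  have hc := eigBound_pos hξ hρ
  refine Summable.of_nonneg_of_le (fun k => (Real.exp_pos _).le) (fun k => ?_)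
    (Real.summable_exp_nat_mul_of_ge (c := -(eigBound ξ ρ * δ))
      (by have := mul_pos hc hδ; linarith) (f := fun k => k) fun k => le_rfl)
  refine Real.exp_le_exp.2 ?_
  have h1 := mul_le_mul_of_nonneg_right (le_eig hξ hρ hτ (k, i)) hδ.le
  have h2 : (k : ℝ) ≤ (k + 1 : ℝ) ^ 2 := by
    have : (0 : ℝ) ≤ k := Nat.cast_nonneg _
    nlinarith
  have h3 := mul_le_mul_of_nonneg_left h2 (mul_pos hc hδ).le
  simp only at h1
  linarith

/-- Needed to pass from a sum over frequencies to an unordered sum over all eigenvalues. -/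
theorem summable_mul_duhamel (hξ : 0 < ξ) (hρ : 0 < ρ) (hτ : 0 < τ) (hT : 0 ≤ T) {v : ℝ → ℝ}
    (hv : Continuous v) {d : ℕ × Fin 2 → ℝ} {M : ℝ} (hd : ∀ j, |d j| ≤ M) :
    Summable fun j => d j * duhamel (eig ξ ρ τ j) v T := by
  obtain ⟨V, hV⟩ := (isCompact_Icc (a := 0) (b := T)).exists_bound_of_continuousOn hv.continuousOn
  have hV0 : 0 ≤ V := (norm_nonneg _).trans (hV T ⟨hT, le_rfl⟩)
  have hc := eigBound_pos hξ hρ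
  refine Summable.of_norm_bounded ((summable_ctrl 1).mul_left (M * (V / eigBound ξ ρ))) fun j => ?_
  have hM : 0 ≤ M := (abs_nonneg _).trans (hd j)
  rw [norm_mul]
  calc ‖d j‖ * ‖duhamel (eig ξ ρ τ j) v T‖ ≤ M * (V / (eigBound ξ ρ * (j.1 + 1 : ℝ) ^ 2)) := by
        refine mul_le_mul (hd j) ?_ (norm_nonneg _) hM
        exact (abs_duhamel_le (eig_pos hξ hρ hτ _) hV ⟨hT, le_rfl⟩).trans
          (div_le_div_of_nonneg_left hV0 (by positivity) (le_eig hξ hρ hτ j))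
    _ = M * (V / eigBound ξ ρ) * (1 / (j.1 + 1 : ℝ)) ^ 2 := by field_simp

/-- The decay of coefficients in `H¹₀` offsets the factor `k+1` in `obsWeight`, so the weights stay
bounded. -/
theorem mul_abs_coef_le (f : H10 ℝ) (j : ℕ × Fin 2) :
    (j.1 + 1 : ℝ) * |coef j.1 (valL2 f) j.2| ≤ ‖f‖ := by
  have h1 := abs_real_inner_le_norm (basisH10 j) f
  rw [basisH10.orthonormal.1 j, one_mul, inner_basisH10, abs_mul, abs_of_pos (h1norm_pos _)] at h1
  refine le_trans (mul_le_mul_of_nonneg_right ?_ (abs_nonneg _)) h1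
  exact Real.le_sqrt_of_sq_le (by linarith)

theorem exists_mem_reachable (hξ : 0 < ξ) (hρ : 0 < ρ) (hτ : 0 < τ) (hT : 0 < T) {v : ℝ → ℝ}
    (hv : Continuous v) : ∃ w : H10 ℝ,
      ∀ j, inner ℝ (basisH10 j) w = (h1norm j.1)⁻¹ * ctrlMode ξ ρ τ v j T := by
  obtain ⟨_, _, _, _, w, _, hw⟩ := (isModeFamily_ctrlMode hξ hρ hτ hT hv).exists_solution hT hv
  exact ⟨w, hw⟩

theorem reachable_orthogonal (hξ : 0 < ξ) (hρ : 0 < ρ) (hτ : 0 < τ) (hT : 0 < T)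
    (hN : Nonresonance ξ ρ τ) : (reachable ξ ρ τ T)ᗮ = ⊥ := by
  rw [Submodule.eq_bot_iff]
  intro f hf
  rw [Submodule.mem_orthogonal] at hf
  set p : ℕ → Fin 2 → ℝ := fun k i => coef k (valL2 f) i with hp
  have hM (j : ℕ × Fin 2) : |obsWeight ξ ρ τ p j| ≤ √(2 / Real.pi) * ξ * (3 * ‖f‖) := by
    refine (abs_obsWeight_le hξ hρ hτ p j).trans (mul_le_mul_of_nonneg_left ?_ (by positivity))
    have h0 := mul_abs_coef_le f (j.1, 0)
    have h1 := mul_abs_coef_le f (j.1, 1)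
    simp only [hp]
    linarith
  have hzero : ∀ v, Continuous v →
      ∑' j, obsWeight ξ ρ τ p j * duhamel (eig ξ ρ τ j) v T = 0 := by
    intro v hv
    obtain ⟨w, hw⟩ := exists_mem_reachable hξ hρ hτ hT hv
    -- Parseval in `H¹₀`; after the cancellation of `h1norm` the pairing is a sum over frequencies,
    -- rewritten in the Duhamel integrals of the single eigenvalues.
    have h1 := basisH10.hasSum_inner_mul_inner w f
    rw [hf w ⟨v, hv, hw⟩] at h1
    have h2 := hasSum_of_prod_fin_two (h1.congr_fun (g := fun j =>
      ctrlMode ξ ρ τ v j T * p j.1 j.2) fun j => by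
        rw [real_inner_comm, hw, inner_basisH10]
        have := (h1norm_pos j.1).ne'
        field_simp
        rfl)
    simp only at h2
    simp_rw [ctrlMode_mul_add hξ hρ hτ] at h2
    exact (hasSum_of_prod_fin_two
      (summable_mul_duhamel hξ hρ hτ hT.le hv hM).hasSum).unique h2
  have hd := eq_zero_of_tsum_duhamel_eq_zero (eig_injective hξ hρ hτ hN) (finite_eig_le hξ hρ hτ)
    (fun j => (eig_pos hξ hρ hτ j).le) (fun δ hδ => ?_) hT hzero
  · refine valL2_injective (eq_zero_of_coef fun k => ?_)
    ext i
    exact eq_zero_of_obsWeight hξ hρ hτ (p := p) (fun i => hd (k, i)) i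
  · refine Summable.of_nonneg_of_le (fun j => by positivity) (fun j => ?_)
      ((summable_exp_neg_eig hξ hρ hτ hδ).mul_left (√(2 / Real.pi) * ξ * (3 * ‖f‖)))
    exact mul_le_mul_of_nonneg_right (hM j) (Real.exp_pos _).le

/-! ### Approximate controllability under nonresonance -/

theorem dense_reachable (hξ : 0 < ξ) (hρ : 0 < ρ) (hτ : 0 < τ) (hT : 0 < T)
    (hN : Nonresonance ξ ρ τ) : Dense (reachable ξ ρ τ T : Set (H10 ℝ)) :=
  (Submodule.dense_iff_topologicalClosure_eq_top).2
    (Submodule.topologicalClosure_eq_top_iff.2 (reachable_orthogonal hξ hρ hτ hT hN))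

theorem approximatelyControllable_of_nonresonance (hξ : 0 < ξ) (hρ : 0 < ρ) (hτ : 0 < τ)
    (hT : 0 < T) (hN : Nonresonance ξ ρ τ) :
    ApproximatelyControllable (matD ξ ρ) (matA ρ τ) vecB T := by
  intro y₀ y₁ ε hε
  have h₀ := isModeFamily_homMode hξ hρ hτ hT y₀
  obtain ⟨_, _, _, _, w₀, _, hw₀⟩ := h₀.exists_solution hT continuous_zero
  set x₁ := (InnerProductSpace.toDual ℝ (H10 ℝ)).symm y₁ with hx₁
  -- By superposition the control need only steer zero close to the target minus the free final
  -- state `w₀`, everything being read in `H¹₀` through the Riesz isometry.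
  obtain ⟨w, ⟨v, hv, hw⟩, hdist⟩ := Metric.mem_closure_iff.1
    (dense_reachable hξ hρ hτ hT hN (x₁ - w₀)) ε hε
  have h₁ := h₀.add (isModeFamily_ctrlMode hξ hρ hτ hT hv)
  rw [add_zero, zero_add] at h₁
  obtain ⟨y, Y, hy, hY, w', hYT, hw'⟩ := h₁.exists_solution hT hv
  have hww : w' = w₀ + w := basisH10.ext_inner fun j => by
    rw [inner_add_right, hw', hw₀, hw, mul_add]
  refine ⟨v, y, Y, ?_, hy, hY, ?_⟩
  · obtain ⟨V, hV⟩ := (isCompact_Icc (a := 0) (b := T)).exists_bound_of_continuousOn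
      hv.continuousOn
    exact MemLp.of_bound hv.aestronglyMeasurable V
      ((ae_restrict_iff' measurableSet_Ioo).2 (Filter.Eventually.of_forall fun t ht =>
        hV t (Ioo_subset_Icc_self ht)))
  · have e : Y T - y₁ = innerSL ℝ (w' - x₁) := by
      rw [map_sub, hYT]
      congr 1
      exact ((InnerProductSpace.toDual ℝ (H10 ℝ)).apply_symm_apply y₁).symm
    rw [e, innerSL_apply_norm, hww, norm_sub_rev, ← sub_sub, ← dist_eq_norm]
    exact hdist.le

end PhaseField

end

theorem theorem1p1 (ξ ρ τ T : ℝ) (hξ : 0 < ξ) (hρ : 0 < ρ) (hτ : 0 < τ) (hT : 0 < T) :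
    (PhaseField.ApproximatelyControllable
        (PhaseField.matD ξ ρ) (PhaseField.matA ρ τ) PhaseField.vecB T ↔
      PhaseField.Nonresonance ξ ρ τ) ∧
    (PhaseField.Nonresonance ξ ρ τ ↔
      PhaseField.HasSimpleSpectrum (PhaseField.matD ξ ρ) (PhaseField.matA ρ τ)) ∧
    (PhaseField.Nonresonance ξ ρ τ ↔
      PhaseField.HasSimpleSpectrum
        (PhaseField.matD ξ ρ).transpose (PhaseField.matA ρ τ).transpose) :=
  ⟨⟨PhaseField.nonresonance_of_approximatelyControllable hτ hT,
      PhaseField.approximatelyControllable_of_nonresonance hξ hρ hτ hT⟩,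
    PhaseField.nonresonance_iff_hasSimpleSpectrum hξ hτ,
    PhaseField.nonresonance_iff_hasSimpleSpectrum_transpose hξ hρ hτ⟩
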